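/- **Setting.** Let $d\ge 1$, $\sigma>0$, let $\Pi^d=(\mathbb R/\mathbb Z)^d$ be the torus with its normalized Lebesgue measure, and let $1<p\le\infty$. Let $\phi\in L^1(\Pi^d)$ be an even function with $\phi\ge 0$, and let $K\in L^p(\Pi^d;\mathbb R^d)$ be such that $K=-\nabla\phi$ in the sense of distributions, with the convention $\phi(0)=0$, $K(0)=0$. For $k\le N$ and $z=(x_1,v_1,\dots,x_k,v_k)\in(\Pi^d\times\mathbb R^d)^k$ put $$e_k(z)=\sum_{i\le k}(1+|v_i|^2)+\frac1N\sum_{i,j\le k}\phi(x_i-x_j),\qquad L_k=\sum_{i\le k}v_i\cdot\nabla_{x_i}+\frac1N\sum_{i,j\le k}K(x_i-x_j)\cdot\nabla_{v_i}.$$ **Solutions.** Fix $2\le q<\infty$ and $\lambda_0>0$. A measurable function $f_N:[0,1]\times(\Pi^d\times\mathbb R^d)^N\to\mathbb R$, with initial datum $f_N^0=f_N(0)$, is called an entropy (renormalized) solution of the Liouville equation $$\partial_t f_N+L_Nf_N=\frac{\sigma^2}{2}\sum_{i\le N}\Delta_{v_i}f_N$$ if the following hold. * $f_N$ is essentially bounded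 (uniformly in $t\in[0,1]$), and each $f_N(t)$ is invariant under permutations of the particles. * For some $\beta,V>0$ one has $\sup_{t\le 1}\int e^{\beta\sum_{i}|v_i|^2}|f_N|\le V^N$. * The equation holds in the sense of distributions, integrated from $0$ to every $t\in[0,1]$ (so $f_N$ is the weakly continuous representative in time). * For all $1\le k\le N$, $T\in[0,1]$ and $0<\kappa<\lambda_0$, the marginal $f_{k,N}(t,x_1,v_1,\dots,x_k,v_k)=\int f_N\,dx_{k+1}dv_{k+1}\cdots dx_Ndv_N$ satisfies $$\int_0^T\!\!\int e^{\frac{\kappa}{1+t} e_k}\,|f_{k,N}|^{q-1}\,\mathrm{sign}(f_{k,N})\,L_kf_{k,N}\,dz\,dt\ \ge 0$$ in the following sense: there are smooth probability densities $\rho_\varepsilon$ on $\Pi^d\times\mathbb R^d$, supported in the closed ball of radius $\varepsilon$ about $0$, such that, with $f^\varepsilon_{k,N}=\rho_\varepsilon^{\otimes k}\star f_{k,N}$, $$\limsup_{R\to\infty}\ \liminf_{\varepsilon\to0}\int_0^T\!\!\int e^{\frac{\kappa}{1+t}\min(e_k,R)}\,|f^\varepsilon_{k,N}|^{q-1}\,\mathrm{sign}(f^\varepsilon_{k,N})\;\rho_\varepsilon^{\otimes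 k}\star(L_kf_{k,N})\,dz\,dt\ \ge\ 0,$$ the integrals being absolutely convergent. **Proposition.** For all $d\ge1$, $\sigma>0$ and $2\le q<\infty$ there are constants $\Lambda,C,\theta>0$, depending only on $q$, $d$ and $\sigma$, with the following property. Let $p$, $\phi$, $K$ be as above with $\frac1q+\frac1p\le 1$, and set $$\lambda(t)=\frac1{\Lambda(1+t)},\qquad L=\frac{C}{\lambda(1)^{\theta}}\,\|K\|_{L^p}^q .$$ Let $f_N$ be an entropy solution of the Liouville equation in the above sense with $\lambda_0=\lambda(0)$, and let $F_0,F>0$ be such that $$\int|f_{k,N}^0|^q\,e^{\lambda(0)e_k}\le F_0^k\quad(1\le k\le N),\qquad \sup_{t\le1}\int|f_N|^q\,e^{\lambda(t)e_N}\le F^N .$$ Then for every $T\le\min\bigl(1,\frac1{4L\max(F_0,F)}\bigr)$ (read as $T\le 1$ if $L=0$) and every $1\le k\le N$, $$\sup_{0\le t\le T}\int|f_{k,N}|^q\,e^{\lambda(t)e_k}\ \le\ 2^kF_0^k+F^k\,2^{2k-N-1}.$$ -/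

import Mathlib

open MeasureTheory Filter Topology Set
open scoped ENNReal ContDiff InnerProductSpace

noncomputable section

namespace Hierarchy

/-- The velocity space `ℝᵈ` with its Euclidean norm. -/
abbrev Vel (d : ℕ) : Type := EuclideanSpace ℝ (Fin d)

/-- The position space, the torus `Πᵈ = (ℝ/ℤ)ᵈ` with its normalized Lebesgue measure. -/
abbrev Torus (d : ℕ) : Type := UnitAddTorus (Fin d)

/-- The phase space `Πᵈ × ℝᵈ` of one particle; a point is written `(x, v)`. -/
abbrev Particle (d : ℕ) : Type := Torus d × Vel d

/-- The phase space of `n` particles, with the product Lebesgue measure. -/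
abbrev Config (d n : ℕ) : Type := Fin n → Particle d

/-- The quotient map `ℝᵈ → Πᵈ`. -/
def toTorus {d : ℕ} (h : Vel d) : Torus d := fun a => (h a : UnitAddCircle)

/-- The covering map `(ℝᵈ × ℝᵈ)ⁿ → (Πᵈ × ℝᵈ)ⁿ`. -/
def toConfig {d n : ℕ} (y : Fin n → Vel d × Vel d) : Config d n :=
  fun i => (toTorus (y i).1, (y i).2)

/-! ### Differential operators -/

/-- The gradient of a function on the torus. -/
def gradTorus {d : ℕ} (ψ : Torus d → ℝ) (x : Torus d) : Vel d :=
  gradient (fun h : Vel d => ψ (x + toTorus h)) 0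

/-- The partial gradient `∇_{x_i} ψ`. -/
def gradX {d n : ℕ} (i : Fin n) (ψ : Config d n → ℝ) (z : Config d n) : Vel d :=
  gradient (fun h : Vel d => ψ (Function.update z i ((z i).1 + toTorus h, (z i).2))) 0

/-- The partial gradient `∇_{v_i} ψ`. -/
def gradV {d n : ℕ} (i : Fin n) (ψ : Config d n → ℝ) (z : Config d n) : Vel d :=
  gradient (fun w : Vel d => ψ (Function.update z i ((z i).1, w))) (z i).2

/-- The partial Laplacian `Δ_{v_i} ψ`. -/
def laplV {d n : ℕ} (i : Fin n) (ψ : Config d n → ℝ) (z : Config d n) : ℝ :=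
  Laplacian.laplacian (fun w : Vel d => ψ (Function.update z i ((z i).1, w))) (z i).2

/-- The advection operator of `k` among `N` particles, applied to a smooth function:
`L_k ψ = ∑_{i ≤ k} v_i · ∇_{x_i} ψ + (1/N) ∑_{i, j ≤ k} K (x_i - x_j) · ∇_{v_i} ψ`. -/
def advection {d k : ℕ} (N : ℕ) (K : Torus d → Vel d) (ψ : Config d k → ℝ)
    (z : Config d k) : ℝ :=
  ∑ i, ⟪(z i).2, gradX i ψ z⟫_ℝ
    + (1 / (N : ℝ)) * ∑ i, ∑ j, ⟪K ((z i).1 - (z j).1), gradV i ψ z⟫_ℝ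

/-! ### The interaction -/

/-- `K ∈ L^p` is the repulsive kernel that derives from the even potential `φ ≥ 0`: one has
`K = - ∇ φ` in the sense of distributions on the torus, with the convention
`φ 0 = 0`, `K 0 = 0`. -/
structure IsRepulsive {d : ℕ} (p : ℝ≥0∞) (φ : Torus d → ℝ) (K : Torus d → Vel d) : Prop where
  nonneg : ∀ x, 0 ≤ φ x
  even : ∀ x, φ (-x) = φ x
  potential_zero : φ 0 = 0
  kernel_zero : K 0 = 0
  integrable : Integrable φ
  memLp : MemLp K p
  weak_gradient : ∀ ψ : Torus d → ℝ, ContDiff ℝ ∞ (fun h : Vel d => ψ (toTorus h)) →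
    ∫ x, φ x • gradTorus ψ x = ∫ x, ψ x • K x

/-- The reduced energy of `k` among `N` particles,
`e_k = ∑_{i ≤ k} (1 + |v_i|²) + (1/N) ∑_{i, j ≤ k} φ (x_i - x_j)`. -/
def energy {d k : ℕ} (N : ℕ) (φ : Torus d → ℝ) (z : Config d k) : ℝ :=
  ∑ i, (1 + ‖(z i).2‖ ^ 2) + (1 / (N : ℝ)) * ∑ i, ∑ j, φ ((z i).1 - (z j).1)

/-- The weighted integral `∫ |g|^q e^{l e_k}` over the phase space of `k` particles. -/
def weightedInt {d k : ℕ} (N : ℕ) (φ : Torus d → ℝ) (q l : ℝ) (g : Config d k → ℝ) : ℝ≥0∞ :=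
  ∫⁻ z, ENNReal.ofReal (|g z| ^ q * Real.exp (l * energy N φ z))

/-! ### Marginals -/

/-- The configuration of `N` particles whose first `k` particles are `z`, and whose other
particles are `w`. -/
def glue {d N k : ℕ} (hk : k ≤ N) (z : Config d k) (w : Config d (N - k)) : Config d N :=
  fun i => if h : (i : ℕ) < k then z ⟨i, h⟩ else w ⟨(i : ℕ) - k, by omega⟩

/-- The marginal on the first `k` particles. -/
def marginal {d N k : ℕ} (hk : k ≤ N) (g : Config d N → ℝ) (z : Config d k) : ℝ :=
  ∫ w : Config d (N - k), g (glue hk z w)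

/-! ### Weak solutions of the Liouville equation -/

/-- Smooth test functions with compact support on `ℝ × (Πᵈ × ℝᵈ)ᴺ`. -/
structure IsTestFunction {d N : ℕ} (Ψ : ℝ → Config d N → ℝ) : Prop where
  smooth : ContDiff ℝ ∞ (fun y : ℝ × (Fin N → Vel d × Vel d) => Ψ y.1 (toConfig y.2))
  compact : HasCompactSupport (Function.uncurry Ψ)

/-- `f` solves, on the time interval `[0, 1]` and in the sense of distributions,
`∂_t f + ∑ v_i · ∇_{x_i} f + (1/N) ∑_{i, j} K (x_i - x_j) · ∇_{v_i} f = (σ²/2) ∑ Δ_{v_i} f`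
with initial datum `f 0`. The identity is imposed at every time `t`: among the functions that
agree at almost every time this selects the one that is weakly continuous in time. -/
def IsWeakSolution {d N : ℕ} (σ : ℝ) (K : Torus d → Vel d) (f : ℝ → Config d N → ℝ) : Prop :=
  ∀ Ψ : ℝ → Config d N → ℝ, IsTestFunction Ψ → ∀ t ∈ Icc (0 : ℝ) 1,
    (∫ z, f t z * Ψ t z) - ∫ z, f 0 z * Ψ 0 z =
      ∫ s in (0 : ℝ)..t, ∫ z, f s z *
        (deriv (fun r => Ψ r z) s + advection N K (Ψ s) z + σ ^ 2 / 2 * ∑ i, laplV i (Ψ s) z)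

/-! ### The entropy condition -/

/-- A smooth convolution kernel on `Πᵈ × ℝᵈ`: for each `ε > 0` a smooth probability density
supported in the closed ball of radius `ε` about the origin. -/
structure IsMollifier {d : ℕ} (ρ : ℝ → Particle d → ℝ) : Prop where
  smooth : ∀ ε, 0 < ε → ContDiff ℝ ∞ (fun y : Vel d × Vel d => ρ ε (toTorus y.1, y.2))
  nonneg : ∀ ε, 0 < ε → ∀ z, 0 ≤ ρ ε z
  integral_eq_one : ∀ ε, 0 < ε → ∫ z, ρ ε z = 1
  support_subset : ∀ ε, 0 < ε → ∀ z, ρ ε z ≠ 0 → ‖z‖ ≤ ε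

/-- The tensor power `ρ^{⊗k}`. -/
def tensor {d k : ℕ} (ρ : Particle d → ℝ) (z : Config d k) : ℝ := ∏ i, ρ (z i)

/-- The convolution `ρ^{⊗k} ⋆ g`. -/
def mollify {d k : ℕ} (ρ : Particle d → ℝ) (g : Config d k → ℝ) (z : Config d k) : ℝ :=
  ∫ y, tensor ρ (z - y) * g y

/-- The convolution `ρ^{⊗k} ⋆ (L_k g)`, where `L_k g` is a distribution: as `L_k` is
antisymmetric, this is `- ∫ g(y) L_k[y ↦ ρ^{⊗k}(z - y)] dy`. -/
def mollifyAdvection {d k : ℕ} (N : ℕ) (K : Torus d → Vel d) (ρ : Particle d → ℝ)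
    (g : Config d k → ℝ) (z : Config d k) : ℝ :=
  -∫ y, g y * advection N K (fun y' => tensor ρ (z - y')) y

/-- The density `e^{l min(e_k, R)} |g_ρ|^{q-1} sign(g_ρ) (ρ^{⊗k} ⋆ L_k g)`, where
`g_ρ = ρ^{⊗k} ⋆ g`. -/
def entropyDensity {d k : ℕ} (N : ℕ) (φ : Torus d → ℝ) (K : Torus d → Vel d) (q l R : ℝ)
    (ρ : Particle d → ℝ) (g : Config d k → ℝ) (z : Config d k) : ℝ :=
  Real.exp (l * min (energy N φ z) R) * |mollify ρ g z| ^ (q - 1) * Real.sign (mollify ρ g z)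
    * mollifyAdvection N K ρ g z

/-- The rigorous form of
`∫_0^T ∫ e^{λ(t) e_k} |g|^{q-1} sign(g) L_k g dz dt ≥ 0` for a function `g` of time and of the
state of `k` particles: `g` and `L_k g` are mollified, and the lower limit is taken as the
mollification vanishes. Mollified functions need not be integrable against
`e^{λ(t) e_k}`, which may be nowhere locally integrable; the weight is therefore reached
from the bounded weights `e^{λ(t) min(e_k, R)}` as `R → ∞`. -/
def EntropyInequality {d k : ℕ} (N : ℕ) (φ : Torus d → ℝ) (K : Torus d → Vel d) (q : ℝ)
    (lam : ℝ → ℝ) (T : ℝ) (g : ℝ → Config d k → ℝ) : Prop :=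
  ∃ ρ : ℝ → Particle d → ℝ, IsMollifier ρ ∧
    (∀ R > 0, ∀ ε > 0,
      Integrable (fun y : ℝ × Config d k => entropyDensity N φ K q (lam y.1) R (ρ ε) (g y.1) y.2)
        ((volume.restrict (Icc 0 T)).prod volume)) ∧
    0 ≤ limsup (fun R : ℝ => liminf (fun ε : ℝ =>
        ((∫ t in Icc 0 T, ∫ z, entropyDensity N φ K q (lam t) R (ρ ε) (g t) z : ℝ) : EReal))
      (𝓝[>] 0)) atTop

/-- `f` is an entropy (renormalized) solution of the Liouville equation of `N` exchangeable
particles on `[0, 1]`: a bounded, symmetric weak solution with Gaussian decay in velocity, all of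
whose marginals satisfy the entropy inequality with exponent `q`, on every interval `[0, T]` and
for every weight `λ(t) = κ / (1 + t)` with `κ < λ₀`. -/
structure IsEntropySolution {d N : ℕ} (σ : ℝ) (φ : Torus d → ℝ) (K : Torus d → Vel d)
    (q lam₀ : ℝ) (f : ℝ → Config d N → ℝ) : Prop where
  measurable : Measurable (Function.uncurry f)
  bounded : ∃ M : ℝ, ∀ t ∈ Icc (0 : ℝ) 1, ∀ᵐ z, |f t z| ≤ M
  symmetric : ∀ t ∈ Icc (0 : ℝ) 1, ∀ π : Equiv.Perm (Fin N), ∀ᵐ z, f t (z ∘ π) = f t z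
  gaussian_decay : ∃ β > 0, ∃ V > 0, ∀ t ∈ Icc (0 : ℝ) 1,
    ∫⁻ z, ENNReal.ofReal (Real.exp (β * ∑ i, ‖(z i).2‖ ^ 2) * |f t z|) ≤ ENNReal.ofReal (V ^ N)
  weak_solution : IsWeakSolution σ K f
  entropy : ∀ (k : ℕ) (hk : k ≤ N), 1 ≤ k → ∀ T ∈ Icc (0 : ℝ) 1, ∀ κ : ℝ, 0 < κ → κ < lam₀ →
    EntropyInequality N φ K q (fun t => κ / (1 + t)) T (fun t => marginal hk (f t))

/-- The weight exponent `λ(t) = 1 / (Λ (1 + t))`. -/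
def lam (Lam t : ℝ) : ℝ := 1 / (Lam * (1 + t))

/-- The rate `L = C λ(1)^{-θ} ‖K‖_{L^p}^q`. -/
def rate {d : ℕ} (Lam C θ : ℝ) (p : ℝ≥0∞) (q : ℝ) (K : Torus d → Vel d) : ℝ :=
  C / lam Lam 1 ^ θ * (eLpNorm K p volume).toReal ^ q

end Hierarchy

end

open Hierarchy

open Hierarchy

noncomputable section

namespace Hierarchy

/-! ### Measure theory of the phase space -/

section Instances

variable (d n : ℕ)

instance : IsProbabilityMeasure (volume : Measure UnitAddCircle) :=
  ⟨UnitAddCircle.measure_univ⟩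

instance : IsProbabilityMeasure (volume : Measure (Torus d)) :=
  inferInstanceAs (IsProbabilityMeasure (Measure.pi fun _ => volume))

instance : MeasurableAdd (Torus d) := inferInstance

instance : MeasurableAdd (Vel d) := inferInstance

instance : (volume : Measure (Torus d)).IsAddHaarMeasure := inferInstance

instance : SigmaFinite (volume : Measure (Particle d)) :=
  inferInstanceAs (SigmaFinite (Measure.prod volume volume))

instance : BorelSpace (Particle d) := inferInstance

instance : MeasurableAdd₂ (Particle d) := ⟨by
  exact (continuous_fst.add continuous_snd).measurable⟩

instance : MeasurableAdd (Particle d) := inferInstance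

instance : MeasurableNeg (Particle d) := ⟨continuous_neg.measurable⟩

instance : (volume : Measure (Particle d)).IsAddHaarMeasure :=
  Measure.prod.instIsAddHaarMeasure (volume : Measure (Torus d)) (volume : Measure (Vel d))

instance : (volume : Measure (Particle d)).IsNegInvariant := inferInstance

instance : BorelSpace (Config d n) := Pi.borelSpace

instance : SecondCountableTopology (Config d n) := inferInstance

instance : (volume : Measure (Config d n)).IsAddLeftInvariant := inferInstance

instance : (volume : Measure (Config d n)).IsNegInvariant := inferInstance

instance : SigmaFinite (volume : Measure (Config d n)) := inferInstance

end Instances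

/-! ### Smooth functions on the phase space -/

section Covering

variable {d n : ℕ}

lemma toTorus_add (h h' : Vel d) : toTorus (h + h') = toTorus h + toTorus h' := by
  ext a; simp [toTorus]

@[simp] lemma toTorus_zero : toTorus (0 : Vel d) = 0 := by
  ext a; simp [toTorus]

lemma toTorus_neg (h : Vel d) : toTorus (-h) = -toTorus h := by
  ext a; simp [toTorus]

lemma toConfig_add (y y' : Fin n → Vel d × Vel d) :
    toConfig (y + y') = toConfig y + toConfig y' := by
  ext i a <;> simp [toConfig, toTorus_add]

@[simp] lemma toConfig_zero : toConfig (0 : Fin n → Vel d × Vel d) = 0 := by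
  ext i a <;> simp [toConfig]

lemma toConfig_neg (y : Fin n → Vel d × Vel d) : toConfig (-y) = -toConfig y := by
  ext i a <;> simp [toConfig, toTorus_neg]

lemma toConfig_sub (y y' : Fin n → Vel d × Vel d) :
    toConfig (y - y') = toConfig y - toConfig y' := by
  rw [sub_eq_add_neg, toConfig_add, toConfig_neg, sub_eq_add_neg]

lemma isOpenQuotientMap_toTorus : IsOpenQuotientMap (toTorus : Vel d → Torus d) := by
  have h1 : IsOpenQuotientMap (Pi.map fun _ : Fin d => ((↑) : ℝ → UnitAddCircle)) :=
    IsOpenQuotientMap.piMap fun _ => QuotientAddGroup.isOpenQuotientMap_mk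
  exact h1.comp (EuclideanSpace.equiv (Fin d) ℝ).toHomeomorph.isOpenQuotientMap

lemma isOpenQuotientMap_toConfig :
    IsOpenQuotientMap (toConfig : (Fin n → Vel d × Vel d) → Config d n) :=
  IsOpenQuotientMap.piMap fun _ => isOpenQuotientMap_toTorus.prodMap IsOpenQuotientMap.id

lemma continuous_toConfig : Continuous (toConfig : (Fin n → Vel d × Vel d) → Config d n) :=
  isOpenQuotientMap_toConfig.continuous

/-- Smooth functions on the phase space, through their lift to the covering space. -/
def IsSmooth (η : Config d n → ℝ) : Prop :=
  ContDiff ℝ ∞ fun y : Fin n → Vel d × Vel d => η (toConfig y)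

/-- The derivative of a function on the phase space in the direction `e`. -/
def dirDeriv (e : Fin n → Vel d × Vel d) (η : Config d n → ℝ) (z : Config d n) : ℝ :=
  deriv (fun s : ℝ => η (z + toConfig (s • e))) 0

/-- The direction of the coordinate `a` of the velocity of the particle `i`. -/
def dirV (i : Fin n) (a : Fin d) : Fin n → Vel d × Vel d :=
  Pi.single i (0, EuclideanSpace.single a 1)

lemma IsSmooth.continuous {η : Config d n → ℝ} (h : IsSmooth η) : Continuous η :=
  isOpenQuotientMap_toConfig.isQuotientMap.continuous_iff.2 (ContDiff.continuous h)

lemma IsSmooth.measurable {η : Config d n → ℝ} (h : IsSmooth η) : Measurable η :=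
  h.continuous.measurable

lemma dirDeriv_toConfig {η : Config d n → ℝ} (h : IsSmooth η) (e y : Fin n → Vel d × Vel d) :
    dirDeriv e η (toConfig y) = fderiv ℝ (fun y => η (toConfig y)) y e := by
  have h1 : DifferentiableAt ℝ (fun y => η (toConfig y)) y :=
    (ContDiff.differentiable h (by simp)) y
  rw [← h1.lineDeriv_eq_fderiv, lineDeriv, dirDeriv]
  simp_rw [toConfig_add]

lemma IsSmooth.dirDeriv {η : Config d n → ℝ} (h : IsSmooth η) (e : Fin n → Vel d × Vel d) :
    IsSmooth (dirDeriv e η) := by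
  unfold IsSmooth
  simp_rw [dirDeriv_toConfig h]
  exact (ContDiff.fderiv_right (m := ∞) h (by simp)).clm_apply contDiff_const

lemma dirDeriv_add_line (η : Config d n → ℝ) (e : Fin n → Vel d × Vel d) (z : Config d n)
    (s : ℝ) : Hierarchy.dirDeriv e η (z + toConfig (s • e)) =
      deriv (fun s : ℝ => η (z + toConfig (s • e))) s := by
  have := deriv_comp_add_const (fun r : ℝ => η (z + toConfig (r • e))) s 0
  rw [zero_add] at this
  rw [← this, Hierarchy.dirDeriv]
  simp_rw [add_smul, toConfig_add, add_assoc, add_comm (toConfig (s • e))]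

lemma IsSmooth.hasDerivAt {η : Config d n → ℝ} (h : IsSmooth η) (e : Fin n → Vel d × Vel d)
    (z : Config d n) (s : ℝ) :
    HasDerivAt (fun s : ℝ => η (z + toConfig (s • e)))
      (Hierarchy.dirDeriv e η (z + toConfig (s • e))) s := by
  rw [dirDeriv_add_line, hasDerivAt_deriv_iff]
  obtain ⟨y, rfl⟩ := isOpenQuotientMap_toConfig.surjective z
  simp_rw [← toConfig_add]
  exact ((ContDiff.differentiable h (by simp)) _).comp s (by fun_prop)

lemma IsSmooth.hasDerivAt_zero {η : Config d n → ℝ} (h : IsSmooth η)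
    (e : Fin n → Vel d × Vel d) (z : Config d n) :
    HasDerivAt (fun s : ℝ => η (z + toConfig (s • e))) (Hierarchy.dirDeriv e η z) 0 := by
  simpa using h.hasDerivAt e z 0

lemma IsSmooth.mul {η ζ : Config d n → ℝ} (h : IsSmooth η) (h' : IsSmooth ζ) :
    IsSmooth fun z => η z * ζ z :=
  ContDiff.mul h h'

lemma IsSmooth.comp_sub {η : Config d n → ℝ} (h : IsSmooth η) (z : Config d n) :
    IsSmooth fun y => η (z - y) := by
  obtain ⟨y, rfl⟩ := isOpenQuotientMap_toConfig.surjective z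
  unfold IsSmooth
  simp_rw [← toConfig_sub]
  exact ContDiff.comp (g := fun y => η (toConfig y)) h (contDiff_const.sub contDiff_id)

lemma dirDeriv_mul {η ζ : Config d n → ℝ} (h : IsSmooth η) (h' : IsSmooth ζ)
    (e : Fin n → Vel d × Vel d) (z : Config d n) :
    dirDeriv e (fun z => η z * ζ z) z = dirDeriv e η z * ζ z + η z * dirDeriv e ζ z := by
  have := (h.hasDerivAt_zero e z).mul (h'.hasDerivAt_zero e z)
  simp only [zero_smul, toConfig_zero, add_zero] at this
  exact this.deriv

lemma dirDeriv_comp_sub {η : Config d n → ℝ} (h : IsSmooth η) (e : Fin n → Vel d × Vel d)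
    (z y : Config d n) :
    dirDeriv e (fun y => η (z - y)) y = -dirDeriv e η (z - y) := by
  have h1 := (h.hasDerivAt_zero e (z - y))
  have h2 : HasDerivAt (fun s : ℝ => -s) (-1) 0 := hasDerivAt_neg 0
  have h3 : HasDerivAt (fun s : ℝ => η (z - y + toConfig (s • e))) (dirDeriv e η (z - y)) (-0) := by
    simpa using h1
  have h4 := h3.scomp (0 : ℝ) h2
  have h5 : (fun s : ℝ => η (z - (y + toConfig (s • e)))) =
      (fun s : ℝ => η (z - y + toConfig (s • e))) ∘ fun s => -s := by
    ext s
    change η (z - (y + toConfig (s • e))) = η (z - y + toConfig ((-s) • e))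
    rw [neg_smul, toConfig_neg]; congr 1; abel
  rw [dirDeriv, h5, h4.deriv]; simp

lemma dirDeriv_neg (η : Config d n → ℝ) (e : Fin n → Vel d × Vel d) (z : Config d n) :
    dirDeriv e (fun z => -η z) z = -dirDeriv e η z := by
  simp [dirDeriv]

lemma hasCompactSupport_dirDeriv {η : Config d n → ℝ} (h : HasCompactSupport η)
    (e : Fin n → Vel d × Vel d) : HasCompactSupport (dirDeriv e η) := by
  refine HasCompactSupport.intro h fun z hz => ?_
  have h1 : ∀ᶠ s : ℝ in 𝓝 0, η (z + toConfig (s • e)) = 0 := by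
    have hc : ContinuousAt (fun s : ℝ => z + toConfig (s • e)) 0 :=
      (continuous_const.add (continuous_toConfig.comp (by fun_prop))).continuousAt
    have h2 : (tsupport η)ᶜ ∈ 𝓝 (z + toConfig ((0 : ℝ) • e)) := by
      simpa using (isClosed_tsupport η).isOpen_compl.mem_nhds hz
    filter_upwards [hc.preimage_mem_nhds h2] with s hs
    exact image_eq_zero_of_notMem_tsupport hs
  exact (Filter.EventuallyEq.deriv_eq (f := fun _ => (0 : ℝ)) h1).trans (by simp)

lemma exists_bound_of_compactSupport {η : Config d n → ℝ} (hη : IsSmooth η)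
    (h : HasCompactSupport η) : ∃ B, 0 ≤ B ∧ ∀ z, |η z| ≤ B := by
  obtain ⟨B, hB⟩ := h.exists_bound_of_continuous hη.continuous
  exact ⟨B, (norm_nonneg _).trans (hB 0), hB⟩

lemma update_velocity (z : Config d n) (i : Fin n) (x w : Vel d) (s : ℝ) :
    Function.update z i ((z i).1, x + s • w) =
      Function.update z i ((z i).1, x) + toConfig (s • Pi.single i (0, w)) := by
  ext j a <;> rcases eq_or_ne j i with rfl | hj <;> simp [toConfig, *]

lemma update_position (z : Config d n) (i : Fin n) (w : Vel d) (s : ℝ) :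
    Function.update z i ((z i).1 + toTorus (s • w), (z i).2) =
      z + toConfig (s • Pi.single i (w, 0)) := by
  ext j a <;> rcases eq_or_ne j i with rfl | hj <;> simp [toConfig, toTorus, *]

lemma IsSmooth.contDiff_position {η : Config d n → ℝ} (h : IsSmooth η) (z : Config d n)
    (i : Fin n) :
    ContDiff ℝ ∞ fun w : Vel d => η (Function.update z i ((z i).1 + toTorus w, (z i).2)) := by
  obtain ⟨y, rfl⟩ := isOpenQuotientMap_toConfig.surjective z
  have h1 (w : Vel d) : Function.update (toConfig y) i
      (((toConfig y) i).1 + toTorus w, ((toConfig y) i).2) =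
        toConfig (y + Pi.single i (w, 0)) := by
    have := update_position (toConfig y) i w 1
    rwa [one_smul, one_smul, ← toConfig_add] at this
  simp_rw [h1]
  refine ContDiff.comp (g := fun y => η (toConfig y)) h ?_
  refine contDiff_const.add ?_
  exact (ContinuousLinearMap.single ℝ (fun _ : Fin n => Vel d × Vel d) i).contDiff.comp
    (contDiff_id.prodMk contDiff_const)

lemma IsSmooth.contDiff_velocity {η : Config d n → ℝ} (h : IsSmooth η) (z : Config d n)
    (i : Fin n) :
    ContDiff ℝ ∞ fun w : Vel d => η (Function.update z i ((z i).1, w)) := by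
  obtain ⟨y, rfl⟩ := isOpenQuotientMap_toConfig.surjective z
  have h1 (w : Vel d) : Function.update (toConfig y) i (((toConfig y) i).1, w) =
        toConfig (y + Pi.single i (0, w - (y i).2)) := by
    have := update_velocity (toConfig y) i ((toConfig y) i).2 (w - (y i).2) 1
    rw [one_smul, one_smul, Prod.mk.eta, Function.update_eq_self, ← toConfig_add] at this
    simpa [toConfig] using this
  simp_rw [h1]
  refine ContDiff.comp (g := fun y => η (toConfig y)) h ?_
  refine contDiff_const.add ?_
  exact (ContinuousLinearMap.single ℝ (fun _ : Fin n => Vel d × Vel d) i).contDiff.comp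
    (contDiff_const.prodMk (contDiff_id.sub contDiff_const))

lemma inner_gradX {η : Config d n → ℝ} (h : IsSmooth η) (i : Fin n) (w : Vel d)
    (z : Config d n) : ⟪w, gradX i η z⟫_ℝ = dirDeriv (Pi.single i (w, 0)) η z := by
  rw [real_inner_comm, gradX, inner_gradient_left, ← DifferentiableAt.lineDeriv_eq_fderiv
    ((h.contDiff_position z i).differentiable (by simp) _), lineDeriv, dirDeriv]
  simp_rw [zero_add, update_position]

lemma fderiv_velocity {η : Config d n → ℝ} (h : IsSmooth η) (i : Fin n) (x w : Vel d)
    (z : Config d n) : fderiv ℝ (fun w : Vel d => η (Function.update z i ((z i).1, w))) x w =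
      dirDeriv (Pi.single i (0, w)) η (Function.update z i ((z i).1, x)) := by
  rw [← DifferentiableAt.lineDeriv_eq_fderiv
    ((h.contDiff_velocity z i).differentiable (by simp) _), lineDeriv, dirDeriv]
  simp_rw [update_velocity]

lemma inner_gradV {η : Config d n → ℝ} (h : IsSmooth η) (i : Fin n) (w : Vel d)
    (z : Config d n) : ⟪w, gradV i η z⟫_ℝ = dirDeriv (Pi.single i (0, w)) η z := by
  rw [real_inner_comm, gradV, inner_gradient_left, fderiv_velocity h, Prod.mk.eta,
    Function.update_eq_self]

lemma laplV_eq_sum {η : Config d n → ℝ} (h : IsSmooth η) (i : Fin n) (z : Config d n) :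
    laplV i η z = ∑ a, dirDeriv (dirV i a) (dirDeriv (dirV i a) η) z := by
  rw [laplV, InnerProductSpace.laplacian_eq_iteratedFDeriv_orthonormalBasis _
    (EuclideanSpace.basisFun (Fin d) ℝ)]
  refine Finset.sum_congr rfl fun a _ => ?_
  rw [iteratedFDeriv_two_apply]
  have h1 := h.contDiff_velocity z i
  have h2 : Differentiable ℝ (fderiv ℝ fun w : Vel d => η (Function.update z i ((z i).1, w))) :=
    (h1.fderiv_right (m := ∞) (by simp)).differentiable (by simp)
  have h3 := (((h2 (z i).2).hasFDerivAt).clm_apply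
    (hasFDerivAt_const (EuclideanSpace.single a (1 : ℝ)) (z i).2)).fderiv
  simp_rw [fderiv_velocity h] at h3
  have h4 := fderiv_velocity (h.dirDeriv (dirV i a)) i (z i).2 (EuclideanSpace.single a 1) z
  rw [Prod.mk.eta, Function.update_eq_self] at h4
  change _ = dirDeriv (Pi.single i (0, EuclideanSpace.single a 1)) (dirDeriv (dirV i a) η) z
  rw [← h4]
  unfold dirV
  rw [h3]
  simp

/-- The partial gradient in the velocity in coordinates. -/
lemma inner_gradV_eq_sum {η : Config d n → ℝ} (h : IsSmooth η) (i : Fin n) (w : Vel d)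
    (z : Config d n) : ⟪w, gradV i η z⟫_ℝ = ∑ a, w a * dirDeriv (dirV i a) η z := by
  rw [PiLp.inner_apply]
  refine Finset.sum_congr rfl fun a _ => ?_
  have := inner_gradV h i (EuclideanSpace.single a 1) z
  rw [EuclideanSpace.inner_single_left] at this
  simp only [map_one, one_mul] at this
  rw [this, dirV]
  simp [mul_comm]

end Covering

/-! ### Convolutions -/

section Convolution

variable {d n : ℕ}

/-- The convolution `η ⋆ g` on the phase space. -/
def conv (η g : Config d n → ℝ) (z : Config d n) : ℝ := ∫ y, η (z - y) * g y

lemma integrable_bdd_mul' {X : Type*} [MeasurableSpace X] {μ : Measure X} {f g : X → ℝ} {B : ℝ}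
    (hf : AEStronglyMeasurable f μ) (hB : ∀ x, |f x| ≤ B) (hg : Integrable g μ) :
    Integrable (fun x => f x * g x) μ :=
  hg.bdd_mul hf (ae_of_all _ hB)

lemma abs_integral_bdd_mul_le {X : Type*} [MeasurableSpace X] {μ : Measure X} {f g : X → ℝ}
    {B : ℝ} (hB : ∀ x, |f x| ≤ B) (hg : Integrable g μ) :
    |∫ x, f x * g x ∂μ| ≤ B * ∫ x, |g x| ∂μ := by
  rw [← integral_const_mul]
  refine (norm_integral_le_integral_norm _).trans
    (integral_mono_of_nonneg (ae_of_all _ fun x => norm_nonneg (f x * g x)) (hg.abs.const_mul B)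
      (ae_of_all _ fun x => ?_))
  simp only [Real.norm_eq_abs, abs_mul]
  exact mul_le_mul_of_nonneg_right (hB x) (abs_nonneg _)

lemma abs_conv_le {η g : Config d n → ℝ} {B : ℝ} (hB : ∀ z, |η z| ≤ B) (hg : Integrable g)
    (z : Config d n) : |conv η g z| ≤ B * ∫ y, |g y| :=
  abs_integral_bdd_mul_le (fun y => hB (z - y)) hg

lemma measurable_conv {X : Type*} [MeasurableSpace X] {η : Config d n → ℝ}
    {g : X → Config d n → ℝ} (hη : Measurable η) (hg : Measurable (Function.uncurry g)) :
    Measurable fun p : X × Config d n => conv η (g p.1) p.2 := by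
  refine (StronglyMeasurable.integral_prod_right (f := fun (p : X × Config d n) y =>
    η (p.2 - y) * g p.1 y) ?_).measurable
  refine Measurable.stronglyMeasurable ?_
  refine (hη.comp ((measurable_snd.comp measurable_fst).sub measurable_snd)).mul ?_
  exact hg.comp ((measurable_fst.comp measurable_fst).prodMk measurable_snd)

lemma measurable_conv_right {η g : Config d n → ℝ} (hη : Measurable η) (hg : Measurable g) :
    Measurable (conv η g) :=
  (measurable_conv (X := Unit) (g := fun _ => g) hη (hg.comp measurable_snd)).comp
    (measurable_const (a := ()) |>.prodMk measurable_id)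

lemma hasDerivAt_conv {η g : Config d n → ℝ} (hη : IsSmooth η) (hc : HasCompactSupport η)
    (hg : Integrable g) (e : Fin n → Vel d × Vel d) (z : Config d n) (s : ℝ) :
    HasDerivAt (fun s : ℝ => conv η g (z + toConfig (s • e)))
      (conv (dirDeriv e η) g (z + toConfig (s • e))) s := by
  obtain ⟨B, hB0, hB⟩ := exists_bound_of_compactSupport hη hc
  obtain ⟨B', hB0', hB'⟩ := exists_bound_of_compactSupport (hη.dirDeriv e)
    (hasCompactSupport_dirDeriv hc e)
  have hm (η : Config d n → ℝ) (hη : IsSmooth η) (z : Config d n) :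
      AEStronglyMeasurable (fun y => η (z - y)) volume :=
    (hη.measurable.comp (measurable_const.sub measurable_id)).aestronglyMeasurable
  refine (hasDerivAt_integral_of_dominated_loc_of_deriv_le (s := univ)
    (F := fun (s : ℝ) y => η (z + toConfig (s • e) - y) * g y)
    (F' := fun (s : ℝ) y => dirDeriv e η (z + toConfig (s • e) - y) * g y)
    (bound := fun y => B' * |g y|) univ_mem
    (Eventually.of_forall fun s => (hm η hη _).mul hg.1)
    (integrable_bdd_mul' (hm η hη _) (fun y => hB _) hg)
    ((hm _ (hη.dirDeriv e) _).mul hg.1)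
    (ae_of_all _ fun y s _ => ?_) (hg.abs.const_mul _) (ae_of_all _ fun y s _ => ?_)).2
  · rw [norm_mul]
    exact mul_le_mul_of_nonneg_right (hB' _) (norm_nonneg _)
  · have := (hη.hasDerivAt e (z - y) s).mul_const (g y)
    have h2 (s : ℝ) : z + toConfig (s • e) - y = z - y + toConfig (s • e) := by abel
    simp_rw [h2]
    exact this

lemma lintegral_enorm_conv_le {η g : Config d n → ℝ} (hη : Measurable η) (hg : Measurable g) :
    ∫⁻ z, ‖conv η g z‖ₑ ≤ (∫⁻ z, ‖η z‖ₑ) * ∫⁻ z, ‖g z‖ₑ := by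
  calc ∫⁻ z, ‖conv η g z‖ₑ ≤ ∫⁻ z, ∫⁻ y, ‖η (z - y)‖ₑ * ‖g y‖ₑ := by
        refine lintegral_mono fun z => (enorm_integral_le_lintegral_enorm _).trans ?_
        simp_rw [enorm_mul]; exact le_rfl
    _ = ∫⁻ y, ∫⁻ z, ‖η (z - y)‖ₑ * ‖g y‖ₑ := by
        refine lintegral_lintegral_swap (Measurable.aemeasurable ?_)
        exact ((hη.comp (measurable_fst.sub measurable_snd)).enorm.mul
          (hg.comp measurable_snd).enorm)
    _ = ∫⁻ y, (∫⁻ z, ‖η z‖ₑ) * ‖g y‖ₑ := by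
        refine lintegral_congr fun y => ?_
        rw [lintegral_mul_const _ (by exact (hη.comp (measurable_id.sub_const y)).enorm),
          lintegral_sub_right_eq_self (fun z => ‖η z‖ₑ)]
    _ = _ := lintegral_const_mul _ hg.enorm

lemma integrable_conv {η g : Config d n → ℝ} (hη : IsSmooth η) (hc : HasCompactSupport η)
    (hgm : Measurable g) (hg : Integrable g) : Integrable (conv η g) := by
  refine ⟨(measurable_conv_right hη.measurable hgm).aestronglyMeasurable, ?_⟩
  refine (lintegral_enorm_conv_le hη.measurable hgm).trans_lt ?_
  exact ENNReal.mul_lt_top (hη.continuous.integrable_of_hasCompactSupport hc).2 hg.2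

/-- Continuity of translations in `L¹`. -/
lemma tendsto_lintegral_translate {g : Config d n → ℝ} (hg : Integrable g) :
    Tendsto (fun y => ∫⁻ z, ‖g (z - y) - g z‖ₑ) (𝓝 0) (𝓝 0) := by
  have : Fact ((1 : ℝ≥0∞) ≠ ⊤) := ⟨ENNReal.one_ne_top⟩
  have : ContinuousVAdd (Config d n)ᵈᵃᵃ (Lp ℝ 1 (volume : Measure (Config d n))) :=
    Lp.instContinuousVAddDomAddAct
  have hL : MemLp g 1 volume := memLp_one_iff_integrable.2 hg
  have hcont : Continuous fun y : Config d n => DomAddAct.mk (-y) +ᵥ hL.toLp g :=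
    (DomAddAct.continuous_mk.comp continuous_neg).vadd continuous_const
  have h1 := (tendsto_iff_edist_tendsto_0.1 (hcont.tendsto 0))
  refine h1.congr fun y => ?_
  rw [DomAddAct.mk_vadd_toLp, DomAddAct.mk_vadd_toLp, Lp.edist_toLp_toLp,
    eLpNorm_one_eq_lintegral_enorm]
  refine lintegral_congr fun z => ?_
  simp [sub_eq_add_neg, add_comm]

end Convolution

/-! ### Mollifiers -/

section Mollifier

variable {d n : ℕ}

/-- A smooth compactly supported probability density on the phase space, supported in the closed
ball of radius `ε`. -/
structure IsBump (ε : ℝ) (η : Config d n → ℝ) : Prop where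
  smooth : IsSmooth η
  compact : HasCompactSupport η
  nonneg : ∀ z, 0 ≤ η z
  integral_eq_one : ∫ z, η z = 1
  support_subset : ∀ z, η z ≠ 0 → ‖z‖ ≤ ε

lemma IsMollifier.isBump_tensor {ρ : ℝ → Particle d → ℝ} (h : IsMollifier ρ) {ε : ℝ}
    (hε : 0 < ε) : IsBump ε (tensor (ρ ε) : Config d n → ℝ) where
  smooth := by
    unfold IsSmooth tensor
    refine contDiff_prod fun i _ => ?_
    exact (h.smooth ε hε).comp (contDiff_apply ℝ (Vel d × Vel d) i)
  compact := by
    refine HasCompactSupport.intro (K := univ.pi fun _ => univ ×ˢ Metric.closedBall 0 ε)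
      (isCompact_univ_pi fun _ => isCompact_univ.prod (isCompact_closedBall _ _)) fun z hz => ?_
    simp only [Set.mem_pi, mem_univ, true_implies, mem_prod, true_and, not_forall,
      mem_closedBall_zero_iff] at hz
    obtain ⟨i, hi⟩ := hz
    refine Finset.prod_eq_zero (Finset.mem_univ i) ?_
    by_contra h0
    exact hi ((norm_snd_le _).trans (h.support_subset ε hε _ h0))
  nonneg z := Finset.prod_nonneg fun i _ => h.nonneg ε hε _
  integral_eq_one := by
    unfold tensor
    rw [integral_fintype_prod_volume_eq_prod (fun _ => ρ ε)]
    simp [h.integral_eq_one ε hε]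
  support_subset z hz := by
    refine (pi_norm_le_iff_of_nonneg hε.le).2 fun i => h.support_subset ε hε _ ?_
    exact fun h0 => hz (Finset.prod_eq_zero (Finset.mem_univ i) h0)

variable {ε : ℝ} {η : Config d n → ℝ}

lemma IsBump.integrable (h : IsBump ε η) : Integrable η :=
  h.smooth.continuous.integrable_of_hasCompactSupport h.compact

lemma IsBump.lintegral_eq_one (h : IsBump ε η) : ∫⁻ z, ‖η z‖ₑ = 1 := by
  have := ofReal_integral_norm_eq_lintegral_enorm h.integrable
  rw [← this]
  simp_rw [Real.norm_eq_abs, abs_of_nonneg (h.nonneg _), h.integral_eq_one, ENNReal.ofReal_one]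

lemma IsBump.lintegral_le (h : IsBump ε η) {T : Config d n → ℝ≥0∞} {c : ℝ≥0∞}
    (hT : ∀ y, ‖y‖ ≤ ε → T y ≤ c) : ∫⁻ y, ‖η y‖ₑ * T y ≤ c := by
  calc ∫⁻ y, ‖η y‖ₑ * T y ≤ ∫⁻ y, ‖η y‖ₑ * c := by
        refine lintegral_mono fun y => ?_
        by_cases h0 : η y = 0
        · simp [h0]
        · exact mul_le_mul_right (hT y (h.support_subset y h0)) _
    _ = c := by
        rw [lintegral_mul_const _ h.smooth.measurable.enorm, h.lintegral_eq_one, one_mul]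

lemma exists_translate_le {g : Config d n → ℝ} (hg : Integrable g) {δ : ℝ≥0∞} (hδ : 0 < δ) :
    ∃ r > 0, ∀ y, ‖y‖ ≤ r → ∫⁻ z, ‖g (z - y) - g z‖ₑ ≤ δ := by
  have h1 := (tendsto_lintegral_translate hg).eventually (ge_mem_nhds hδ)
  obtain ⟨r, hr, h2⟩ := Metric.eventually_nhds_iff.1 h1
  refine ⟨r / 2, by positivity, fun y hy => h2 ?_⟩
  rw [dist_zero_right]; linarith

/-- Mollification converges in `L¹`. -/
lemma exists_lintegral_conv_sub_le {g : Config d n → ℝ} (hgm : Measurable g) (hg : Integrable g)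
    {δ : ℝ≥0∞} (hδ : 0 < δ) :
    ∃ r > 0, ∀ (ε : ℝ) (η : Config d n → ℝ), IsBump ε η → ε ≤ r →
      ∫⁻ z, ‖conv η g z - g z‖ₑ ≤ δ := by
  obtain ⟨r, hr, h⟩ := exists_translate_le hg hδ
  refine ⟨r, hr, fun ε η hη hε => ?_⟩
  obtain ⟨B, hB0, hB⟩ := exists_bound_of_compactSupport hη.smooth hη.compact
  have h1 (z : Config d n) : ‖conv η g z - g z‖ₑ ≤ ∫⁻ y, ‖η y‖ₑ * ‖g (z - y) - g z‖ₑ := by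
    have h2 : conv η g z - g z = ∫ y, η y * (g (z - y) - g z) := by
      have h3 : conv η g z = ∫ y, η y * g (z - y) := by
        rw [conv, ← integral_sub_left_eq_self _ _ z]
        simp
      have h4 : Integrable fun y => η y * g (z - y) :=
        integrable_bdd_mul' hη.smooth.measurable.aestronglyMeasurable hB
          ((integrable_comp_sub_left g z).2 hg)
      simp_rw [mul_sub]
      rw [integral_sub h4 (hη.integrable.mul_const _), integral_mul_const, hη.integral_eq_one,
        one_mul, h3]
    rw [h2]
    refine (enorm_integral_le_lintegral_enorm _).trans ?_
    simp_rw [enorm_mul]; exact le_rfl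
  calc ∫⁻ z, ‖conv η g z - g z‖ₑ ≤ ∫⁻ z, ∫⁻ y, ‖η y‖ₑ * ‖g (z - y) - g z‖ₑ := lintegral_mono h1
    _ = ∫⁻ y, ∫⁻ z, ‖η y‖ₑ * ‖g (z - y) - g z‖ₑ := by
        refine lintegral_lintegral_swap (Measurable.aemeasurable ?_)
        exact ((hη.smooth.measurable.comp measurable_snd).enorm.mul
          ((hgm.comp (measurable_fst.sub measurable_snd)).sub (hgm.comp measurable_fst)).enorm)
    _ = ∫⁻ y, ‖η y‖ₑ * ∫⁻ z, ‖g (z - y) - g z‖ₑ := by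
        refine lintegral_congr fun y => ?_
        rw [lintegral_const_mul]
        exact ((hgm.comp (measurable_id.sub_const y)).sub hgm).enorm
    _ ≤ δ := hη.lintegral_le fun y hy => h y (hy.trans hε)

/-- Jensen's inequality for mollification. -/
lemma IsBump.enorm_conv_rpow_le (hη : IsBump ε η) {g : Config d n → ℝ} (hgm : Measurable g)
    {q : ℝ} (hq : 1 ≤ q) (z : Config d n) :
    ‖conv η g z‖ₑ ^ q ≤ ∫⁻ y, ‖η y‖ₑ * ‖g (z - y)‖ₑ ^ q := by
  set ν : Measure (Config d n) := volume.withDensity fun y => ‖η y‖ₑ with hν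
  have hprob : IsProbabilityMeasure ν := ⟨by
    rw [hν, withDensity_apply _ MeasurableSet.univ, Measure.restrict_univ, hη.lintegral_eq_one]⟩
  have hgz : Measurable fun y => g (z - y) := hgm.comp (measurable_const.sub measurable_id)
  have h1 : ‖conv η g z‖ₑ ≤ ∫⁻ y, ‖g (z - y)‖ₑ ∂ν := by
    rw [hν, lintegral_withDensity_eq_lintegral_mul _ hη.smooth.measurable.enorm hgz.enorm, conv,
      ← integral_sub_left_eq_self _ _ z]
    refine (enorm_integral_le_lintegral_enorm _).trans (lintegral_mono fun y => ?_)
    simp [enorm_mul]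
  have h2 := eLpNorm'_le_eLpNorm'_of_exponent_le one_pos hq ν hgz.aestronglyMeasurable
  simp only [eLpNorm', ENNReal.rpow_one, div_one] at h2
  calc ‖conv η g z‖ₑ ^ q ≤ ((∫⁻ y, ‖g (z - y)‖ₑ ^ q ∂ν) ^ (1 / q)) ^ q :=
        ENNReal.rpow_le_rpow (h1.trans h2) (by linarith)
    _ = ∫⁻ y, ‖g (z - y)‖ₑ ^ q ∂ν := by
        rw [← ENNReal.rpow_mul, one_div_mul_cancel (by linarith), ENNReal.rpow_one]
    _ = _ := by
        rw [hν, lintegral_withDensity_eq_lintegral_mul _ hη.smooth.measurable.enorm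
          (hgz.enorm.pow_const q)]
        rfl

/-- Weighted `L^q` norms of mollified functions, for bounded weights. -/
lemma exists_lintegral_conv_rpow_le {g : Config d n → ℝ} (hgm : Measurable g) {q : ℝ}
    (hq : 1 ≤ q) (hg : Integrable fun z => |g z| ^ q) {δ : ℝ≥0∞} (hδ : 0 < δ) :
    ∃ r > 0, ∀ (ε : ℝ) (η : Config d n → ℝ), IsBump ε η → ε ≤ r →
      ∀ (W : Config d n → ℝ≥0∞) (c : ℝ≥0∞), Measurable W → (∀ z, W z ≤ c) →
      ∫⁻ z, W z * ‖conv η g z‖ₑ ^ q ≤ (∫⁻ z, W z * ‖g z‖ₑ ^ q) + c * δ := by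
  obtain ⟨r, hr, h⟩ := exists_translate_le hg hδ
  refine ⟨r, hr, fun ε η hη hε W c hWm hW => ?_⟩
  have hgq (z : Config d n) : ‖g z‖ₑ ^ q = ‖|g z| ^ q‖ₑ := by
    rw [Real.enorm_rpow_of_nonneg (abs_nonneg _) (by linarith), Real.enorm_abs]
  have hm : Measurable fun z => |g z| ^ q := hgm.abs.pow_const q
  calc ∫⁻ z, W z * ‖conv η g z‖ₑ ^ q
      ≤ ∫⁻ z, ∫⁻ y, ‖η y‖ₑ * (W z * ‖g (z - y)‖ₑ ^ q) := by
        refine lintegral_mono fun z => ?_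
        refine (mul_le_mul_right (hη.enorm_conv_rpow_le hgm hq z) _).trans ?_
        rw [← lintegral_const_mul]
        · exact lintegral_mono fun y => by rw [mul_left_comm]
        · exact hη.smooth.measurable.enorm.mul
            ((hgm.comp (measurable_const.sub measurable_id)).enorm.pow_const q)
    _ = ∫⁻ y, ∫⁻ z, ‖η y‖ₑ * (W z * ‖g (z - y)‖ₑ ^ q) := by
        refine lintegral_lintegral_swap (Measurable.aemeasurable ?_)
        exact (hη.smooth.measurable.comp measurable_snd).enorm.mul ((hWm.comp measurable_fst).mul
          ((hgm.comp (measurable_fst.sub measurable_snd)).enorm.pow_const q))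
    _ = ∫⁻ y, ‖η y‖ₑ * ∫⁻ z, W z * ‖g (z - y)‖ₑ ^ q := by
        refine lintegral_congr fun y => ?_
        rw [lintegral_const_mul]
        exact hWm.mul ((hgm.comp (measurable_id.sub_const y)).enorm.pow_const q)
    _ ≤ _ := hη.lintegral_le fun y hy => ?_
  calc ∫⁻ z, W z * ‖g (z - y)‖ₑ ^ q
      ≤ ∫⁻ z, (W z * ‖g z‖ₑ ^ q + c * ‖|g (z - y)| ^ q - |g z| ^ q‖ₑ) := by
        refine lintegral_mono fun z => ?_
        rw [hgq, hgq]
        calc W z * ‖|g (z - y)| ^ q‖ₑ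
            ≤ W z * (‖|g z| ^ q‖ₑ + ‖|g (z - y)| ^ q - |g z| ^ q‖ₑ) := by
              refine mul_le_mul_right ?_ _
              have := enorm_add_le (|g z| ^ q) (|g (z - y)| ^ q - |g z| ^ q)
              simpa using this
          _ ≤ _ := by
              rw [mul_add]
              exact add_le_add_right (mul_le_mul_left (hW z) _) _
    _ = (∫⁻ z, W z * ‖g z‖ₑ ^ q) + c * ∫⁻ z, ‖|g (z - y)| ^ q - |g z| ^ q‖ₑ := by
        rw [lintegral_add_left (by exact hWm.mul (hgm.enorm.pow_const q)), lintegral_const_mul]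
        exact ((hm.comp (measurable_id.sub_const y)).sub hm).enorm
    _ ≤ _ := add_le_add_right (mul_le_mul_right (h y (hy.trans hε)) _) _

end Mollifier

/-! ### Integration by parts along lines -/

section Lines

variable {d n : ℕ}

lemma continuous_line (e : Fin n → Vel d × Vel d) :
    Continuous fun s : ℝ => (toConfig (s • e) : Config d n) :=
  continuous_toConfig.comp (by fun_prop)

/-- The shift by a random point of a line preserves the Lebesgue measure. -/
lemma measurePreserving_line (e : Fin n → Vel d × Vel d) :
    MeasurePreserving (fun p : ℝ × Config d n => p.2 + toConfig (p.1 • e))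
      ((volume.restrict (Ioc (0 : ℝ) 1)).prod volume) volume := by
  have : IsProbabilityMeasure (volume.restrict (Ioc (0 : ℝ) 1)) := ⟨by simp⟩
  have h1 : MeasurePreserving (fun p : ℝ × Config d n => (p.1, p.2 + toConfig (p.1 • e)))
      ((volume.restrict (Ioc (0 : ℝ) 1)).prod volume)
      ((volume.restrict (Ioc (0 : ℝ) 1)).prod volume) := by
    refine (MeasurePreserving.id _).skew_product (g := fun s z => z + toConfig (s • e)) ?_
      (ae_of_all _ fun s => map_add_right_eq_self _ _)
    exact (continuous_snd.add ((continuous_line e).comp continuous_fst)).measurable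
  exact measurePreserving_snd.comp h1

/-- The integral of a derivative along lines vanishes. -/
lemma integral_lineDeriv_eq_zero (e : Fin n → Vel d × Vel d) {Q Q' : Config d n → ℝ}
    (hQ : Integrable Q) (hQ' : Integrable Q')
    (hcont : ∀ z, Continuous fun s : ℝ => Q (z + toConfig (s • e)))
    (hderiv : ∀ z, ∃ S : Set ℝ, S.Countable ∧ ∀ s ∉ S,
      HasDerivAt (fun s : ℝ => Q (z + toConfig (s • e))) (Q' (z + toConfig (s • e))) s) :
    ∫ z, Q' z = 0 := by
  have hint : Integrable (fun p : ℝ × Config d n => Q' (p.2 + toConfig (p.1 • e)))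
      ((volume.restrict (Ioc (0 : ℝ) 1)).prod volume) :=
    (measurePreserving_line e).integrable_comp_of_integrable hQ'
  have h1 : ∀ᵐ z : Config d n, ∫ s in Ioc (0 : ℝ) 1, Q' (z + toConfig (s • e)) =
      Q (z + toConfig ((1 : ℝ) • e)) - Q z := by
    filter_upwards [hint.prod_left_ae] with z hz
    obtain ⟨S, hS, h⟩ := hderiv z
    have := integral_eq_of_hasDerivAt_off_countable
      (fun s : ℝ => Q (z + toConfig (s • e))) (fun s => Q' (z + toConfig (s • e)))
      (a := 0) (b := 1) hS (hcont z).continuousOn (fun s hs => h s hs.2)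
      ((intervalIntegrable_iff_integrableOn_Ioc_of_le zero_le_one).2 hz)
    rw [← intervalIntegral.integral_of_le zero_le_one, this]
    simp
  have h2 : ∫ z : Config d n, ∫ s in Ioc (0 : ℝ) 1, Q' (z + toConfig (s • e)) = ∫ z, Q' z := by
    rw [← integral_integral_swap hint]
    simp_rw [integral_add_right_eq_self Q']
    simp
  rw [← h2, integral_congr_ae h1, integral_sub (hQ.comp_add_right _) hQ,
    integral_add_right_eq_self Q, sub_self]

end Lines

/-! ### Powers and chain rules -/

section Chain

lemma abs_rpow_mul_sign (q u : ℝ) :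
    |u| ^ (q - 1) * Real.sign u = |u| ^ (q - 2) * u := by
  rcases eq_or_ne u 0 with rfl | hu
  · simp
  · have h1 : |u| ^ (q - 1) = |u| ^ (q - 2) * |u| := by
      rw [← Real.rpow_add_one (abs_pos.2 hu).ne']; ring_nf
    rw [h1, mul_assoc]
    congr 1
    rcases lt_or_gt_of_ne hu with h | h
    · rw [Real.sign_of_neg h, abs_of_neg h]; ring
    · rw [Real.sign_of_pos h, abs_of_pos h]; ring

lemma abs_rpow_mul_sq {q : ℝ} (hq : 2 ≤ q) (u : ℝ) : |u| ^ (q - 2) * u ^ 2 = |u| ^ q := by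
  rw [← sq_abs, ← Real.rpow_natCast, ← Real.rpow_add' (abs_nonneg _) (by norm_num; linarith)]
  norm_num

lemma hasDerivAt_abs_rpow_mul {q : ℝ} (hq : 2 ≤ q) (u : ℝ) :
    HasDerivAt (fun u : ℝ => |u| ^ (q - 2) * u) ((q - 1) * |u| ^ (q - 2)) u := by
  rcases hq.eq_or_lt with rfl | hq
  · norm_num
    exact hasDerivAt_id' u
  rcases eq_or_ne u 0 with rfl | hu
  · rw [abs_zero, Real.zero_rpow (by linarith), mul_zero, hasDerivAt_iff_tendsto_slope]
    have h1 : Tendsto (fun u : ℝ => |u| ^ (q - 2)) (𝓝[≠] 0) (𝓝 0) := by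
      have : Continuous fun u : ℝ => |u| ^ (q - 2) :=
        continuous_abs.rpow_const fun _ => Or.inr (by linarith)
      have := this.tendsto 0
      rw [abs_zero, Real.zero_rpow (by linarith)] at this
      exact this.mono_left nhdsWithin_le_nhds
    refine h1.congr' ?_
    filter_upwards [self_mem_nhdsWithin] with u hu
    have hu : u ≠ 0 := hu
    simp [slope_def_field, hu]
  · have h1 := ((hasDerivAt_abs hu).rpow_const (p := q - 2) (Or.inl (abs_pos.2 hu).ne')).mul
      (hasDerivAt_id u)
    refine h1.congr_deriv ?_
    have h2 : |u| ^ (q - 2) = |u| ^ (q - 2 - 1) * |u| := by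
      rw [← Real.rpow_add_one (abs_pos.2 hu).ne']; ring_nf
    have h3 : (SignType.sign u : ℝ) * u = |u| := sign_mul_self u
    rw [h2, ← h3, id, mul_one]
    ring

lemma absolutelyContinuousOnInterval_comp {u Φ : ℝ → ℝ} {a b : ℝ}
    (hu : AbsolutelyContinuousOnInterval u a b) (hΦ : ContDiff ℝ 1 Φ) :
    AbsolutelyContinuousOnInterval (fun t => Φ (u t)) a b := by
  obtain ⟨C, hC⟩ := hu.exists_bound
  obtain ⟨K, hK⟩ := (hΦ.contDiffOn (s := Icc (-C) C)).exists_lipschitzOnWith (by decide)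
    (convex_Icc _ _) isCompact_Icc
  have hmem (t : ℝ) (ht : t ∈ uIcc a b) : u t ∈ Icc (-C) C := abs_le.1 (hC t ht)
  rw [absolutelyContinuousOnInterval_iff] at hu ⊢
  intro ε hε
  obtain ⟨δ, hδ, h⟩ := hu (ε / (K + 1)) (by positivity)
  refine ⟨δ, hδ, fun E hE hlt => ?_⟩
  have h1 := h E hE hlt
  rw [lt_div_iff₀ (by positivity)] at h1
  calc ∑ i ∈ Finset.range E.1, dist (Φ (u (E.2 i).1)) (Φ (u (E.2 i).2))
      ≤ ∑ i ∈ Finset.range E.1, K * dist (u (E.2 i).1) (u (E.2 i).2) :=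
        Finset.sum_le_sum fun i hi => hK.dist_le_mul _ (hmem _ (hE.1 i hi).1) _
          (hmem _ (hE.1 i hi).2)
    _ ≤ (∑ i ∈ Finset.range E.1, dist (u (E.2 i).1) (u (E.2 i).2)) * (K + 1) := by
        rw [← Finset.mul_sum, mul_comm]
        exact mul_le_mul_of_nonneg_left (by linarith) (Finset.sum_nonneg fun _ _ => dist_nonneg)
    _ < ε := h1

lemma contDiff_abs_rpow {q : ℝ} (hq : 2 ≤ q) : ContDiff ℝ 1 fun u : ℝ => |u| ^ q := by
  have h (u : ℝ) := hasDerivAt_abs_rpow u (p := q) (by linarith)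
  refine contDiff_one_iff_deriv.2 ⟨fun u => (h u).differentiableAt, ?_⟩
  have : deriv (fun u : ℝ => |u| ^ q) = fun u => q * |u| ^ (q - 2) * u := by
    ext u; exact (h u).deriv
  rw [this]
  exact (continuous_const.mul (continuous_abs.rpow_const fun _ => Or.inr (by linarith))).mul
    continuous_id

/-- The chain rule for `e^{κ w / (1 + t)} |u(t)|^q`, where `u` has the integrable derivative
`D`. -/
lemma weighted_power_sub_eq_integral {u D : ℝ → ℝ} {T q : ℝ} (hq : 2 ≤ q) (hT : 0 ≤ T)
    (hD : IntervalIntegrable D volume 0 T)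
    (hu : ∀ t ∈ Icc 0 T, u t = u 0 + ∫ s in (0 : ℝ)..t, D s) (κ w : ℝ) :
    Real.exp (κ / (1 + T) * w) * |u T| ^ q - Real.exp (κ * w) * |u 0| ^ q =
      ∫ s in (0 : ℝ)..T, Real.exp (κ / (1 + s) * w) *
        (q * (|u s| ^ (q - 2) * u s) * D s - κ / (1 + s) ^ 2 * w * |u s| ^ q) := by
  set v : ℝ → ℝ := fun t => u 0 + ∫ s in (0 : ℝ)..t, D s with hv
  have huv (t : ℝ) (ht : t ∈ Icc 0 T) : u t = v t := hu t ht
  have hIcc : uIcc 0 T = Icc 0 T := uIcc_of_le hT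
  have hac : AbsolutelyContinuousOnInterval v 0 T := by
    have h1 := hD.absolutelyContinuousOnInterval_intervalIntegral (c := 0) (by simp)
    have h2 : AbsolutelyContinuousOnInterval (fun _ : ℝ => u 0) 0 T :=
      contDiffOn_const.absolutelyContinuousOnInterval
    exact h2.add h1
  have hE (t : ℝ) (ht : t ∈ Icc 0 T) : HasDerivAt (fun s => Real.exp (κ / (1 + s) * w))
      (Real.exp (κ / (1 + t) * w) * (-(κ / (1 + t) ^ 2) * w)) t := by
    have h0 : (1 + t) ≠ 0 := by have := ht.1; positivity
    have h1 : HasDerivAt (fun s : ℝ => 1 + s) 1 t := by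
      simpa using (hasDerivAt_id t).const_add 1
    have h2 := (((h1.fun_inv h0).const_mul κ).mul_const w).exp
    simp only [← div_eq_mul_inv] at h2
    convert h2 using 2
    ring
  have hEac : AbsolutelyContinuousOnInterval (fun s => Real.exp (κ / (1 + s) * w)) 0 T := by
    refine ContDiffOn.absolutelyContinuousOnInterval ?_
    rw [hIcc]
    refine Real.contDiff_exp.comp_contDiffOn (ContDiffOn.mul ?_ contDiffOn_const)
    refine ContDiffOn.div contDiffOn_const (by fun_prop) fun t ht => ?_
    have := ht.1; positivity
  have hmain := (hEac.fun_mul (absolutelyContinuousOnInterval_comp hac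
    (contDiff_abs_rpow hq))).integral_deriv_eq_sub
  have h0 : (0 : ℝ) ∈ Icc 0 T := ⟨le_rfl, hT⟩
  rw [huv T ⟨hT, le_rfl⟩, huv 0 h0]
  simp only [add_zero, div_one] at hmain
  rw [← hmain]
  refine intervalIntegral.integral_congr_ae ?_
  filter_upwards [hD.ae_hasDerivAt_integral] with s hs hs'
  have hs2 : s ∈ Icc 0 T := by
    rw [uIoc_of_le hT] at hs'; exact Ioc_subset_Icc_self hs'
  have h1 : HasDerivAt v (D s) s := by
    have := hs (by rwa [hIcc]) 0 (by rwa [hIcc])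
    exact this.const_add (u 0)
  have h2 := (hE s hs2).mul ((hasDerivAt_abs_rpow (v s) (p := q) (by linarith)).comp s h1)
  rw [huv s hs2]
  refine h2.deriv.trans ?_
  simp only [Function.comp]
  ring

end Chain

/-! ### Marginals -/

section Marginal

variable {d N k : ℕ}

/-- The first `k` particles of a configuration. -/
def fstPart (hk : k ≤ N) (y : Config d N) : Config d k := fun i => y (Fin.castLE hk i)

@[simp] lemma fstPart_glue (hk : k ≤ N) (z : Config d k) (w : Config d (N - k)) :
    fstPart hk (glue hk z w) = z := by
  ext i : 1
  simp [fstPart, glue]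

lemma measurable_fstPart (hk : k ≤ N) : Measurable (fstPart hk : Config d N → Config d k) :=
  measurable_pi_lambda _ fun _ => measurable_pi_apply _

lemma measurable_glue (hk : k ≤ N) :
    Measurable fun p : Config d k × Config d (N - k) => glue hk p.1 p.2 := by
  refine measurable_pi_lambda _ fun i => ?_
  unfold glue
  split_ifs with h
  · exact (measurable_pi_apply _).comp measurable_fst
  · exact (measurable_pi_apply _).comp measurable_snd

@[to_additive]
lemma prod_fin_split {M : Type*} [CommMonoid M] (hk : k ≤ N) (a : Fin N → M) :
    ∏ i, a i = (∏ i : Fin k, a (Fin.castLE hk i)) *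
      ∏ i : Fin (N - k), a ⟨k + i, by omega⟩ := by
  obtain ⟨m, rfl⟩ := Nat.exists_eq_add_of_le hk
  rw [Fin.prod_univ_add]
  congr 1
  refine Fintype.prod_equiv (finCongr (by omega)) _ _ fun i => ?_
  rfl

lemma measurePreserving_glue (hk : k ≤ N) :
    MeasurePreserving (fun p : Config d k × Config d (N - k) => glue hk p.1 p.2)
      (volume.prod volume) volume := by
  refine ⟨measurable_glue hk, ?_⟩
  refine (Measure.pi_eq fun s hs => ?_).symm
  have h1 : (fun p : Config d k × Config d (N - k) => glue hk p.1 p.2) ⁻¹' (univ.pi s) =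
      (univ.pi fun i : Fin k => s (Fin.castLE hk i)) ×ˢ
        (univ.pi fun i : Fin (N - k) => s ⟨k + i, by omega⟩) := by
    ext ⟨z, w⟩
    simp only [mem_preimage, Set.mem_pi, mem_univ, true_implies, mem_prod]
    constructor
    · refine fun h => ⟨fun i => ?_, fun i => ?_⟩
      · simpa [glue] using h (Fin.castLE hk i)
      · simpa [glue] using h ⟨k + i, by omega⟩
    · rintro ⟨h1, h2⟩ i
      unfold glue
      split_ifs with h
      · exact h1 ⟨i, h⟩
      · have := h2 ⟨(i : ℕ) - k, by omega⟩
        convert this using 2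
        ext; simp; omega
  rw [Measure.map_apply (measurable_glue hk) (MeasurableSet.univ_pi hs), h1, Measure.prod_prod,
    volume_pi, volume_pi, Measure.pi_pi, Measure.pi_pi, prod_fin_split hk]

lemma measurable_marginal {X : Type*} [MeasurableSpace X] (hk : k ≤ N) {f : X → Config d N → ℝ}
    (hf : Measurable (Function.uncurry f)) :
    Measurable (Function.uncurry fun x => marginal hk (f x)) := by
  refine (StronglyMeasurable.integral_prod_right (f := fun (p : X × Config d k) w =>
    f p.1 (glue hk p.2 w)) ?_).measurable
  refine (hf.comp ((measurable_fst.comp measurable_fst).prodMk ?_)).stronglyMeasurable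
  exact (measurable_glue hk).comp ((measurable_snd.comp measurable_fst).prodMk measurable_snd)

lemma integrable_marginal_mul (hk : k ≤ N) {g : Config d N → ℝ} {ζ : Config d k → ℝ}
    (h : Integrable fun y => g y * ζ (fstPart hk y)) :
    Integrable fun z => marginal hk g z * ζ z := by
  have h1 := ((measurePreserving_glue hk).integrable_comp_of_integrable h).integral_prod_left
  refine h1.congr (ae_of_all _ fun z => ?_)
  simp [marginal, integral_mul_const, Function.comp]

lemma integral_marginal_mul (hk : k ≤ N) {g : Config d N → ℝ} {ζ : Config d k → ℝ}
    (h : Integrable fun y => g y * ζ (fstPart hk y)) :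
    ∫ z, marginal hk g z * ζ z = ∫ y, g y * ζ (fstPart hk y) := by
  have h0 := (measurePreserving_glue (d := d) hk).map_eq
  have h1 := (measurePreserving_glue hk).integrable_comp_of_integrable h
  rw [← h0, integral_map (measurable_glue hk).aemeasurable (by rw [h0]; exact h.1)]
  rw [integral_prod _ (by exact h1)]
  refine integral_congr_ae (ae_of_all _ fun z => ?_)
  simp [marginal, integral_mul_const]

lemma integrable_marginal (hk : k ≤ N) {g : Config d N → ℝ} (h : Integrable g) :
    Integrable (marginal hk g) := by
  simpa using integrable_marginal_mul (ζ := fun _ => 1) hk (by simpa using h)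

lemma integral_abs_marginal_le (hk : k ≤ N) {g : Config d N → ℝ} (h : Integrable g) :
    ∫ z, |marginal hk g z| ≤ ∫ y, |g y| := by
  have h1 := integral_marginal_mul (ζ := fun _ => 1) hk (g := fun y => |g y|)
    (by simpa using h.abs)
  simp only [mul_one] at h1
  rw [← h1]
  refine integral_mono (integrable_marginal hk h).abs (integrable_marginal hk h.abs) fun z => ?_
  exact abs_integral_le_integral_abs

lemma marginal_self (g : Config d N → ℝ) : marginal (le_refl N) g = g := by
  ext z
  have : Unique (Config d (N - N)) :=
    { default := fun i => absurd i.2 (by simp)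
      uniq := fun a => by ext i : 1; exact absurd i.2 (by simp) }
  have h1 (w : Config d (N - N)) : g (glue (le_refl N) z w) = g z := by
    congr 1; ext i : 1; simp [glue]
  simp_rw [marginal, h1]
  have h2 : (volume : Measure (Config d (N - N))) univ = 1 := by
    rw [← Set.pi_univ, volume_pi, Measure.pi_pi]
    have : IsEmpty (Fin (N - N)) := ⟨fun i => absurd i.2 (by simp)⟩
    simp
  simp [measureReal_def, h2]

/-- Permutations of the particles preserve the Lebesgue measure. -/
lemma measurePreserving_perm (π : Equiv.Perm (Fin N)) :
    MeasurePreserving (fun y : Config d N => y ∘ π) volume volume := by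
  have := volume_measurePreserving_piCongrLeft (fun _ : Fin N => Particle d) π.symm
  convert this using 1
  ext y i : 2
  obtain ⟨j, rfl⟩ := π.symm.surjective i
  rw [MeasurableEquiv.coe_piCongrLeft, Equiv.piCongrLeft_apply_apply]
  simp

/-- The configuration of `k + 1` particles with last particle `p`. -/
def snocConfig (z : Config d k) (p : Particle d) : Config d (k + 1) :=
  Fin.snoc (α := fun _ => Particle d) z p

@[simp] lemma snocConfig_castSucc (z : Config d k) (p : Particle d) (i : Fin k) :
    snocConfig z p i.castSucc = z i := by
  simp [snocConfig]

@[simp] lemma snocConfig_last (z : Config d k) (p : Particle d) :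
    snocConfig z p (Fin.last k) = p := by
  simp [snocConfig]

@[simp] lemma fstPart_snocConfig (z : Config d k) (p : Particle d) :
    fstPart k.le_succ (snocConfig z p) = z := by
  ext i : 1
  exact snocConfig_castSucc z p i

lemma measurable_snocConfig :
    Measurable fun p : Config d k × Particle d => snocConfig p.1 p.2 := by
  refine measurable_pi_lambda _ fun i => ?_
  induction i using Fin.lastCases with
  | last => simpa using measurable_snd
  | cast i => simpa using! (measurable_pi_apply i).comp measurable_fst

lemma measurePreserving_snocConfig :
    MeasurePreserving (fun p : Config d k × Particle d => snocConfig p.1 p.2)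
      (volume.prod volume) volume := by
  refine ⟨measurable_snocConfig, ?_⟩
  refine (Measure.pi_eq fun s hs => ?_).symm
  have h1 : (fun p : Config d k × Particle d => snocConfig p.1 p.2) ⁻¹' (univ.pi s) =
      (univ.pi fun i : Fin k => s i.castSucc) ×ˢ s (Fin.last k) := by
    ext ⟨z, p⟩
    simp only [mem_preimage, Set.mem_pi, mem_univ, true_implies, mem_prod]
    constructor
    · refine fun h => ⟨fun i => ?_, ?_⟩
      · simpa using h i.castSucc
      · simpa using h (Fin.last k)
    · rintro ⟨h1, h2⟩ i
      induction i using Fin.lastCases with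
      | last => simpa using h2
      | cast i => simpa using h1 i
  rw [Measure.map_apply measurable_snocConfig (MeasurableSet.univ_pi hs), h1, Measure.prod_prod,
    volume_pi, Measure.pi_pi, Fin.prod_univ_castSucc]

end Marginal

/-! ### The generator -/

section Generator

variable {d N : ℕ}

/-- The direction of the coordinate `a` of the position of the particle `i`. -/
def dirX (i : Fin N) (a : Fin d) : Fin N → Vel d × Vel d :=
  Pi.single i (EuclideanSpace.single a 1, 0)

lemma inner_gradX_eq_sum {η : Config d N → ℝ} (h : IsSmooth η) (i : Fin N) (w : Vel d)
    (z : Config d N) : ⟪w, gradX i η z⟫_ℝ = ∑ a, w a * dirDeriv (dirX i a) η z := by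
  rw [PiLp.inner_apply]
  refine Finset.sum_congr rfl fun a _ => ?_
  have := inner_gradX h i (EuclideanSpace.single a 1) z
  rw [EuclideanSpace.inner_single_left] at this
  simp only [map_one, one_mul] at this
  rw [this, dirX]
  simp [mul_comm]

/-- The adjoint of the Liouville operator with diffusion, `L_N ψ + (σ²/2) ∑ Δ_{v_i} ψ`. -/
def generator (σ : ℝ) (N₀ : ℕ) (K : Torus d → Vel d) (ψ : Config d N → ℝ) (z : Config d N) : ℝ :=
  advection N₀ K ψ z + σ ^ 2 / 2 * ∑ i, laplV i ψ z

lemma advection_eq (N₀ : ℕ) (K : Torus d → Vel d) {ψ : Config d N → ℝ} (h : IsSmooth ψ)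
    (z : Config d N) : advection N₀ K ψ z =
      (∑ i, ∑ a, (z i).2 a * dirDeriv (dirX i a) ψ z) + 1 / (N₀ : ℝ) *
        ∑ i, ∑ j, ∑ a, K ((z i).1 - (z j).1) a * dirDeriv (dirV i a) ψ z := by
  simp_rw [advection, inner_gradX_eq_sum h, inner_gradV_eq_sum h]

lemma generator_eq (σ : ℝ) (N₀ : ℕ) (K : Torus d → Vel d) {ψ : Config d N → ℝ} (h : IsSmooth ψ)
    (z : Config d N) : generator σ N₀ K ψ z =
      (∑ i, ∑ a, (z i).2 a * dirDeriv (dirX i a) ψ z) + 1 / (N₀ : ℝ) *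
        (∑ i, ∑ j, ∑ a, K ((z i).1 - (z j).1) a * dirDeriv (dirV i a) ψ z) +
      σ ^ 2 / 2 * ∑ i, ∑ a, dirDeriv (dirV i a) (dirDeriv (dirV i a) ψ) z := by
  rw [generator, advection_eq N₀ K h]
  simp_rw [laplV_eq_sum h]

lemma measurable_coord (i : Fin N) (a : Fin d) : Measurable fun z : Config d N => (z i).2 a :=
  (EuclideanSpace.proj (𝕜 := ℝ) a).measurable.comp (measurable_snd.comp (measurable_pi_apply i))

lemma measurable_kernel {K : Torus d → Vel d} (hK : Measurable K) (i j : Fin N) :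
    Measurable fun z : Config d N => K ((z i).1 - (z j).1) :=
  hK.comp ((measurable_fst.comp (measurable_pi_apply i)).sub
    (measurable_fst.comp (measurable_pi_apply j)))

lemma measurable_kernel_coord {K : Torus d → Vel d} (hK : Measurable K) (i j : Fin N)
    (a : Fin d) : Measurable fun z : Config d N => K ((z i).1 - (z j).1) a :=
  (EuclideanSpace.proj (𝕜 := ℝ) a).measurable.comp (measurable_kernel hK i j)

lemma measurable_advection {N₀ : ℕ} {K : Torus d → Vel d} (hK : Measurable K)
    {ψ : Config d N → ℝ} (h : IsSmooth ψ) : Measurable (advection N₀ K ψ) := by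
  have h1 : advection N₀ K ψ = _ := funext (advection_eq N₀ K h)
  rw [h1]
  refine Measurable.add ?_ (measurable_const.mul ?_)
  · exact Finset.measurable_fun_sum _ fun i _ => Finset.measurable_fun_sum _ fun a _ =>
      (measurable_coord i a).mul (h.dirDeriv _).measurable
  · exact Finset.measurable_fun_sum _ fun i _ => Finset.measurable_fun_sum _ fun j _ =>
      Finset.measurable_fun_sum _ fun a _ =>
        (measurable_kernel_coord hK i j a).mul (h.dirDeriv _).measurable

lemma measurable_generator {σ : ℝ} {N₀ : ℕ} {K : Torus d → Vel d} (hK : Measurable K)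
    {ψ : Config d N → ℝ} (h : IsSmooth ψ) : Measurable (generator σ N₀ K ψ) := by
  refine (measurable_advection hK h).add (measurable_const.mul ?_)
  refine Finset.measurable_fun_sum _ fun i _ => ?_
  have h1 : laplV i ψ = _ := funext (laplV_eq_sum h i)
  rw [h1]
  exact Finset.measurable_fun_sum _ fun a _ => ((h.dirDeriv _).dirDeriv _).measurable

/-- The derivatives of `ψ` that enter the generator are bounded by `B`. -/
structure BoundedDerivs (B : ℝ) (ψ : Config d N → ℝ) : Prop where
  nonneg : 0 ≤ B
  smooth : IsSmooth ψ
  value : ∀ z, |ψ z| ≤ B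
  transport : ∀ i z, |∑ a, (z i).2 a * dirDeriv (dirX i a) ψ z| ≤ B
  first : ∀ i a z, |dirDeriv (dirV i a) ψ z| ≤ B
  second : ∀ i a z, |dirDeriv (dirV i a) (dirDeriv (dirV i a) ψ) z| ≤ B

/-- The envelope of the generator applied to functions with bounded derivatives. -/
def envelope (σ : ℝ) (K : Torus d → Vel d) (z : Config d N) : ℝ :=
  (N + σ ^ 2 / 2 * (N * d)) + d * ∑ i, ∑ j, ‖K ((z i).1 - (z j).1)‖

lemma abs_coord_le (w : Vel d) (a : Fin d) : |w a| ≤ ‖w‖ := PiLp.norm_apply_le w a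

lemma BoundedDerivs.abs_generator_le {B : ℝ} {ψ : Config d N → ℝ} (h : BoundedDerivs B ψ)
    (σ : ℝ) (N₀ : ℕ) (K : Torus d → Vel d) (z : Config d N) :
    |generator σ N₀ K ψ z| ≤ B * envelope σ K z := by
  rw [generator_eq σ N₀ K h.smooth]
  have h1 : |∑ i, ∑ a, (z i).2 a * dirDeriv (dirX i a) ψ z| ≤ N * B := by
    refine (Finset.abs_sum_le_sum_abs _ _).trans ?_
    refine (Finset.sum_le_sum fun i _ => h.transport i z).trans ?_
    simp
  have h2 : |1 / (N₀ : ℝ) * ∑ i, ∑ j, ∑ a, K ((z i).1 - (z j).1) a * dirDeriv (dirV i a) ψ z|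
      ≤ d * (∑ i, ∑ j, ‖K ((z i).1 - (z j).1)‖) * B := by
    rw [abs_mul]
    have h3 : |1 / (N₀ : ℝ)| ≤ 1 := by
      rw [abs_of_nonneg (by positivity)]
      rcases Nat.eq_zero_or_pos N₀ with rfl | hN
      · simp
      · rw [div_le_one (by positivity)]; exact_mod_cast hN
    refine (mul_le_of_le_one_left (abs_nonneg _) h3).trans ?_
    rw [Finset.mul_sum, Finset.sum_mul]
    refine (Finset.abs_sum_le_sum_abs _ _).trans (Finset.sum_le_sum fun i _ => ?_)
    rw [Finset.mul_sum, Finset.sum_mul]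
    refine (Finset.abs_sum_le_sum_abs _ _).trans (Finset.sum_le_sum fun j _ => ?_)
    refine (Finset.abs_sum_le_sum_abs _ _).trans ?_
    calc ∑ a, |K ((z i).1 - (z j).1) a * dirDeriv (dirV i a) ψ z|
        ≤ ∑ _a : Fin d, ‖K ((z i).1 - (z j).1)‖ * B := by
          refine Finset.sum_le_sum fun a _ => ?_
          rw [abs_mul]
          exact mul_le_mul (abs_coord_le _ _) (h.first i a z) (abs_nonneg _) (norm_nonneg _)
      _ = _ := by simp; ring
  have h3 : |σ ^ 2 / 2 * ∑ i, ∑ a, dirDeriv (dirV i a) (dirDeriv (dirV i a) ψ) z| ≤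
      σ ^ 2 / 2 * (N * d) * B := by
    rw [abs_mul, abs_of_nonneg (by positivity : 0 ≤ σ ^ 2 / 2), mul_assoc]
    refine mul_le_mul_of_nonneg_left ?_ (by positivity)
    calc |∑ i, ∑ a, dirDeriv (dirV i a) (dirDeriv (dirV i a) ψ) z|
        ≤ ∑ _i : Fin N, ∑ _a : Fin d, B := by
          refine (Finset.abs_sum_le_sum_abs _ _).trans (Finset.sum_le_sum fun i _ => ?_)
          exact (Finset.abs_sum_le_sum_abs _ _).trans
            (Finset.sum_le_sum fun a _ => h.second i a z)
      _ = _ := by simp; ring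
  calc _ ≤ N * B + d * (∑ i, ∑ j, ‖K ((z i).1 - (z j).1)‖) * B + σ ^ 2 / 2 * (N * d) * B :=
        (abs_add_le _ _).trans (add_le_add ((abs_add_le _ _).trans (add_le_add h1 h2)) h3)
    _ = B * envelope σ K z := by unfold envelope; ring

end Generator

/-! ### Functions with integrable interactions -/

section Controlled

variable {d N : ℕ}

/-- The function `g` and its products with the interaction kernels are integrable, with integrals
bounded by `M`. -/
structure IsControlled (K : Torus d → Vel d) (M : ℝ) (g : Config d N → ℝ) : Prop where
  integrable : Integrable g
  integral_le : ∫ z, |g z| ≤ M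
  integrable_kernel : ∀ i j, Integrable fun z => ‖K ((z i).1 - (z j).1)‖ * |g z|
  integral_kernel_le : ∀ i j, ∫ z, ‖K ((z i).1 - (z j).1)‖ * |g z| ≤ M

lemma IsControlled.integrable_envelope {K : Torus d → Vel d} {M : ℝ} {g : Config d N → ℝ}
    (h : IsControlled K M g) (σ : ℝ) : Integrable fun z => envelope σ K z * |g z| := by
  have h1 : (fun z => envelope σ K z * |g z|) = fun z => (N + σ ^ 2 / 2 * (N * d)) * |g z| +
      d * ∑ i, ∑ j, ‖K ((z i).1 - (z j).1)‖ * |g z| := by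
    ext z; simp only [envelope, add_mul, mul_assoc, Finset.sum_mul]
  rw [h1]
  exact (h.integrable.abs.const_mul _).add ((integrable_finsetSum _ fun i _ =>
    integrable_finsetSum _ fun j _ => h.integrable_kernel i j).const_mul _)

lemma IsControlled.integral_envelope_le {K : Torus d → Vel d} {M : ℝ} {g : Config d N → ℝ}
    (h : IsControlled K M g) (σ : ℝ) : ∫ z, envelope σ K z * |g z| ≤
      (N + σ ^ 2 / 2 * (N * d) + d * (N * N)) * M := by
  have h1 : (fun z => envelope σ K z * |g z|) = fun z => (N + σ ^ 2 / 2 * (N * d)) * |g z| +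
      d * ∑ i, ∑ j, ‖K ((z i).1 - (z j).1)‖ * |g z| := by
    ext z; simp only [envelope, add_mul, mul_assoc, Finset.sum_mul]
  rw [h1, integral_add (h.integrable.abs.const_mul _) ((integrable_finsetSum _ fun i _ =>
    integrable_finsetSum _ fun j _ => h.integrable_kernel i j).const_mul _),
    integral_const_mul, integral_const_mul, integral_finsetSum _ fun i _ =>
      integrable_finsetSum _ fun j _ => h.integrable_kernel i j, add_mul _ _ M, mul_assoc _ _ M]
  refine add_le_add (mul_le_mul_of_nonneg_left h.integral_le (by positivity))
    (mul_le_mul_of_nonneg_left ?_ (by positivity))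
  calc _ ≤ ∑ _i : Fin N, ∑ _j : Fin N, M := by
        refine Finset.sum_le_sum fun i _ => ?_
        rw [integral_finsetSum _ fun j _ => h.integrable_kernel i j]
        exact Finset.sum_le_sum fun j _ => h.integral_kernel_le i j
    _ = _ := by simp; ring

lemma IsControlled.integrable_mul_generator {K : Torus d → Vel d} (hK : Measurable K) {M : ℝ}
    {g : Config d N → ℝ} (h : IsControlled K M g) {B : ℝ} {ψ : Config d N → ℝ}
    (hψ : BoundedDerivs B ψ) (σ : ℝ) (N₀ : ℕ) :
    Integrable fun z => g z * generator σ N₀ K ψ z := by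
  refine ((h.integrable_envelope σ).const_mul B).mono'
    (h.integrable.1.mul (measurable_generator hK hψ.smooth).aestronglyMeasurable)
    (ae_of_all _ fun z => ?_)
  rw [norm_mul, mul_comm, ← mul_assoc]
  exact mul_le_mul_of_nonneg_right (hψ.abs_generator_le σ N₀ K z) (norm_nonneg _)

lemma IsControlled.abs_integral_mul_generator_le {K : Torus d → Vel d} {M : ℝ}
    {g : Config d N → ℝ} (h : IsControlled K M g) {B : ℝ} {ψ : Config d N → ℝ}
    (hψ : BoundedDerivs B ψ) (σ : ℝ) (N₀ : ℕ) :
    |∫ z, g z * generator σ N₀ K ψ z| ≤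
      B * ((N + σ ^ 2 / 2 * (N * d) + d * (N * N)) * M) := by
  refine (norm_integral_le_of_norm_le (f := fun z => g z * generator σ N₀ K ψ z)
    ((h.integrable_envelope σ).const_mul B) (ae_of_all _ fun z => ?_)).trans ?_
  · rw [norm_mul, mul_comm, ← mul_assoc]
    exact mul_le_mul_of_nonneg_right (hψ.abs_generator_le σ N₀ K z) (norm_nonneg _)
  · rw [integral_const_mul]
    exact mul_le_mul_of_nonneg_left (h.integral_envelope_le σ) hψ.nonneg

end Controlled

/-! ### Cutoffs in the velocities -/

section Cutoff

variable {d N : ℕ}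

/-- The velocities of a configuration. -/
def velocities (z : Config d N) : Fin N → Vel d := fun i => (z i).2

/-- A function of the rescaled velocities. -/
def velFun (β : (Fin N → Vel d) → ℝ) (c : ℝ) (z : Config d N) : ℝ := β (c • velocities z)

lemma isSmooth_velFun {β : (Fin N → Vel d) → ℝ} (hβ : ContDiff ℝ ∞ β) (c : ℝ) :
    IsSmooth (velFun β c : Config d N → ℝ) := by
  have h : ContDiff ℝ ∞ fun y : Fin N → Vel d × Vel d => velocities (toConfig y) :=
    contDiff_pi.2 fun i => (contDiff_snd.comp (contDiff_apply ℝ (Vel d × Vel d) i) :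
      ContDiff ℝ ∞ fun y : Fin N → Vel d × Vel d => (y i).2)
  exact hβ.comp (h.const_smul c)

lemma dirDeriv_velFun {β : (Fin N → Vel d) → ℝ} (hβ : ContDiff ℝ ∞ β) (c : ℝ)
    (e : Fin N → Vel d × Vel d) (z : Config d N) :
    dirDeriv e (velFun β c) z =
      c * velFun (fun v => fderiv ℝ β v fun i => (e i).2) c z := by
  have h1 : HasFDerivAt β (fderiv ℝ β (c • velocities z)) (c • velocities z) :=
    (hβ.differentiable (by simp) _).hasFDerivAt
  have h2 : HasDerivAt (fun s : ℝ => c • (velocities z + s • fun i => (e i).2))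
      (c • fun i => (e i).2) 0 := by
    refine HasDerivAt.const_smul c (HasDerivAt.const_add _ ?_)
    have := (hasDerivAt_id' (0 : ℝ)).smul_const (fun i => (e i).2)
    rwa [one_smul] at this
  have h3 := HasFDerivAt.comp_hasDerivAt (0 : ℝ) (l := β) (by simpa using h1) h2
  have h4 : (fun s : ℝ => velFun β c (z + toConfig (s • e))) =
      β ∘ fun s : ℝ => c • (velocities z + s • fun i => (e i).2) := by
    ext s; rfl
  rw [dirDeriv, h4, h3.deriv]
  simp [velFun]

end Cutoff

section WeakExtension

variable {d N : ℕ}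

lemma dirDeriv_const_mul {η : Config d N → ℝ} (h : IsSmooth η) (c : ℝ)
    (e : Fin N → Vel d × Vel d) (z : Config d N) :
    dirDeriv e (fun z => c * η z) z = c * dirDeriv e η z :=
  ((h.hasDerivAt_zero e z).const_mul c).deriv

lemma dirDeriv_add {η ζ : Config d N → ℝ} (h : IsSmooth η) (h' : IsSmooth ζ)
    (e : Fin N → Vel d × Vel d) (z : Config d N) :
    dirDeriv e (fun z => η z + ζ z) z = dirDeriv e η z + dirDeriv e ζ z := by
  have := (h.hasDerivAt_zero e z).add (h'.hasDerivAt_zero e z)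
  exact this.deriv

lemma dirDeriv_dirDeriv_mul {η ζ : Config d N → ℝ} (h : IsSmooth η) (h' : IsSmooth ζ)
    (e : Fin N → Vel d × Vel d) (z : Config d N) :
    dirDeriv e (dirDeriv e fun z => η z * ζ z) z = dirDeriv e (dirDeriv e η) z * ζ z +
      2 * (dirDeriv e η z * dirDeriv e ζ z) + η z * dirDeriv e (dirDeriv e ζ) z := by
  have h1 : dirDeriv e (fun z => η z * ζ z) = _ := funext (dirDeriv_mul h h' e)
  rw [h1, dirDeriv_add ((h.dirDeriv e).mul h') (h.mul (h'.dirDeriv e)),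
    dirDeriv_mul (h.dirDeriv e) h', dirDeriv_mul h (h'.dirDeriv e)]
  ring

/-- A bounded family of cutoff functions that exhausts the phase space. -/
lemma exists_cutoff (d N : ℕ) : ∃ (θ : ℕ → Config d N → ℝ) (B : ℝ), 0 ≤ B ∧
    (∀ m, IsSmooth (θ m)) ∧ (∀ m, HasCompactSupport (θ m)) ∧ (∀ m z, |θ m z| ≤ B) ∧
    (∀ m i a z, dirDeriv (dirX i a) (θ m) z = 0) ∧
    (∀ m i a z, |dirDeriv (dirV i a) (θ m) z| ≤ B) ∧
    (∀ m i a z, |dirDeriv (dirV i a) (dirDeriv (dirV i a) (θ m)) z| ≤ B) ∧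
    (∀ z, Tendsto (fun m => θ m z) atTop (𝓝 1)) ∧
    (∀ i a z, Tendsto (fun m => dirDeriv (dirV i a) (θ m) z) atTop (𝓝 0)) ∧
    (∀ i a z, Tendsto (fun m => dirDeriv (dirV i a) (dirDeriv (dirV i a) (θ m)) z) atTop
      (𝓝 0)) := by
  let b : ContDiffBump (0 : Fin N → Vel d) := ⟨1, 2, one_pos, one_lt_two⟩
  have hb : ContDiff ℝ ∞ b := b.contDiff
  let b1 (i : Fin N) (a : Fin d) (v : Fin N → Vel d) : ℝ :=
    fderiv ℝ b v fun j => (dirV i a j).2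
  have hb1 (i : Fin N) (a : Fin d) : ContDiff ℝ ∞ (b1 i a) :=
    (hb.fderiv_right (m := ∞) (by simp)).clm_apply contDiff_const
  let b2 (i : Fin N) (a : Fin d) (v : Fin N → Vel d) : ℝ :=
    fderiv ℝ (b1 i a) v fun j => (dirV i a j).2
  have hb2 (i : Fin N) (a : Fin d) : ContDiff ℝ ∞ (b2 i a) :=
    ((hb1 i a).fderiv_right (m := ∞) (by simp)).clm_apply contDiff_const
  have hc1 (i : Fin N) (a : Fin d) : HasCompactSupport (b1 i a) :=
    b.hasCompactSupport.fderiv_apply ℝ _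
  have hc2 (i : Fin N) (a : Fin d) : HasCompactSupport (b2 i a) :=
    (hc1 i a).fderiv_apply ℝ _
  choose C1 hC1 using fun i a => (hc1 i a).exists_bound_of_continuous (hb1 i a).continuous
  choose C2 hC2 using fun i a => (hc2 i a).exists_bound_of_continuous (hb2 i a).continuous
  have hC1' (i : Fin N) (a : Fin d) : 0 ≤ C1 i a := (norm_nonneg _).trans (hC1 i a 0)
  have hC2' (i : Fin N) (a : Fin d) : 0 ≤ C2 i a := (norm_nonneg _).trans (hC2 i a 0)
  let c (m : ℕ) : ℝ := 1 / ((m : ℝ) + 1)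
  have hc0 (m : ℕ) : 0 < c m := by positivity
  have hcle (m : ℕ) : c m ≤ 1 := by
    rw [div_le_one (by positivity)]; linarith [(Nat.cast_nonneg m : (0 : ℝ) ≤ m)]
  have hclim : Tendsto c atTop (𝓝 0) := tendsto_one_div_add_atTop_nhds_zero_nat
  have hd1 (m : ℕ) (i : Fin N) (a : Fin d) :
      dirDeriv (dirV i a) (velFun b (c m)) = fun z => c m * velFun (b1 i a) (c m) z :=
    funext fun z => dirDeriv_velFun hb _ _ z
  have hd2 (m : ℕ) (i : Fin N) (a : Fin d) (z : Config d N) :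
      dirDeriv (dirV i a) (dirDeriv (dirV i a) (velFun b (c m))) z =
        c m * (c m * velFun (b2 i a) (c m) z) := by
    rw [hd1, dirDeriv_const_mul (isSmooth_velFun (hb1 i a) _), dirDeriv_velFun (hb1 i a)]
  let B := 1 + (∑ i, ∑ a, C1 i a) + ∑ i, ∑ a, C2 i a
  have hS1 : 0 ≤ ∑ i, ∑ a, C1 i a :=
    Finset.sum_nonneg fun i _ => Finset.sum_nonneg fun a _ => hC1' i a
  have hS2 : 0 ≤ ∑ i, ∑ a, C2 i a :=
    Finset.sum_nonneg fun i _ => Finset.sum_nonneg fun a _ => hC2' i a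
  have hB1 (i : Fin N) (a : Fin d) : C1 i a ≤ B := by
    have h1 : C1 i a ≤ ∑ a, C1 i a :=
      Finset.single_le_sum (fun a _ => hC1' i a) (Finset.mem_univ a)
    have h2 : ∑ a, C1 i a ≤ ∑ i, ∑ a, C1 i a :=
      Finset.single_le_sum (f := fun i => ∑ a, C1 i a)
        (fun i _ => Finset.sum_nonneg fun a _ => hC1' i a) (Finset.mem_univ i)
    simp only [B]; linarith
  have hB2 (i : Fin N) (a : Fin d) : C2 i a ≤ B := by
    have h1 : C2 i a ≤ ∑ a, C2 i a :=
      Finset.single_le_sum (fun a _ => hC2' i a) (Finset.mem_univ a)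
    have h2 : ∑ a, C2 i a ≤ ∑ i, ∑ a, C2 i a :=
      Finset.single_le_sum (f := fun i => ∑ a, C2 i a)
        (fun i _ => Finset.sum_nonneg fun a _ => hC2' i a) (Finset.mem_univ i)
    simp only [B]; linarith
  have hbd1 (m : ℕ) (i : Fin N) (a : Fin d) (z : Config d N) :
      |dirDeriv (dirV i a) (velFun b (c m)) z| ≤ c m * B := by
    rw [hd1, abs_mul, abs_of_pos (hc0 m)]
    exact mul_le_mul_of_nonneg_left ((hC1 i a _).trans (hB1 i a)) (hc0 m).le
  have hbd2 (m : ℕ) (i : Fin N) (a : Fin d) (z : Config d N) :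
      |dirDeriv (dirV i a) (dirDeriv (dirV i a) (velFun b (c m))) z| ≤ c m * B := by
    rw [hd2, abs_mul, abs_mul, abs_of_pos (hc0 m)]
    refine mul_le_mul_of_nonneg_left ?_ (hc0 m).le
    exact (mul_le_of_le_one_left (abs_nonneg _) (hcle m)).trans ((hC2 i a _).trans (hB2 i a))
  have hB0 : 0 ≤ B := by positivity
  have hcB : Tendsto (fun m => c m * B) atTop (𝓝 0) := by simpa using hclim.mul_const B
  refine ⟨fun m => velFun b (c m), B, hB0, fun m => isSmooth_velFun hb _, fun m => ?_,
    fun m z => ?_, fun m i a z => ?_,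
    fun m i a z => (hbd1 m i a z).trans (mul_le_of_le_one_left hB0 (hcle m)),
    fun m i a z => (hbd2 m i a z).trans (mul_le_of_le_one_left hB0 (hcle m)), fun z => ?_,
    fun i a z => squeeze_zero_norm (fun m => hbd1 m i a z) hcB,
    fun i a z => squeeze_zero_norm (fun m => hbd2 m i a z) hcB⟩
  · refine HasCompactSupport.intro
      (K := univ.pi fun _ => univ ×ˢ Metric.closedBall 0 (2 * ((m : ℝ) + 1)))
      (isCompact_univ_pi fun _ => isCompact_univ.prod (isCompact_closedBall _ _)) fun z hz => ?_
    simp only [Set.mem_pi, mem_univ, true_implies, mem_prod, true_and, not_forall,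
      mem_closedBall_zero_iff, not_le] at hz
    obtain ⟨i, hi⟩ := hz
    refine b.zero_of_le_dist ?_
    rw [dist_zero_right]
    refine le_trans ?_ (norm_le_pi_norm (c m • velocities z) i)
    rw [Pi.smul_apply, norm_smul, Real.norm_of_nonneg (hc0 m).le]
    change 2 ≤ 1 / ((m : ℝ) + 1) * ‖(z i).2‖
    rw [one_div, inv_mul_eq_div, le_div_iff₀ (by positivity)]
    exact hi.le
  · refine (abs_of_nonneg b.nonneg).le.trans (b.le_one.trans ?_)
    simp only [B]; linarith
  · rw [dirDeriv_velFun hb]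
    have : (fun j => (dirX i a j).2) = (0 : Fin N → Vel d) := by
      ext j : 1
      rcases eq_or_ne j i with rfl | hj <;> simp [dirX, *]
    simp [this, velFun]
  · have h1 : Tendsto (fun m => b (c m • velocities z)) atTop (𝓝 (b ((0 : ℝ) • velocities z))) :=
      (hb.continuous.tendsto _).comp (hclim.smul_const _)
    rw [zero_smul, b.one_of_mem_closedBall (Metric.mem_closedBall_self zero_le_one)] at h1
    exact h1

/-- The weak formulation holds for smooth functions on the phase space that need not have compact
support. -/
lemma IsWeakSolution.of_boundedDerivs {σ : ℝ} {K : Torus d → Vel d} (hK : Measurable K)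
    {f : ℝ → Config d N → ℝ} (hf : IsWeakSolution σ K f) (hfm : Measurable (Function.uncurry f))
    {M : ℝ} (hM : ∀ t ∈ Icc (0 : ℝ) 1, IsControlled K M (f t)) {B : ℝ} {ψ : Config d N → ℝ}
    (hψ : BoundedDerivs B ψ) {t : ℝ} (ht : t ∈ Icc (0 : ℝ) 1) :
    (∫ z, f t z * ψ z) - ∫ z, f 0 z * ψ z =
      ∫ s in (0 : ℝ)..t, ∫ z, f s z * generator σ N K ψ z := by
  obtain ⟨θ, Bθ, hBθ, hθs, hθc, hθb, hθX, hθV, hθVV, hθ1, hθV0, hθVV0⟩ := exists_cutoff d N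
  have h0 : (0 : ℝ) ∈ Icc (0 : ℝ) 1 := ⟨le_rfl, zero_le_one⟩
  let χ : ContDiffBump (0 : ℝ) := ⟨2, 3, two_pos, by norm_num⟩
  have hχ1 (s : ℝ) (hs : s ∈ Icc (0 : ℝ) 1) : χ s = 1 := by
    refine χ.one_of_mem_closedBall ?_
    rw [mem_closedBall_zero_iff, Real.norm_of_nonneg hs.1]
    change s ≤ 2
    linarith [hs.2]
  have hχ' (s : ℝ) (hs : s ∈ Icc (0 : ℝ) 1) : ∀ᶠ r in 𝓝 s, χ r = 1 := by
    filter_upwards [Metric.ball_mem_nhds s one_pos] with r hr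
    refine χ.one_of_mem_closedBall ?_
    rw [mem_closedBall_zero_iff]
    change ‖r‖ ≤ 2
    rw [Metric.mem_ball, Real.dist_eq, abs_lt] at hr
    rw [Real.norm_eq_abs, abs_le]
    constructor <;> linarith [hs.1, hs.2, hr.1, hr.2]
  let ψm (m : ℕ) (z : Config d N) : ℝ := ψ z * θ m z
  have hψm (m : ℕ) : IsSmooth (ψm m) := hψ.smooth.mul (hθs m)
  have htest (m : ℕ) : IsTestFunction fun r z => χ r * ψm m z := by
    constructor
    · exact (χ.contDiff.comp contDiff_fst).mul (ContDiff.comp (hψm m) contDiff_snd)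
    · refine HasCompactSupport.intro (χ.hasCompactSupport.prod (hθc m)) fun p hp => ?_
      rw [mem_prod, not_and_or] at hp
      rcases hp with hp | hp
      · simp [Function.uncurry, image_eq_zero_of_notMem_tsupport hp]
      · simp [Function.uncurry, ψm, image_eq_zero_of_notMem_tsupport hp]
  have hBψ := hψ.nonneg
  have hbd (m : ℕ) : BoundedDerivs (4 * (B * Bθ)) (ψm m) := by
    have hBB : 0 ≤ B * Bθ := mul_nonneg hBψ hBθ
    refine ⟨by positivity, hψm m, fun z => ?_, fun i z => ?_, fun i a z => ?_, fun i a z => ?_⟩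
    · rw [abs_mul]
      have := mul_le_mul (hψ.value z) (hθb m z) (abs_nonneg _) hBψ
      linarith
    · have h1 : ∑ a, (z i).2 a * dirDeriv (dirX i a) (ψm m) z =
          (∑ a, (z i).2 a * dirDeriv (dirX i a) ψ z) * θ m z := by
        rw [Finset.sum_mul]
        refine Finset.sum_congr rfl fun a _ => ?_
        rw [dirDeriv_mul hψ.smooth (hθs m), hθX]; ring
      rw [h1, abs_mul]
      have := mul_le_mul (hψ.transport i z) (hθb m z) (abs_nonneg _) hBψ
      linarith
    · rw [dirDeriv_mul hψ.smooth (hθs m)]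
      have h1 := mul_le_mul (hψ.first i a z) (hθb m z) (abs_nonneg _) hBψ
      have h2 := mul_le_mul (hψ.value z) (hθV m i a z) (abs_nonneg _) hBψ
      refine (abs_add_le _ _).trans ?_
      rw [abs_mul, abs_mul]; linarith
    · rw [dirDeriv_dirDeriv_mul hψ.smooth (hθs m)]
      have h1 := mul_le_mul (hψ.second i a z) (hθb m z) (abs_nonneg _) hBψ
      have h2 := mul_le_mul (hψ.first i a z) (hθV m i a z) (abs_nonneg _) hBψ
      have h3 := mul_le_mul (hψ.value z) (hθVV m i a z) (abs_nonneg _) hBψ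
      refine (abs_add_le _ _).trans ?_
      have h4 := abs_add_le (dirDeriv (dirV i a) (dirDeriv (dirV i a) ψ) z * θ m z)
        (2 * (dirDeriv (dirV i a) ψ z * dirDeriv (dirV i a) (θ m) z))
      rw [abs_mul, abs_mul, abs_mul, abs_two] at h4
      rw [abs_mul (ψ z)]; linarith
  have hgen (z : Config d N) :
      Tendsto (fun m => generator σ N K (ψm m) z) atTop (𝓝 (generator σ N K ψ z)) := by
    simp_rw [generator_eq σ N K (hψm _), generator_eq σ N K hψ.smooth]
    have hm (e : Fin N → Vel d × Vel d)
        (he : Tendsto (fun m => dirDeriv e (θ m) z) atTop (𝓝 0)) :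
        Tendsto (fun m => dirDeriv e (ψm m) z) atTop (𝓝 (dirDeriv e ψ z)) := by
      simp_rw [ψm, dirDeriv_mul hψ.smooth (hθs _)]
      simpa using ((hθ1 z).const_mul (dirDeriv e ψ z)).add (he.const_mul (ψ z))
    refine ((tendsto_finsetSum _ fun i _ => tendsto_finsetSum _ fun a _ =>
      (hm _ ?_).const_mul _).add ((tendsto_finsetSum _ fun i _ => tendsto_finsetSum _ fun j _ =>
        tendsto_finsetSum _ fun a _ => (hm _ (hθV0 i a z)).const_mul _).const_mul _)).add
      ((tendsto_finsetSum _ fun i _ => tendsto_finsetSum _ fun a _ => ?_).const_mul _)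
    · simp_rw [hθX]; exact tendsto_const_nhds
    · simp_rw [ψm, dirDeriv_dirDeriv_mul hψ.smooth (hθs _)]
      simpa using (((hθ1 z).const_mul (dirDeriv (dirV i a) (dirDeriv (dirV i a) ψ) z)).add
        (((hθV0 i a z).const_mul (dirDeriv (dirV i a) ψ z)).const_mul 2)).add
        ((hθVV0 i a z).const_mul (ψ z))
  have hweak (m : ℕ) : (∫ z, f t z * ψm m z) - ∫ z, f 0 z * ψm m z =
      ∫ s in (0 : ℝ)..t, ∫ z, f s z * generator σ N K (ψm m) z := by
    have h := hf _ (htest m) t ht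
    simp only [hχ1 t ht, hχ1 0 h0, one_mul] at h
    rw [h]
    refine intervalIntegral.integral_congr fun s hs => ?_
    have hs' : s ∈ Icc (0 : ℝ) 1 := by
      rw [uIcc_of_le ht.1] at hs; exact ⟨hs.1, hs.2.trans ht.2⟩
    refine integral_congr_ae (ae_of_all _ fun z => ?_)
    have h1 : deriv (fun r => χ r * ψm m z) s = 0 := by
      have : (fun r => χ r * ψm m z) =ᶠ[𝓝 s] fun _ => ψm m z := by
        filter_upwards [hχ' s hs'] with r hr
        rw [hr, one_mul]
      rw [this.deriv_eq, deriv_const]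
    simp only [h1, hχ1 s hs', one_mul, zero_add]
    rfl
  have hlim (s : ℝ) (hs : s ∈ Icc (0 : ℝ) 1) :
      Tendsto (fun m => ∫ z, f s z * ψm m z) atTop (𝓝 (∫ z, f s z * ψ z)) := by
    refine tendsto_integral_of_dominated_convergence (fun z => 4 * (B * Bθ) * |f s z|)
      (fun m => (hM s hs).integrable.1.mul (hψm m).measurable.aestronglyMeasurable)
      ((hM s hs).integrable.abs.const_mul _) (fun m => ae_of_all _ fun z => ?_)
      (ae_of_all _ fun z => ?_)
    · rw [norm_mul, mul_comm]
      exact mul_le_mul_of_nonneg_right ((hbd m).value z) (norm_nonneg _)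
    · simpa using ((hθ1 z).const_mul (ψ z)).const_mul (f s z)
  have hR : Tendsto (fun m => ∫ s in (0 : ℝ)..t, ∫ z, f s z * generator σ N K (ψm m) z) atTop
      (𝓝 (∫ s in (0 : ℝ)..t, ∫ z, f s z * generator σ N K ψ z)) := by
    refine intervalIntegral.tendsto_integral_filter_of_dominated_convergence
      (fun _ => 4 * (B * Bθ) * ((N + σ ^ 2 / 2 * (N * d) + d * (N * N)) * M))
      (Eventually.of_forall fun m => ?_) (Eventually.of_forall fun m => ae_of_all _ fun s hs => ?_)
      (by simp) (ae_of_all _ fun s hs => ?_)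
    · refine (StronglyMeasurable.integral_prod_right (f := fun s z =>
        f s z * generator σ N K (ψm m) z) ?_).aestronglyMeasurable
      exact (hfm.mul ((measurable_generator hK (hψm m)).comp measurable_snd)).stronglyMeasurable
    · have hs' : s ∈ Icc (0 : ℝ) 1 := by
        rw [uIoc_of_le ht.1] at hs; exact ⟨hs.1.le, hs.2.trans ht.2⟩
      exact (hM s hs').abs_integral_mul_generator_le (hbd m) σ N
    · have hs' : s ∈ Icc (0 : ℝ) 1 := by
        rw [uIoc_of_le ht.1] at hs; exact ⟨hs.1.le, hs.2.trans ht.2⟩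
      refine tendsto_integral_of_dominated_convergence
        (fun z => 4 * (B * Bθ) * (envelope σ K z * |f s z|))
        (fun m => (hM s hs').integrable.1.mul
          (measurable_generator hK (hψm m)).aestronglyMeasurable)
        (((hM s hs').integrable_envelope σ).const_mul _) (fun m => ae_of_all _ fun z => ?_)
        (ae_of_all _ fun z => (hgen z).const_mul _)
      rw [norm_mul, mul_comm, ← mul_assoc]
      exact mul_le_mul_of_nonneg_right ((hbd m).abs_generator_le σ N K z) (norm_nonneg _)
  refine tendsto_nhds_unique ?_ hR
  simp_rw [← hweak]
  exact (hlim t ht).sub (hlim 0 h0)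

end WeakExtension

/-! ### The hierarchy of the marginals -/

section BBGKY

variable {d N k : ℕ}

lemma IsSmooth.comp_fstPart {η : Config d k → ℝ} (h : IsSmooth η) (hk : k ≤ N) :
    IsSmooth fun y : Config d N => η (fstPart hk y) := by
  refine ContDiff.comp (g := fun y => η (toConfig y)) h
    (f := fun (y : Fin N → Vel d × Vel d) i => y (Fin.castLE hk i)) ?_
  exact contDiff_pi.2 fun i => contDiff_apply ℝ (Vel d × Vel d) _

lemma dirDeriv_comp_fstPart (η : Config d k → ℝ) (hk : k ≤ N) (e : Fin N → Vel d × Vel d) :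
    dirDeriv e (fun y => η (fstPart hk y)) =
      fun y => dirDeriv (fun i => e (Fin.castLE hk i)) η (fstPart hk y) := rfl

lemma dirDeriv_zero (η : Config d k → ℝ) (z : Config d k) : dirDeriv 0 η z = 0 := by
  simp [dirDeriv]

lemma single_castLE {E : Type*} [Zero E] (hk : k ≤ N) (i : Fin k) (v : E) :
    (fun j => (Pi.single (Fin.castLE hk i) v : Fin N → E) (Fin.castLE hk j)) =
      Pi.single i v := by
  ext j : 1
  rcases eq_or_ne j i with rfl | hj
  · simp
  · rw [Pi.single_eq_of_ne hj, Pi.single_eq_of_ne]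
    exact fun h => hj (Fin.castLE_injective hk h)

lemma single_castLE_of_le {E : Type*} [Zero E] (hk : k ≤ N) (i : Fin (N - k)) (v : E) :
    (fun j => (Pi.single ⟨k + i, by omega⟩ v : Fin N → E) (Fin.castLE hk j)) = 0 := by
  ext j : 1
  rw [Pi.single_eq_of_ne]; · rfl
  intro h
  have := congrArg Fin.val h
  simp at this
  omega

lemma dirDeriv_fstPart_of_le (η : Config d k → ℝ) (hk : k ≤ N) (i : Fin (N - k))
    (v : Vel d × Vel d) (y : Config d N) :
    dirDeriv (Pi.single ⟨k + i, by omega⟩ v) (fun y => η (fstPart hk y)) y = 0 := by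
  rw [dirDeriv_comp_fstPart]
  simp only [single_castLE_of_le hk i v, dirDeriv_zero]

lemma dirDeriv_fstPart (η : Config d k → ℝ) (hk : k ≤ N) (i : Fin k)
    (v : Vel d × Vel d) (y : Config d N) :
    dirDeriv (Pi.single (Fin.castLE hk i) v) (fun y => η (fstPart hk y)) y =
      dirDeriv (Pi.single i v) η (fstPart hk y) := by
  rw [dirDeriv_comp_fstPart]
  simp only [single_castLE hk i v]

lemma dirDeriv_dirDeriv_fstPart (η : Config d k → ℝ) (hk : k ≤ N) (i : Fin k)
    (v : Vel d × Vel d) (y : Config d N) :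
    dirDeriv (Pi.single (Fin.castLE hk i) v) (dirDeriv (Pi.single (Fin.castLE hk i) v)
      (fun y => η (fstPart hk y))) y =
      dirDeriv (Pi.single i v) (dirDeriv (Pi.single i v) η) (fstPart hk y) := by
  rw [funext (dirDeriv_fstPart η hk i v), dirDeriv_fstPart]

lemma dirDeriv_dirDeriv_fstPart_of_le (η : Config d k → ℝ) (hk : k ≤ N) (i : Fin (N - k))
    (v : Vel d × Vel d) (y : Config d N) :
    dirDeriv (Pi.single ⟨k + i, by omega⟩ v) (dirDeriv (Pi.single ⟨k + i, by omega⟩ v)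
      (fun y => η (fstPart hk y))) y = 0 := by
  rw [funext (dirDeriv_fstPart_of_le η hk i v)]
  simp [dirDeriv]

/-- The part of the generator in which the last `N - k` particles act on the first `k`. -/
def outerInteraction (hk : k ≤ N) (K : Torus d → Vel d) (η : Config d k → ℝ)
    (y : Config d N) : ℝ :=
  1 / (N : ℝ) * ∑ i : Fin k, ∑ j : Fin (N - k), ∑ a,
    K ((y (Fin.castLE hk i)).1 - (y ⟨k + j, by omega⟩).1) a *
      dirDeriv (dirV i a) η (fstPart hk y)

lemma generator_comp_fstPart {η : Config d k → ℝ} (h : IsSmooth η) (hk : k ≤ N) (σ : ℝ)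
    (K : Torus d → Vel d) (y : Config d N) :
    generator σ N K (fun y => η (fstPart hk y)) y =
      generator σ N K η (fstPart hk y) + outerInteraction hk K η y := by
  rw [generator_eq σ N K (h.comp_fstPart hk), generator_eq σ N K h, outerInteraction]
  simp_rw [sum_fin_split hk (fun i : Fin N => ∑ a, (y i).2 a * dirDeriv _ _ y),
    sum_fin_split hk (fun i : Fin N => ∑ j, ∑ a, K ((y i).1 - (y j).1) a * dirDeriv _ _ y),
    sum_fin_split hk (fun i : Fin N => ∑ a, dirDeriv _ _ y), dirX, dirV,
    dirDeriv_fstPart_of_le, dirDeriv_dirDeriv_fstPart_of_le, dirDeriv_fstPart,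
    dirDeriv_dirDeriv_fstPart, mul_zero, Finset.sum_const_zero, add_zero]
  simp_rw [sum_fin_split hk (fun j : Fin N => ∑ a, K (_ - (y j).1) a * _),
    Finset.sum_add_distrib, fstPart]
  ring

lemma boundedDerivs_comp_fstPart {η : Config d k → ℝ} (h : IsSmooth η)
    (hc : HasCompactSupport η) (hk : k ≤ N) :
    ∃ B, BoundedDerivs B fun y : Config d N => η (fstPart hk y) := by
  have hcX (i : Fin k) : Continuous fun z : Config d k =>
      ∑ a, (z i).2 a * dirDeriv (dirX i a) η z :=
    continuous_finsetSum _ fun a _ => Continuous.mul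
      ((EuclideanSpace.proj (𝕜 := ℝ) a).continuous.comp
        (continuous_snd.comp (continuous_apply i))) (h.dirDeriv _).continuous
  have hsX (i : Fin k) : HasCompactSupport fun z : Config d k =>
      ∑ a, (z i).2 a * dirDeriv (dirX i a) η z := by
    refine HasCompactSupport.intro hc fun z hz => Finset.sum_eq_zero fun a _ => ?_
    have h1 : z ∉ tsupport (dirDeriv (dirX i a) η) := by
      intro h2
      refine hz (closure_minimal ?_ (isClosed_tsupport η) h2)
      intro z' hz'
      by_contra h3
      refine hz' ?_
      have h4 : ∀ᶠ s : ℝ in 𝓝 0, η (z' + toConfig (s • dirX i a)) = 0 := by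
        have hct : ContinuousAt (fun s : ℝ => z' + toConfig (s • dirX i a)) 0 :=
          (continuous_const.add (continuous_line _)).continuousAt
        have h2 : (tsupport η)ᶜ ∈ 𝓝 (z' + toConfig ((0 : ℝ) • dirX i a)) := by
          simpa using (isClosed_tsupport η).isOpen_compl.mem_nhds h3
        filter_upwards [hct.preimage_mem_nhds h2] with s hs
        exact image_eq_zero_of_notMem_tsupport hs
      exact (Filter.EventuallyEq.deriv_eq (f := fun _ => (0 : ℝ)) h4).trans (by simp)
    rw [image_eq_zero_of_notMem_tsupport h1, mul_zero]
  obtain ⟨B0, hB0, hB0'⟩ := exists_bound_of_compactSupport h hc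
  choose BX hBX using fun i => (hsX i).exists_bound_of_continuous (hcX i)
  choose BV hBV hBV' using fun i a => exists_bound_of_compactSupport (h.dirDeriv (dirV i a))
    (hasCompactSupport_dirDeriv hc _)
  choose BW hBW hBW' using fun i a => exists_bound_of_compactSupport
    ((h.dirDeriv (dirV i a)).dirDeriv (dirV i a))
    (hasCompactSupport_dirDeriv (hasCompactSupport_dirDeriv hc _) _)
  have hBXn (i : Fin k) : 0 ≤ BX i := (norm_nonneg _).trans (hBX i 0)
  obtain ⟨B, hB⟩ : ∃ B, B0 ≤ B ∧ (∀ i, BX i ≤ B) ∧ (∀ i a, BV i a ≤ B) ∧ ∀ i a, BW i a ≤ B := by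
    obtain ⟨B1, hB1⟩ := (Set.finite_range BX).bddAbove
    obtain ⟨B2, hB2⟩ := (Set.finite_range fun p : Fin k × Fin d => BV p.1 p.2).bddAbove
    obtain ⟨B3, hB3⟩ := (Set.finite_range fun p : Fin k × Fin d => BW p.1 p.2).bddAbove
    refine ⟨max B0 (max B1 (max B2 B3)), le_max_left _ _, fun i => ?_, fun i a => ?_,
      fun i a => ?_⟩
    · exact (hB1 ⟨i, rfl⟩).trans (by simp)
    · exact (hB2 ⟨(i, a), rfl⟩).trans (by simp)
    · exact (hB3 ⟨(i, a), rfl⟩).trans (by simp)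
  have hBn : 0 ≤ B := hB0.trans hB.1
  have hsplit (i : Fin N) : (∃ i', i = Fin.castLE hk i') ∨
      ∃ i' : Fin (N - k), i = ⟨k + i', by omega⟩ := by
    by_cases hi : (i : ℕ) < k
    · exact Or.inl ⟨⟨i, hi⟩, rfl⟩
    · refine Or.inr ⟨⟨i - k, by omega⟩, ?_⟩
      ext; simp; omega
  refine ⟨B, hBn, h.comp_fstPart hk, fun y => (hB0' _).trans hB.1, fun i y => ?_,
    fun i a y => ?_, fun i a y => ?_⟩
  · rcases hsplit i with ⟨i', rfl⟩ | ⟨i', rfl⟩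
    · simp_rw [dirX, dirDeriv_fstPart]
      exact (hBX i' (fstPart hk y)).trans (hB.2.1 i')
    · simp_rw [dirX, dirDeriv_fstPart_of_le]
      simpa using hBn
  · rcases hsplit i with ⟨i', rfl⟩ | ⟨i', rfl⟩
    · simp_rw [dirV, dirDeriv_fstPart]
      exact (hBV' i' a (fstPart hk y)).trans (hB.2.2.1 i' a)
    · simp_rw [dirV, dirDeriv_fstPart_of_le]
      simpa using hBn
  · rcases hsplit i with ⟨i', rfl⟩ | ⟨i', rfl⟩
    · simp_rw [dirV, dirDeriv_dirDeriv_fstPart]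
      exact (hBW' i' a (fstPart hk y)).trans (hB.2.2.2 i' a)
    · simp_rw [dirV, dirDeriv_dirDeriv_fstPart_of_le]
      simpa using hBn

/-- The mean force on the particle `i` that the other `N - k` particles exert, weighted with the
density: `((N - k) / N) ∫ K (x_i - x_{k+1}) h (z, z_{k+1}) dz_{k+1}`, in coordinates. -/
def force (N : ℕ) (K : Torus d → Vel d) (i : Fin k) (a : Fin d) (h : Config d (k + 1) → ℝ)
    (z : Config d k) : ℝ :=
  ((N : ℝ) - k) / N * ∫ p, K ((z i).1 - p.1) a * h (snocConfig z p)

lemma IsControlled.integrable_kernel_mul {K : Torus d → Vel d} (hK : Measurable K) {M : ℝ}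
    {g : Config d N → ℝ} (h : IsControlled K M g) {D : Config d N → ℝ} {B : ℝ}
    (hD : Measurable D) (hB : ∀ y, |D y| ≤ B) (i j : Fin N) (a : Fin d) :
    Integrable fun y => g y * (K ((y i).1 - (y j).1) a * D y) := by
  refine ((h.integrable_kernel i j).const_mul B).mono'
    (h.integrable.1.mul ((measurable_kernel_coord hK i j a).mul hD).aestronglyMeasurable)
    (ae_of_all _ fun y => ?_)
  rw [norm_mul, norm_mul]
  calc ‖g y‖ * (‖K ((y i).1 - (y j).1) a‖ * ‖D y‖)
      ≤ ‖g y‖ * (‖K ((y i).1 - (y j).1)‖ * B) := by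
        gcongr
        · exact abs_coord_le _ _
        · exact hB y
    _ = _ := by rw [Real.norm_eq_abs (g y)]; ring

/-- By exchangeability, every outer particle exerts the same mean force. -/
lemma integral_kernel_symm {K : Torus d → Vel d} (hK : Measurable K) {g : Config d N → ℝ}
    (hgm : Measurable g) (hsymm : ∀ π : Equiv.Perm (Fin N), ∀ᵐ z, g (z ∘ π) = g z)
    (hk : k + 1 ≤ N) {D : Config d k → ℝ} (hD : Measurable D) (i : Fin k) (j : Fin (N - k))
    (a : Fin d) :
    ∫ y, g y * (K ((y (Fin.castLE (by omega) i)).1 - (y ⟨k + j, by omega⟩).1) a *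
        D (fstPart (by omega) y)) =
      ∫ y, g y * (K ((y (Fin.castLE (by omega) i)).1 - (y ⟨k, by omega⟩).1) a *
        D (fstPart (by omega) y)) := by
  have hk' : k ≤ N := by omega
  set π : Equiv.Perm (Fin N) := Equiv.swap ⟨k, by omega⟩ ⟨k + j, by omega⟩ with hπ
  have hfix (i : Fin k) : π (Fin.castLE hk' i) = Fin.castLE hk' i := by
    refine Equiv.swap_apply_of_ne_of_ne ?_ ?_ <;>
    · intro h; have := congrArg Fin.val h; simp at this; omega
  have hfst (y : Config d N) : fstPart hk' (y ∘ π) = fstPart hk' y := by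
    ext i : 1; simp only [fstPart, Function.comp, hfix]
  have h0 := (measurePreserving_perm (d := d) π).map_eq
  have hF : Measurable fun y : Config d N => g y * (K ((y (Fin.castLE hk' i)).1 -
      (y ⟨k + j, by omega⟩).1) a * D (fstPart hk' y)) :=
    hgm.mul ((measurable_kernel_coord hK _ _ a).mul (hD.comp (measurable_fstPart hk')))
  conv_lhs => rw [← h0]
  rw [integral_map (measurePreserving_perm π).measurable.aemeasurable hF.aestronglyMeasurable]
  refine integral_congr_ae ?_
  filter_upwards [hsymm π] with y hy
  rw [hy, hfst]
  simp only [Function.comp, hfix]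
  have : π ⟨k + j, by omega⟩ = ⟨k, by omega⟩ := Equiv.swap_apply_right _ _
  rw [this]

/-- The mean force on the first `k` particles in terms of the next marginal. -/
lemma integral_kernel_eq_force {K : Torus d → Vel d} (hK : Measurable K) {M : ℝ}
    {g : Config d N → ℝ} (hg : IsControlled K M g)
    (hk : k + 1 ≤ N) {D : Config d k → ℝ} (hD : Measurable D) {B : ℝ} (hB : ∀ z, |D z| ≤ B)
    (i : Fin k) (a : Fin d) :
    ((N : ℝ) - k) / N * ∫ y, g y * (K ((y (Fin.castLE (by omega) i)).1 -
      (y ⟨k, by omega⟩).1) a * D (fstPart (by omega) y)) =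
      ∫ z, force N K i a (marginal hk g) z * D z := by
  have hk' : k ≤ N := by omega
  set ζ : Config d (k + 1) → ℝ := fun y =>
    K ((y i.castSucc).1 - (y (Fin.last k)).1) a * D (fstPart k.le_succ y) with hζ
  have h1 : Integrable fun y => g y * ζ (fstPart hk y) :=
    hg.integrable_kernel_mul hK (D := fun y => D (fstPart hk' y))
      (hD.comp (measurable_fstPart hk')) (fun y => hB _) (Fin.castLE hk' i) ⟨k, by omega⟩ a
  have h2 := integral_marginal_mul hk h1
  have h3 := integrable_marginal_mul hk h1
  have h4 := (measurePreserving_snocConfig (d := d) (k := k)).integrable_comp_of_integrable h3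
  have h5 : ∫ y, marginal hk g y * ζ y =
      ∫ z, ∫ p, marginal hk g (snocConfig z p) * ζ (snocConfig z p) := by
    have h0 := (measurePreserving_snocConfig (d := d) (k := k)).map_eq
    conv_lhs => rw [← h0]
    rw [integral_map measurable_snocConfig.aemeasurable (by rw [h0]; exact h3.1),
      integral_prod _ (by exact h4)]
  change _ * ∫ y, g y * ζ (fstPart hk y) = _
  rw [← h2, h5, ← integral_const_mul]
  refine integral_congr_ae (ae_of_all _ fun z => ?_)
  simp only [hζ, fstPart_snocConfig, snocConfig_castSucc, snocConfig_last, force]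
  rw [mul_assoc, ← integral_mul_const]
  congr 1
  refine integral_congr_ae (ae_of_all _ fun p => ?_)
  simp only; ring

/-- The equation of the hierarchy for the marginal on `k` particles, in weak form. -/
lemma integral_generator_comp_fstPart {σ : ℝ} {K : Torus d → Vel d} (hK : Measurable K) {M : ℝ}
    {g : Config d N → ℝ} (hg : IsControlled K M g) (hgm : Measurable g)
    (hsymm : ∀ π : Equiv.Perm (Fin N), ∀ᵐ z, g (z ∘ π) = g z)
    (hk : k + 1 ≤ N) {η : Config d k → ℝ} (h : IsSmooth η) (hc : HasCompactSupport η) :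
    ∫ y, g y * generator σ N K (fun y => η (fstPart (Nat.le_of_succ_le hk) y)) y =
      (∫ z, marginal (Nat.le_of_succ_le hk) g z * generator σ N K η z) +
        ∑ i, ∑ a, ∫ z, force N K i a (marginal hk g) z * dirDeriv (dirV i a) η z := by
  have hk' : k ≤ N := Nat.le_of_succ_le hk
  obtain ⟨B, hB⟩ := boundedDerivs_comp_fstPart h hc hk'
  choose BV hBV hBV' using fun i a => exists_bound_of_compactSupport (h.dirDeriv (dirV i a))
    (hasCompactSupport_dirDeriv hc _)
  have hterm (i : Fin k) (j : Fin (N - k)) (a : Fin d) : Integrable fun y => g y *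
      (K ((y (Fin.castLE hk' i)).1 - (y ⟨k + j, by omega⟩).1) a *
        dirDeriv (dirV i a) η (fstPart hk' y)) :=
    hg.integrable_kernel_mul hK (D := fun y => dirDeriv (dirV i a) η (fstPart hk' y))
      ((h.dirDeriv _).measurable.comp (measurable_fstPart hk')) (fun y => hBV' i a _) _ _ a
  have houter : (fun y => g y * outerInteraction hk' K η y) = fun y => 1 / (N : ℝ) *
      ∑ i : Fin k, ∑ j : Fin (N - k), ∑ a, g y * (K ((y (Fin.castLE hk' i)).1 -
        (y ⟨k + j, by omega⟩).1) a * dirDeriv (dirV i a) η (fstPart hk' y)) := by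
    ext y
    rw [outerInteraction, mul_left_comm]
    simp_rw [Finset.mul_sum]
  have hint : Integrable fun y => g y * outerInteraction hk' K η y := by
    rw [houter]
    exact (integrable_finsetSum _ fun i _ => integrable_finsetSum _ fun j _ =>
      integrable_finsetSum _ fun a _ => hterm i j a).const_mul _
  have htot := hg.integrable_mul_generator hK hB σ N
  have hinner : Integrable fun y => g y * generator σ N K η (fstPart hk' y) := by
    refine (htot.sub hint).congr (ae_of_all _ fun y => ?_)
    simp only [Pi.sub_apply, generator_comp_fstPart h hk']; ring
  simp_rw [generator_comp_fstPart h hk', mul_add]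
  rw [integral_add hinner hint, integral_marginal_mul hk' hinner, houter, integral_const_mul,
    integral_finsetSum _ fun i _ => integrable_finsetSum _ fun j _ =>
      integrable_finsetSum _ fun a _ => hterm i j a, Finset.mul_sum]
  congr 1
  refine Finset.sum_congr rfl fun i _ => ?_
  rw [integral_finsetSum _ fun j _ => integrable_finsetSum _ fun a _ => hterm i j a]
  simp_rw [integral_finsetSum _ fun a _ => hterm i _ a]
  rw [Finset.sum_comm, Finset.mul_sum]
  refine Finset.sum_congr rfl fun a _ => ?_
  rw [← integral_kernel_eq_force hK hg hk (h.dirDeriv (dirV i a)).measurable (hBV' i a) i a]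
  rw [Finset.sum_congr rfl fun j _ => integral_kernel_symm hK hgm hsymm hk
    (h.dirDeriv (dirV i a)).measurable i j a, Finset.sum_const, Finset.card_univ, Fintype.card_fin,
    nsmul_eq_mul, Nat.cast_sub hk']
  ring

end BBGKY

section Mollified

variable {d N k : ℕ}

lemma measurable_force {X : Type*} [MeasurableSpace X] {K : Torus d → Vel d} (hK : Measurable K)
    {h : X → Config d (k + 1) → ℝ} (hh : Measurable (Function.uncurry h)) (i : Fin k) (a : Fin d) :
    Measurable (Function.uncurry fun x => force N K i a (h x)) := by
  refine measurable_const.mul ?_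
  refine (StronglyMeasurable.integral_prod_right (f := fun (q : X × Config d k) (p : Particle d) =>
    K ((q.2 i).1 - p.1) a * h q.1 (snocConfig q.2 p)) ?_).measurable
  refine Measurable.stronglyMeasurable (Measurable.mul ?_ ?_)
  · refine (EuclideanSpace.proj (𝕜 := ℝ) a).measurable.comp (hK.comp (Measurable.sub ?_ ?_))
    · exact measurable_fst.comp ((measurable_pi_apply i).comp
        (measurable_snd.comp measurable_fst))
    · exact measurable_fst.comp measurable_snd
  · exact hh.comp ((measurable_fst.comp measurable_fst).prodMk
      (measurable_snocConfig.comp ((measurable_snd.comp measurable_fst).prodMk measurable_snd)))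

lemma IsControlled.integrable_force {K : Torus d → Vel d} (hK : Measurable K) {M : ℝ}
    {g : Config d N → ℝ} (hg : IsControlled K M g) (hk : k + 1 ≤ N) (i : Fin k) (a : Fin d) :
    Integrable (force N K i a (marginal hk g)) ∧
      ∫ z, |force N K i a (marginal hk g) z| ≤ M := by
  have hk' : k ≤ N := Nat.le_of_succ_le hk
  set ζ : Config d (k + 1) → ℝ := fun y => K ((y i.castSucc).1 - (y (Fin.last k)).1) a with hζ
  have h0 := hg.integrable_kernel_mul hK (D := fun _ => 1) (B := 1) measurable_const (by simp)
    (Fin.castLE hk' i) ⟨k, by omega⟩ a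
  simp only [mul_one] at h0
  have h1 : Integrable fun y => g y * ζ (fstPart hk y) := h0
  have h1' : Integrable fun y => |g y| * |ζ (fstPart hk y)| := by
    refine h1.abs.congr (ae_of_all _ fun y => abs_mul _ _)
  have h3 := integrable_marginal_mul hk h1
  have h3' := integrable_marginal_mul (g := fun y => |g y|) (ζ := fun y => |ζ y|) hk h1'
  have h4 := (measurePreserving_snocConfig (d := d) (k := k)).integrable_comp_of_integrable h3
  have hN0 : |((N : ℝ) - k) / N| ≤ 1 := by
    have h1 : (k : ℝ) ≤ N := by exact_mod_cast hk'
    have h2 : (0 : ℝ) < N := by exact_mod_cast (by omega : 0 < N)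
    rw [abs_of_nonneg (div_nonneg (by linarith) h2.le), div_le_one h2]
    linarith [(Nat.cast_nonneg k : (0 : ℝ) ≤ k)]
  have h5 : force N K i a (marginal hk g) = fun z => ((N : ℝ) - k) / N *
      ∫ p, marginal hk g (snocConfig z p) * ζ (snocConfig z p) := by
    ext z
    simp only [force, hζ, snocConfig_castSucc, snocConfig_last]
    simp_rw [mul_comm]
  constructor
  · rw [h5]
    exact (Integrable.integral_prod_left h4).const_mul _
  · have h6 : ∫ z, |force N K i a (marginal hk g) z| ≤
        ∫ z, ∫ p, |marginal hk g (snocConfig z p) * ζ (snocConfig z p)| := by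
      rw [h5]
      refine integral_mono_of_nonneg (ae_of_all _ fun z => abs_nonneg _)
        (Integrable.integral_prod_left h4.abs) (ae_of_all _ fun z => ?_)
      simp only [abs_mul (((N : ℝ) - k) / N)]
      exact (mul_le_of_le_one_left (abs_nonneg _) hN0).trans abs_integral_le_integral_abs
    have h7 : ∫ z, ∫ p, |marginal hk g (snocConfig z p) * ζ (snocConfig z p)| =
        ∫ y, |marginal hk g y * ζ y| := by
      have h0 := (measurePreserving_snocConfig (d := d) (k := k)).map_eq
      conv_rhs => rw [← h0]
      rw [integral_map measurable_snocConfig.aemeasurable (by rw [h0]; exact h3.abs.1),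
        integral_prod _ (by exact h4.abs)]
    have h8 : ∫ y, |marginal hk g y * ζ y| ≤ ∫ y, marginal hk (fun y => |g y|) y * |ζ y| := by
      refine integral_mono h3.abs h3' fun y => ?_
      simp only [abs_mul]
      exact mul_le_mul_of_nonneg_right abs_integral_le_integral_abs (abs_nonneg _)
    have h9 := integral_marginal_mul (g := fun y => |g y|) (ζ := fun y => |ζ y|) hk h1'
    have h10 : ∫ y, |g y| * |ζ (fstPart hk y)| ≤ M := by
      refine le_trans (integral_mono h1' (hg.integrable_kernel (Fin.castLE hk' i) ⟨k, by omega⟩)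
        fun y => ?_) (hg.integral_kernel_le (Fin.castLE hk' i) ⟨k, by omega⟩)
      simp only
      rw [mul_comm]
      exact mul_le_mul_of_nonneg_right (abs_coord_le _ _) (abs_nonneg _)
    linarith

lemma hasCompactSupport_comp_sub {η : Config d k → ℝ} (hc : HasCompactSupport η)
    (z : Config d k) : HasCompactSupport fun y => η (z - y) :=
  hc.comp_homeomorph (Homeomorph.subLeft z)

/-- The mollified equation of the marginal on `k` particles: the time derivative of the
convolution with `η`. -/
lemma conv_marginal_sub_eq_integral {σ : ℝ} {K : Torus d → Vel d} (hK : Measurable K)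
    {f : ℝ → Config d N → ℝ} (hf : IsWeakSolution σ K f) (hfm : Measurable (Function.uncurry f))
    {M : ℝ} (hM : ∀ t ∈ Icc (0 : ℝ) 1, IsControlled K M (f t))
    (hsymm : ∀ t ∈ Icc (0 : ℝ) 1, ∀ π : Equiv.Perm (Fin N), ∀ᵐ z, f t (z ∘ π) = f t z)
    (hk : k + 1 ≤ N) {η : Config d k → ℝ} (h : IsSmooth η) (hc : HasCompactSupport η)
    (z : Config d k) :
    let D : ℝ → ℝ := fun s =>
      (∫ y, marginal (Nat.le_of_succ_le hk) (f s) y * advection N K (fun y' => η (z - y')) y) +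
        ∑ i, ∑ a, (σ ^ 2 / 2 * conv (dirDeriv (dirV i a) (dirDeriv (dirV i a) η))
          (marginal (Nat.le_of_succ_le hk) (f s)) z -
            conv (dirDeriv (dirV i a) η) (force N K i a (marginal hk (f s))) z)
    IntervalIntegrable D volume 0 1 ∧ ∀ t ∈ Icc (0 : ℝ) 1,
      conv η (marginal (Nat.le_of_succ_le hk) (f t)) z -
        conv η (marginal (Nat.le_of_succ_le hk) (f 0)) z = ∫ s in (0 : ℝ)..t, D s := by
  intro D
  have hk' : k ≤ N := Nat.le_of_succ_le hk
  set ψ : Config d k → ℝ := fun y => η (z - y) with hψdef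
  have hψ : IsSmooth ψ := h.comp_sub z
  have hψc : HasCompactSupport ψ := hasCompactSupport_comp_sub hc z
  obtain ⟨B, hB⟩ := boundedDerivs_comp_fstPart hψ hψc hk'
  have hd1 (i : Fin k) (a : Fin d) : dirDeriv (dirV i a) ψ =
      fun y => -dirDeriv (dirV i a) η (z - y) := funext fun y => dirDeriv_comp_sub h _ z y
  have hd2 (i : Fin k) (a : Fin d) (y : Config d k) :
      dirDeriv (dirV i a) (dirDeriv (dirV i a) ψ) y =
        dirDeriv (dirV i a) (dirDeriv (dirV i a) η) (z - y) := by
    rw [hd1, dirDeriv_neg, dirDeriv_comp_sub (h.dirDeriv _), neg_neg]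
  have hbd (ζ : Config d k → ℝ) (hζ : IsSmooth ζ) (hζc : HasCompactSupport ζ)
      (g : Config d k → ℝ) (hg : Integrable g) : Integrable fun y => g y * ζ (z - y) := by
    obtain ⟨B, hB0, hB⟩ := exists_bound_of_compactSupport hζ hζc
    refine (integrable_bdd_mul' (hζ.comp_sub z).measurable.aestronglyMeasurable
      (fun y => hB (z - y)) hg).congr (ae_of_all _ fun y => mul_comm _ _)
  have hDeq (s : ℝ) (hs : s ∈ Icc (0 : ℝ) 1) :
      ∫ y, f s y * generator σ N K (fun y => ψ (fstPart hk' y)) y = D s := by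
    have hfs := hM s hs
    rw [integral_generator_comp_fstPart hK hfs (hfm.comp measurable_prodMk_left) (hsymm s hs) hk
      hψ hψc]
    have hlap (y : Config d k) : ∑ i, laplV i ψ y =
        ∑ i, ∑ a, dirDeriv (dirV i a) (dirDeriv (dirV i a) η) (z - y) := by
      simp_rw [laplV_eq_sum hψ, hd2]
    have hmi := integrable_marginal hk' hfs.integrable
    have hi2 (i : Fin k) (a : Fin d) := hbd _ ((h.dirDeriv (dirV i a)).dirDeriv (dirV i a))
      (hasCompactSupport_dirDeriv (hasCompactSupport_dirDeriv hc (dirV i a)) (dirV i a)) _ hmi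
    have hlapeq : (fun y => marginal hk' (f s) y * (σ ^ 2 / 2 * ∑ i, laplV i ψ y)) =
        fun y => σ ^ 2 / 2 * ∑ i, ∑ a, marginal hk' (f s) y *
          dirDeriv (dirV i a) (dirDeriv (dirV i a) η) (z - y) := by
      ext y; rw [hlap]; simp_rw [← Finset.mul_sum]; ring
    have hlapint : Integrable fun y =>
        marginal hk' (f s) y * (σ ^ 2 / 2 * ∑ i, laplV i ψ y) := by
      rw [hlapeq]
      exact (integrable_finsetSum _ fun i _ => integrable_finsetSum _ fun a _ =>
        hi2 i a).const_mul _
    have hgenint : Integrable fun y => marginal hk' (f s) y * generator σ N K ψ y := by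
      refine integrable_marginal_mul hk' ?_
      have h1 := hfs.integrable_mul_generator hK hB σ N
      choose BV hBV hBV' using fun i a => exists_bound_of_compactSupport
        (hψ.dirDeriv (dirV i a)) (hasCompactSupport_dirDeriv hψc _)
      have h2 : Integrable fun y => f s y * outerInteraction hk' K ψ y := by
        have : (fun y => f s y * outerInteraction hk' K ψ y) = fun y => 1 / (N : ℝ) *
            ∑ i : Fin k, ∑ j : Fin (N - k), ∑ a, f s y * (K ((y (Fin.castLE hk' i)).1 -
              (y ⟨k + j, by omega⟩).1) a * dirDeriv (dirV i a) ψ (fstPart hk' y)) := by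
          ext y
          rw [outerInteraction, mul_left_comm]
          simp_rw [Finset.mul_sum]
        rw [this]
        exact (integrable_finsetSum _ fun i _ => integrable_finsetSum _ fun j _ =>
          integrable_finsetSum _ fun a _ => hfs.integrable_kernel_mul hK
            (D := fun y => dirDeriv (dirV i a) ψ (fstPart hk' y))
            ((hψ.dirDeriv _).measurable.comp (measurable_fstPart hk'))
            (fun y => hBV' i a _) _ _ a).const_mul _
      refine (h1.sub h2).congr (ae_of_all _ fun y => ?_)
      simp only [Pi.sub_apply, generator_comp_fstPart hψ hk']; ring
    have hadv : Integrable fun y => marginal hk' (f s) y * advection N K ψ y := by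
      refine (hgenint.sub hlapint).congr (ae_of_all _ fun y => ?_)
      simp only [Pi.sub_apply, generator]; ring
    simp_rw [generator, mul_add]
    rw [integral_add hadv hlapint, hlapeq, integral_const_mul,
      integral_finsetSum _ fun i _ => integrable_finsetSum _ fun a _ => hi2 i a]
    simp_rw [integral_finsetSum _ fun a _ => hi2 _ a, hd1, mul_neg, integral_neg]
    simp only [D, conv]
    rw [add_assoc]
    congr 1
    simp_rw [Finset.mul_sum, ← Finset.sum_add_distrib, sub_eq_add_neg]
    simp_rw [mul_comm (dirDeriv _ _ _)]
  have hmD : AEStronglyMeasurable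
      (fun s => ∫ y, f s y * generator σ N K (fun y => ψ (fstPart hk' y)) y)
      (volume : Measure ℝ) := by
    refine (StronglyMeasurable.integral_prod_right (f := fun s y =>
      f s y * generator σ N K (fun y => ψ (fstPart hk' y)) y) ?_).aestronglyMeasurable
    exact (hfm.mul ((measurable_generator hK (hψ.comp_fstPart hk')).comp
      measurable_snd)).stronglyMeasurable
  have hint : IntervalIntegrable
      (fun s => ∫ y, f s y * generator σ N K (fun y => ψ (fstPart hk' y)) y) volume 0 1 := by
    refine (intervalIntegrable_const (c := B *
      ((N + σ ^ 2 / 2 * (N * d) + d * (N * N)) * M))).mono_fun hmD.restrict ?_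
    refine (ae_restrict_iff' measurableSet_uIoc).2 (ae_of_all _ fun s hs => ?_)
    rw [uIoc_of_le zero_le_one] at hs
    exact ((hM s ⟨hs.1.le, hs.2⟩).abs_integral_mul_generator_le hB σ N).trans (le_abs_self _)
  refine ⟨hint.congr fun s hs => hDeq s ?_, fun t ht => ?_⟩
  · rw [uIoc_of_le zero_le_one] at hs
    exact ⟨hs.1.le, hs.2⟩
  · have h1 := hf.of_boundedDerivs hK hfm hM hB ht
    have h2 (s : ℝ) (hs : s ∈ Icc (0 : ℝ) 1) :
        ∫ y, f s y * ψ (fstPart hk' y) = conv η (marginal hk' (f s)) z := by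
      have hi : Integrable fun y => f s y * ψ (fstPart hk' y) :=
        (integrable_bdd_mul' (hψ.comp_fstPart hk').measurable.aestronglyMeasurable hB.value
          (hM s hs).integrable).congr (ae_of_all _ fun y => mul_comm _ _)
      rw [← integral_marginal_mul hk' hi, conv]
      simp_rw [mul_comm, hψdef]
    rw [h2 t ht, h2 0 ⟨le_rfl, zero_le_one⟩] at h1
    rw [h1]
    refine intervalIntegral.integral_congr fun s hs => hDeq s ?_
    rw [uIcc_of_le ht.1] at hs
    exact ⟨hs.1, hs.2.trans ht.2⟩

end Mollified

/-! ### The pointwise dissipation inequality -/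

section Pointwise

/-- The constant in front of the gradient of the weight. -/
def weightConst (q τ : ℝ) : ℝ := (q * τ + q) / 2

/-- The constant in front of the mean force. -/
def forceConst (q τ : ℝ) : ℝ := q * (q - 1) / (2 * τ) + q / 2

/-- The constant `Λ`. -/
def lamConst (q τ : ℝ) : ℝ := 4 * weightConst q τ + 1

/-- The parameter in Young's inequality. -/
def youngConst (d : ℕ) (q τ : ℝ) : ℝ := 1 / (16 * lamConst q τ ^ 2 * (forceConst q τ * d))

variable {q τ : ℝ}

lemma weightConst_pos (hq : 2 ≤ q) (hτ : 0 < τ) : 0 < weightConst q τ := by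
  unfold weightConst; positivity

lemma forceConst_pos (hq : 2 ≤ q) (hτ : 0 < τ) : 0 < forceConst q τ := by
  have : 0 < q - 1 := by linarith
  unfold forceConst; positivity

lemma lamConst_pos (hq : 2 ≤ q) (hτ : 0 < τ) : 0 < lamConst q τ := by
  have := weightConst_pos hq hτ
  unfold lamConst; positivity

lemma youngConst_pos {d : ℕ} (hd : 0 < d) (hq : 2 ≤ q) (hτ : 0 < τ) : 0 < youngConst d q τ := by
  have := forceConst_pos hq hτ
  have := lamConst_pos hq hτ
  have : (0 : ℝ) < d := by exact_mod_cast hd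
  unfold youngConst; positivity

lemma abs_rpow_mul_sq_le (hq : 2 ≤ q) {δ : ℝ} (hδ : 0 < δ) (u h : ℝ) :
    |u| ^ (q - 2) * h ^ 2 ≤ δ * |u| ^ q + (1 / δ) ^ ((q - 2) / 2) * |h| ^ q := by
  have h0 : 0 ≤ |u| ^ (q - 2) := by positivity
  rcases le_or_gt (h ^ 2) (δ * u ^ 2) with hle | hlt
  · have h1 : |u| ^ (q - 2) * h ^ 2 ≤ δ * |u| ^ q := by
      rw [← abs_rpow_mul_sq hq u]
      nlinarith [mul_le_mul_of_nonneg_left hle h0]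
    have h2 : 0 ≤ (1 / δ) ^ ((q - 2) / 2) * |h| ^ q := by positivity
    linarith
  · have h1 : u ^ 2 ≤ 1 / δ * h ^ 2 := by
      rw [one_div, inv_mul_eq_div, le_div_iff₀ hδ]; linarith
    have hsq (x : ℝ) : (x ^ 2) ^ ((q - 2) / 2) = |x| ^ (q - 2) := by
      rw [← sq_abs, ← Real.rpow_natCast, ← Real.rpow_mul (abs_nonneg _)]
      congr 1; push_cast; ring
    have h2 : |u| ^ (q - 2) ≤ (1 / δ) ^ ((q - 2) / 2) * |h| ^ (q - 2) := by
      rw [← hsq u, ← hsq h, ← Real.mul_rpow (by positivity) (by positivity)]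
      exact Real.rpow_le_rpow (by positivity) h1 (by linarith)
    have h3 : 0 ≤ δ * |u| ^ q := by positivity
    rw [← abs_rpow_mul_sq hq h]
    nlinarith [mul_le_mul_of_nonneg_right h2 (sq_nonneg h)]

/-- The quadratic form of the dissipation. -/
lemma dissipation_le (hq : 2 ≤ q) (hτ : 0 < τ) (a b h : ℝ) :
    -(q * (((q - 1) * a + b) * (τ * a - h))) ≤
      weightConst q τ * b ^ 2 + forceConst q τ * h ^ 2 := by
  have h1 : q * (q - 1) * (a * h) ≤
      q * (q - 1) * (τ / 2 * a ^ 2 + 1 / (2 * τ) * h ^ 2) := by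
    refine mul_le_mul_of_nonneg_left ?_ (mul_nonneg (by linarith) (by linarith))
    have : τ / 2 * a ^ 2 + 1 / (2 * τ) * h ^ 2 - a * h = (τ * a - h) ^ 2 / (2 * τ) := by
      field_simp; ring
    have : 0 ≤ (τ * a - h) ^ 2 / (2 * τ) := by positivity
    linarith
  have h2 : -(q * τ * (a * b)) ≤ q * τ * (a ^ 2 / 2 + b ^ 2 / 2) := by
    nlinarith [mul_nonneg (mul_nonneg (by linarith : 0 ≤ q) hτ.le) (sq_nonneg (a + b))]
  have h3 : q * (b * h) ≤ q * (b ^ 2 / 2 + h ^ 2 / 2) :=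
    mul_le_mul_of_nonneg_left (by nlinarith [sq_nonneg (b - h)]) (by linarith)
  have h4 : 0 ≤ q * τ * (q - 2) * a ^ 2 := by
    have : 0 ≤ q - 2 := by linarith
    positivity
  have h5 : forceConst q τ * h ^ 2 = q * (q - 1) * (1 / (2 * τ) * h ^ 2) + q / 2 * h ^ 2 := by
    unfold forceConst; ring
  rw [h5]
  unfold weightConst
  nlinarith

/-- The terms of the energy balance at one point: dissipation and the decay of the weight control
everything but the mean force. -/
lemma pointwise_dissipation_le {d k : ℕ} (hd : 0 < d) (hq : 2 ≤ q) (hτ : 0 < τ) {κ s w u : ℝ}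
    (hκ : 1 / (2 * lamConst q τ) ≤ κ) (hκ' : κ ≤ 1 / lamConst q τ) (hs : s ∈ Icc (0 : ℝ) 1)
    (hw : (k : ℝ) ≤ w) {a om h : Fin k → Fin d → ℝ} (hom : ∑ i, ∑ c, om i c ^ 2 ≤ 4 * w) :
    -(∑ i, ∑ c, q * (((q - 1) * |u| ^ (q - 2) * a i c +
        |u| ^ (q - 2) * u * (κ / (1 + s) * om i c)) * (τ * a i c - h i c))) -
      κ / (1 + s) ^ 2 * w * |u| ^ q ≤
      forceConst q τ * (1 / youngConst d q τ) ^ ((q - 2) / 2) * ∑ i, ∑ c, |h i c| ^ q := by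
  set Λ := lamConst q τ with hΛdef
  set c1 := weightConst q τ with hc1
  set c2 := forceConst q τ with hc2
  set δ := youngConst d q τ with hδdef
  set Cδ := (1 / δ) ^ ((q - 2) / 2) with hCδ
  set m := |u| ^ (q - 2) with hm
  set lam := κ / (1 + s) with hlam
  have hΛ : 0 < Λ := lamConst_pos hq hτ
  have hc1p : 0 < c1 := weightConst_pos hq hτ
  have hc2p : 0 < c2 := forceConst_pos hq hτ
  have hδp : 0 < δ := youngConst_pos hd hq hτ
  have hm0 : 0 ≤ m := by positivity
  have hdp : (0 : ℝ) < d := by exact_mod_cast hd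
  have hs1 : 0 < 1 + s := by linarith [hs.1]
  have hκp : 0 < κ := lt_of_lt_of_le (by positivity) hκ
  have hw0 : 0 ≤ w := (Nat.cast_nonneg k).trans hw
  have huq : m * u ^ 2 = |u| ^ q := abs_rpow_mul_sq hq u
  have huq0 : 0 ≤ |u| ^ q := by positivity
  have hterm (i : Fin k) (c : Fin d) :
      -(q * (((q - 1) * m * a i c + m * u * (lam * om i c)) * (τ * a i c - h i c))) ≤
        c1 * lam ^ 2 * |u| ^ q * om i c ^ 2 + (c2 * (δ * |u| ^ q) + c2 * Cδ * |h i c| ^ q) := by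
    have h1 := mul_le_mul_of_nonneg_left
      (dissipation_le hq hτ (a i c) (u * (lam * om i c)) (h i c)) hm0
    have h2 := mul_le_mul_of_nonneg_left (abs_rpow_mul_sq_le hq hδp u (h i c)) hc2p.le
    rw [← huq]
    rw [← huq] at h2
    have e1 : m * -(q * (((q - 1) * a i c + u * (lam * om i c)) * (τ * a i c - h i c))) =
      -(q * (((q - 1) * m * a i c + m * u * (lam * om i c)) * (τ * a i c - h i c))) := by ring
    rw [e1] at h1
    calc _ ≤ _ := h1
      _ = c1 * lam ^ 2 * (m * u ^ 2) * om i c ^ 2 + c2 * (m * h i c ^ 2) := by ring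
      _ ≤ _ := by linarith
  have hsum : -(∑ i, ∑ c, q * (((q - 1) * m * a i c + m * u * (lam * om i c)) *
        (τ * a i c - h i c))) ≤
      c1 * lam ^ 2 * |u| ^ q * (∑ i, ∑ c, om i c ^ 2) + (k * d * (c2 * (δ * |u| ^ q)) +
        c2 * Cδ * ∑ i, ∑ c, |h i c| ^ q) := by
    have e : c1 * lam ^ 2 * |u| ^ q * (∑ i, ∑ c, om i c ^ 2) + (k * d * (c2 * (δ * |u| ^ q)) +
        c2 * Cδ * ∑ i, ∑ c, |h i c| ^ q) = ∑ i : Fin k, ∑ c : Fin d,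
          (c1 * lam ^ 2 * |u| ^ q * om i c ^ 2 + (c2 * (δ * |u| ^ q) + c2 * Cδ * |h i c| ^ q)) := by
      simp_rw [Finset.sum_add_distrib, ← Finset.mul_sum]
      simp
      ring
    rw [e]
    simp_rw [← Finset.sum_neg_distrib]
    exact Finset.sum_le_sum fun i _ => Finset.sum_le_sum fun c _ => hterm i c
  have hdecay : (4 * c1 + 1) * lam ^ 2 ≤ κ / (1 + s) ^ 2 := by
    have h1 : κ / (1 + s) ^ 2 = (1 / κ) * lam ^ 2 := by
      rw [hlam]; field_simp
    rw [h1]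
    refine mul_le_mul_of_nonneg_right ?_ (sq_nonneg _)
    rw [le_div_iff₀ hκp]
    calc Λ * κ ≤ Λ * (1 / Λ) := mul_le_mul_of_nonneg_left hκ' hΛ.le
      _ = 1 := by field_simp
  have hlamge : c2 * d * δ ≤ lam ^ 2 := by
    have h1 : c2 * d * δ = (1 / (4 * Λ)) ^ 2 := by
      rw [hδdef, youngConst, ← hΛdef, ← hc2]; field_simp; norm_num
    rw [h1]
    refine pow_le_pow_left₀ (by positivity) ?_ 2
    rw [hlam, le_div_iff₀ hs1]
    calc 1 / (4 * Λ) * (1 + s) ≤ 1 / (4 * Λ) * 2 :=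
          mul_le_mul_of_nonneg_left (by linarith [hs.2]) (by positivity)
      _ = 1 / (2 * Λ) := by field_simp; norm_num
      _ ≤ κ := hκ
  have h1 : c1 * lam ^ 2 * |u| ^ q * (∑ i, ∑ c, om i c ^ 2) ≤ c1 * lam ^ 2 * |u| ^ q * (4 * w) :=
    mul_le_mul_of_nonneg_left hom (by positivity)
  have h2 : k * d * (c2 * (δ * |u| ^ q)) ≤ w * (lam ^ 2 * |u| ^ q) := by
    have : k * d * (c2 * (δ * |u| ^ q)) = k * ((c2 * d * δ) * |u| ^ q) := by ring
    rw [this]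
    exact mul_le_mul hw (mul_le_mul_of_nonneg_right hlamge huq0) (by positivity) hw0
  have h3 : (4 * c1 + 1) * lam ^ 2 * (w * |u| ^ q) ≤ κ / (1 + s) ^ 2 * (w * |u| ^ q) :=
    mul_le_mul_of_nonneg_right hdecay (by positivity)
  nlinarith

end Pointwise

/-! ### Bounded and integrable families -/

section Tame

variable {X : Type*} [MeasurableSpace X]

/-- A jointly measurable family, bounded for times in `[0, T]`. -/
structure IsBddFamily (T : ℝ) (F : ℝ → X → ℝ) : Prop where
  measurable : Measurable (Function.uncurry F)
  bounded : ∃ B, 0 ≤ B ∧ ∀ s ∈ Icc 0 T, ∀ x, |F s x| ≤ B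

/-- A jointly measurable family, bounded and uniformly integrable for times in `[0, T]`. -/
structure IsTame (μ : Measure X) (T : ℝ) (F : ℝ → X → ℝ) : Prop extends IsBddFamily T F where
  integrable : ∃ C, ∀ s ∈ Icc 0 T, Integrable (F s) μ ∧ ∫ x, |F s x| ∂μ ≤ C

variable {μ : Measure X} {T : ℝ} {F G : ℝ → X → ℝ}

lemma IsBddFamily.mul (hF : IsBddFamily T F) (hG : IsBddFamily T G) :
    IsBddFamily T fun s x => F s x * G s x := by
  obtain ⟨B, hB, h⟩ := hF.bounded
  obtain ⟨B', hB', h'⟩ := hG.bounded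
  refine ⟨hF.measurable.mul hG.measurable, B * B', mul_nonneg hB hB', fun s hs x => ?_⟩
  rw [abs_mul]
  exact mul_le_mul (h s hs x) (h' s hs x) (abs_nonneg _) hB

lemma IsBddFamily.add (hF : IsBddFamily T F) (hG : IsBddFamily T G) :
    IsBddFamily T fun s x => F s x + G s x := by
  obtain ⟨B, hB, h⟩ := hF.bounded
  obtain ⟨B', hB', h'⟩ := hG.bounded
  refine ⟨hF.measurable.add hG.measurable, B + B', add_nonneg hB hB', fun s hs x => ?_⟩
  exact (abs_add_le _ _).trans (add_le_add (h s hs x) (h' s hs x))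

lemma isBddFamily_const (c : ℝ) : IsBddFamily T fun (_ : ℝ) (_ : X) => c :=
  ⟨measurable_const, |c|, abs_nonneg _, fun _ _ _ => le_rfl⟩

lemma IsBddFamily.abs_rpow (hF : IsBddFamily T F) {r : ℝ} (hr : 0 ≤ r) :
    IsBddFamily T fun s x => |F s x| ^ r := by
  obtain ⟨B, hB, h⟩ := hF.bounded
  refine ⟨hF.measurable.abs.pow_const r, B ^ r, by positivity, fun s hs x => ?_⟩
  rw [abs_of_nonneg (by positivity)]
  exact Real.rpow_le_rpow (abs_nonneg _) (h s hs x) hr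

lemma IsBddFamily.mul_tame (hF : IsBddFamily T F) (hG : IsTame μ T G) :
    IsTame μ T fun s x => F s x * G s x := by
  obtain ⟨B, hB, h⟩ := hF.bounded
  obtain ⟨C, hC⟩ := hG.integrable
  refine ⟨hF.mul hG.toIsBddFamily, B * C, fun s hs => ⟨?_, ?_⟩⟩
  · exact (hC s hs).1.bdd_mul (hF.measurable.comp measurable_prodMk_left).aestronglyMeasurable
      (ae_of_all _ (h s hs))
  · calc ∫ x, |F s x * G s x| ∂μ ≤ ∫ x, B * |G s x| ∂μ := by
          refine integral_mono_of_nonneg (ae_of_all _ fun x => abs_nonneg _)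
            ((hC s hs).1.abs.const_mul B) (ae_of_all _ fun x => ?_)
          simp only [abs_mul]
          exact mul_le_mul_of_nonneg_right (h s hs x) (abs_nonneg _)
      _ = B * ∫ x, |G s x| ∂μ := integral_const_mul _ _
      _ ≤ B * C := mul_le_mul_of_nonneg_left (hC s hs).2 hB

lemma IsTame.add (hF : IsTame μ T F) (hG : IsTame μ T G) :
    IsTame μ T fun s x => F s x + G s x := by
  obtain ⟨C, hC⟩ := hF.integrable
  obtain ⟨C', hC'⟩ := hG.integrable
  refine ⟨hF.toIsBddFamily.add hG.toIsBddFamily, C + C', fun s hs =>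
    ⟨(hC s hs).1.add (hC' s hs).1, ?_⟩⟩
  calc ∫ x, |F s x + G s x| ∂μ ≤ ∫ x, (|F s x| + |G s x|) ∂μ :=
        integral_mono ((hC s hs).1.add (hC' s hs).1).abs ((hC s hs).1.abs.add (hC' s hs).1.abs)
          fun x => abs_add_le _ _
    _ = (∫ x, |F s x| ∂μ) + ∫ x, |G s x| ∂μ := integral_add (hC s hs).1.abs (hC' s hs).1.abs
    _ ≤ C + C' := add_le_add (hC s hs).2 (hC' s hs).2

lemma IsTame.const_mul (hF : IsTame μ T F) (c : ℝ) : IsTame μ T fun s x => c * F s x :=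
  (isBddFamily_const c).mul_tame hF

lemma IsTame.sub (hF : IsTame μ T F) (hG : IsTame μ T G) :
    IsTame μ T fun s x => F s x - G s x := by
  simpa [sub_eq_add_neg] using hF.add (hG.const_mul (-1))

lemma isTame_zero : IsTame μ T fun (_ : ℝ) (_ : X) => (0 : ℝ) :=
  ⟨isBddFamily_const 0, 0, fun _ _ => by simp⟩

lemma IsTame.sum {ι : Type*} (s : Finset ι) {F : ι → ℝ → X → ℝ} (hF : ∀ i, IsTame μ T (F i)) :
    IsTame μ T fun t x => ∑ i ∈ s, F i t x := by
  classical
  induction s using Finset.induction_on with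
  | empty => simpa using isTame_zero
  | insert i s hi ih =>
    simp_rw [Finset.sum_insert hi]
    exact (hF i).add ih

lemma IsTame.abs_rpow (hF : IsTame μ T F) {q : ℝ} (hq : 2 ≤ q) :
    IsTame μ T fun s x => |F s x| ^ q := by
  have h := ((hF.toIsBddFamily.abs_rpow (r := q - 2) (by linarith)).mul
    hF.toIsBddFamily).mul_tame hF
  have e : (fun s x => |F s x| ^ (q - 2) * F s x * F s x) = fun s x => |F s x| ^ q := by
    ext s x
    rw [← abs_rpow_mul_sq hq]; ring
  rwa [e] at h

lemma IsTame.integrable_slice (hF : IsTame μ T F) {s : ℝ} (hs : s ∈ Icc 0 T) :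
    Integrable (F s) μ :=
  (hF.integrable.choose_spec s hs).1

lemma IsTame.integrable_prod [SFinite μ] (hF : IsTame μ T F) :
    Integrable (Function.uncurry F) ((volume.restrict (Icc 0 T)).prod μ) := by
  obtain ⟨C, hC⟩ := hF.integrable
  refine (integrable_prod_iff hF.measurable.aestronglyMeasurable).2 ⟨?_, ?_⟩
  · filter_upwards [ae_restrict_mem measurableSet_Icc] with s hs
    exact (hC s hs).1
  · refine Integrable.of_bound (C := C) ?_ ?_
    · exact (StronglyMeasurable.integral_prod_right (f := fun s x => ‖F s x‖)
        hF.measurable.norm.stronglyMeasurable).aestronglyMeasurable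
    · filter_upwards [ae_restrict_mem measurableSet_Icc] with s hs
      rw [Real.norm_of_nonneg (integral_nonneg fun x => norm_nonneg _)]
      exact (hC s hs).2

end Tame

/-! ### Weights -/

section Weight

variable {d k : ℕ} {N : ℕ} {φ : Torus d → ℝ}

lemma measurable_energy (hφ : Measurable φ) : Measurable (energy N φ : Config d k → ℝ) := by
  refine Measurable.add (Finset.measurable_fun_sum _ fun i _ => ?_)
    (measurable_const.mul (Finset.measurable_fun_sum _ fun i _ =>
      Finset.measurable_fun_sum _ fun j _ => ?_))
  · exact measurable_const.add
      ((measurable_snd.comp (measurable_pi_apply i)).norm.pow_const 2)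
  · exact hφ.comp ((measurable_fst.comp (measurable_pi_apply i)).sub
      (measurable_fst.comp (measurable_pi_apply j)))

lemma sum_sq_velocity_le_energy (hφ : ∀ x, 0 ≤ φ x) (z : Config d k) :
    (k : ℝ) + ∑ i, ‖(z i).2‖ ^ 2 ≤ energy N φ z := by
  have h1 : 0 ≤ 1 / (N : ℝ) * ∑ i, ∑ j, φ ((z i).1 - (z j).1) :=
    mul_nonneg (by positivity)
      (Finset.sum_nonneg fun i _ => Finset.sum_nonneg fun j _ => hφ _)
  rw [energy, Finset.sum_add_distrib]
  simp
  simpa using h1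

lemma card_le_energy (hφ : ∀ x, 0 ≤ φ x) (z : Config d k) : (k : ℝ) ≤ energy N φ z :=
  le_trans (by simpa using Finset.sum_nonneg fun i _ => by positivity)
    (sum_sq_velocity_le_energy hφ z)

lemma energy_nonneg (hφ : ∀ x, 0 ≤ φ x) (z : Config d k) : 0 ≤ energy N φ z :=
  (Nat.cast_nonneg k).trans (card_le_energy hφ z)

lemma line_apply_fst (z : Config d k) (i j : Fin k) (a : Fin d) (s : ℝ) :
    ((z + toConfig (s • dirV i a)) j).1 = (z j).1 := by
  rcases eq_or_ne j i with rfl | hj <;> simp [toConfig, dirV, *]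

lemma line_apply_snd_of_ne (z : Config d k) {i j : Fin k} (hj : j ≠ i) (a : Fin d) (s : ℝ) :
    ((z + toConfig (s • dirV i a)) j).2 = (z j).2 := by
  simp [toConfig, dirV, hj]

lemma line_apply_snd (z : Config d k) (i : Fin k) (a : Fin d) (s : ℝ) :
    ((z + toConfig (s • dirV i a)) i).2 = (z i).2 + s • EuclideanSpace.single a 1 := by
  simp [toConfig, dirV]

lemma energy_line (z : Config d k) (i : Fin k) (a : Fin d) (s : ℝ) :
    energy N φ (z + toConfig (s • dirV i a)) = energy N φ z + 2 * s * (z i).2 a + s ^ 2 := by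
  have h1 : ∑ j, (1 + ‖((z + toConfig (s • dirV i a)) j).2‖ ^ 2) =
      ∑ j, (1 + ‖(z j).2‖ ^ 2) + (2 * s * (z i).2 a + s ^ 2) := by
    rw [← Finset.add_sum_erase _ _ (Finset.mem_univ i),
      ← Finset.add_sum_erase _ (fun j => 1 + ‖(z j).2‖ ^ 2) (Finset.mem_univ i),
      line_apply_snd, norm_add_sq_real, inner_smul_right, EuclideanSpace.inner_single_right,
      norm_smul, PiLp.norm_single]
    have h2 : ∑ j ∈ Finset.univ.erase i, (1 + ‖((z + toConfig (s • dirV i a)) j).2‖ ^ 2) =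
        ∑ j ∈ Finset.univ.erase i, (1 + ‖(z j).2‖ ^ 2) := by
      refine Finset.sum_congr rfl fun j hj => ?_
      rw [line_apply_snd_of_ne z (Finset.ne_of_mem_erase hj)]
    rw [h2]
    simp
    ring
  simp only [energy, h1, line_apply_fst]
  ring

/-- The derivative of the truncated energy in a velocity coordinate. -/
def truncGrad (N : ℕ) (φ : Torus d → ℝ) (R : ℝ) (i : Fin k) (a : Fin d) (z : Config d k) : ℝ :=
  if energy N φ z < R then 2 * (z i).2 a else 0

lemma measurable_truncGrad (hφ : Measurable φ) (R : ℝ) (i : Fin k) (a : Fin d) :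
    Measurable (truncGrad N φ R i a) :=
  Measurable.ite (measurableSet_lt (measurable_energy hφ) measurable_const)
    (measurable_const.mul (measurable_coord i a)) measurable_const

lemma sum_truncGrad_sq_le (hφ : ∀ x, 0 ≤ φ x) {R : ℝ} (hR : 0 ≤ R) (z : Config d k) :
    ∑ i, ∑ a, truncGrad N φ R i a z ^ 2 ≤ 4 * min (energy N φ z) R := by
  unfold truncGrad
  split_ifs with h
  · rw [min_eq_left h.le]
    have h1 := sum_sq_velocity_le_energy (N := N) hφ z
    have h2 : ∑ i, ∑ a, (2 * (z i).2 a) ^ 2 = 4 * ∑ i, ‖(z i).2‖ ^ 2 := by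
      simp_rw [EuclideanSpace.real_norm_sq_eq, mul_pow, ← Finset.mul_sum]
      norm_num
    rw [h2]
    linarith [(Nat.cast_nonneg k : (0 : ℝ) ≤ k)]
  · rw [min_eq_right (not_lt.1 h)]
    simpa using hR

lemma abs_truncGrad_le (hφ : ∀ x, 0 ≤ φ x) {R : ℝ} (hR : 0 ≤ R) (i : Fin k) (a : Fin d)
    (z : Config d k) : |truncGrad N φ R i a z| ≤ 2 * (R + 1) := by
  have h1 : truncGrad N φ R i a z ^ 2 ≤ 4 * R := by
    have h2 : truncGrad N φ R i a z ^ 2 ≤ ∑ a, truncGrad N φ R i a z ^ 2 :=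
      Finset.single_le_sum (f := fun a => truncGrad N φ R i a z ^ 2)
        (fun a _ => sq_nonneg _) (Finset.mem_univ a)
    have h3 : ∑ a, truncGrad N φ R i a z ^ 2 ≤ ∑ i, ∑ a, truncGrad N φ R i a z ^ 2 :=
      Finset.single_le_sum (f := fun i => ∑ a, truncGrad N φ R i a z ^ 2)
        (fun i _ => Finset.sum_nonneg fun a _ => sq_nonneg _) (Finset.mem_univ i)
    have h4 := sum_truncGrad_sq_le (N := N) hφ hR z
    have h5 := min_le_right (energy N φ z) R
    linarith
  refine abs_le_of_sq_le_sq ?_ (by linarith)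
  nlinarith

lemma hasDerivAt_exp_trunc (lam R : ℝ) (z : Config d k) (i : Fin k) (a : Fin d) :
    ∃ S : Set ℝ, S.Countable ∧ ∀ s ∉ S, HasDerivAt
      (fun s : ℝ => Real.exp (lam * min (energy N φ (z + toConfig (s • dirV i a))) R))
      (Real.exp (lam * min (energy N φ (z + toConfig (s • dirV i a))) R) *
        (lam * truncGrad N φ R i a (z + toConfig (s • dirV i a)))) s := by
  set E := energy N φ z
  set v := (z i).2 a
  refine ⟨{s | E + 2 * s * v + s ^ 2 = R}, ?_, fun s hs => ?_⟩
  · by_cases hne : ∃ r, E + 2 * r * v + r ^ 2 = R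
    · obtain ⟨r, hr⟩ := hne
      refine ((Set.toFinite {r, -2 * v - r}).subset fun s hs => ?_).countable
      have hs' : E + 2 * s * v + s ^ 2 = R := hs
      have h1 : (s - r) * (s - (-2 * v - r)) = 0 := by linear_combination hs' - hr
      rcases mul_eq_zero.1 h1 with h | h
      · exact Or.inl (by linarith)
      · exact Or.inr (by simp only [mem_singleton_iff]; linarith)
    · have : {s | E + 2 * s * v + s ^ 2 = R} = ∅ :=
        eq_empty_of_forall_notMem fun s hs => hne ⟨s, hs⟩
      rw [this]; exact countable_empty
  · simp only [energy_line, truncGrad]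
    have hs' : E + 2 * s * v + s ^ 2 ≠ R := hs
    have hcont : Continuous fun s : ℝ => E + 2 * s * v + s ^ 2 := by fun_prop
    have hE : HasDerivAt (fun s : ℝ => E + 2 * s * v + s ^ 2) (2 * v + 2 * s) s := by
      have h1 := (((hasDerivAt_id' s).const_mul 2).mul_const v).const_add E
      have h2 := h1.add ((hasDerivAt_id' s).pow 2)
      refine h2.congr_deriv ?_
      simp
    have hmin : HasDerivAt (fun s : ℝ => min (E + 2 * s * v + s ^ 2) R)
        (if E + 2 * s * v + s ^ 2 < R then 2 * v + 2 * s else 0) s := by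
      rcases lt_or_gt_of_ne hs' with h | h
      · rw [if_pos h]
        refine hE.congr_of_eventuallyEq ?_
        filter_upwards [hcont.continuousAt.eventually_lt continuousAt_const h] with r hr
        exact min_eq_left hr.le
      · rw [if_neg h.not_gt]
        refine (hasDerivAt_const s R).congr_of_eventuallyEq ?_
        filter_upwards [continuousAt_const.eventually_lt hcont.continuousAt h] with r hr
        exact min_eq_right hr.le
    have h3 := (hmin.const_mul lam).exp
    refine h3.congr_deriv ?_
    have h4 : ((z + toConfig (s • dirV i a)) i).2 a = v + s := by
      rw [line_apply_snd]; simp [v]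
    rw [h4, mul_add]

lemma continuous_exp_trunc (lam R : ℝ) (z : Config d k) (i : Fin k) (a : Fin d) :
    Continuous fun s : ℝ =>
      Real.exp (lam * min (energy N φ (z + toConfig (s • dirV i a))) R) := by
  simp only [energy_line]
  fun_prop

end Weight

/-! ### The energy inequality for mollified solutions -/

section EnergyInequality

variable {d k : ℕ} {N : ℕ} {φ : Torus d → ℝ} {T : ℝ}

lemma isBddFamily_weight (hφm : Measurable φ) (hφ : ∀ x, 0 ≤ φ x) {κ R : ℝ} (hκ : 0 ≤ κ)
    (hR : 0 ≤ R) : IsBddFamily T fun (s : ℝ) (z : Config d k) =>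
      Real.exp (κ / (1 + s) * min (energy N φ z) R) := by
  refine ⟨?_, Real.exp (κ * R), (Real.exp_pos _).le, fun s hs z => ?_⟩
  · exact Real.measurable_exp.comp ((measurable_const.div (measurable_const.add
      measurable_fst)).mul (((measurable_energy hφm).comp measurable_snd).min measurable_const))
  · rw [abs_of_pos (Real.exp_pos _), Real.exp_le_exp]
    refine mul_le_mul (div_le_self hκ (by linarith [hs.1])) (min_le_right _ _)
      (le_min (energy_nonneg hφ z) hR) hκ

/-- Integration by parts of the diffusion and of the mean force against
`|u|^{q-2} u e^{λ min(e_k, R)}`. -/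
lemma integral_weight_byParts {q : ℝ} (hq : 2 ≤ q) (hφm : Measurable φ) (hφ : ∀ x, 0 ≤ φ x)
    {lam R : ℝ} (hlam : 0 ≤ lam) (hR : 0 ≤ R) (i : Fin k) (a : Fin d)
    {u ua J Ja : Config d k → ℝ} {B : ℝ} (hum : Measurable u) (huam : Measurable ua)
    (hu : ∀ z, |u z| ≤ B) (hua : ∀ z, |ua z| ≤ B) (hJ : Integrable J) (hJa : Integrable Ja)
    (du : ∀ z s, HasDerivAt (fun s : ℝ => u (z + toConfig (s • dirV i a)))
      (ua (z + toConfig (s • dirV i a))) s)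
    (dJ : ∀ z s, HasDerivAt (fun s : ℝ => J (z + toConfig (s • dirV i a)))
      (Ja (z + toConfig (s • dirV i a))) s) :
    ∫ z, Real.exp (lam * min (energy N φ z) R) * (|u z| ^ (q - 2) * u z) * Ja z =
      -∫ z, Real.exp (lam * min (energy N φ z) R) * (((q - 1) * |u z| ^ (q - 2) * ua z +
        |u z| ^ (q - 2) * u z * (lam * truncGrad N φ R i a z)) * J z) := by
  set W : Config d k → ℝ := fun z => Real.exp (lam * min (energy N φ z) R) with hW
  set P : Config d k → ℝ := fun z => |u z| ^ (q - 2) * u z with hP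
  set P' : Config d k → ℝ := fun z => (q - 1) * |u z| ^ (q - 2) with hP'
  have hB : 0 ≤ B := (abs_nonneg _).trans (hu 0)
  have hWm : Measurable W := Real.measurable_exp.comp
    (measurable_const.mul ((measurable_energy hφm).min measurable_const))
  have hWb (z : Config d k) : |W z| ≤ Real.exp (lam * R) := by
    rw [abs_of_pos (Real.exp_pos _), Real.exp_le_exp]
    exact mul_le_mul_of_nonneg_left (min_le_right _ _) hlam
  have hpow (z : Config d k) : |(|u z| ^ (q - 2))| ≤ B ^ (q - 2) := by
    rw [abs_of_nonneg (by positivity)]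
    exact Real.rpow_le_rpow (abs_nonneg _) (hu z) (by linarith)
  have hPm : Measurable P := (hum.abs.pow_const _).mul hum
  have hPb (z : Config d k) : |P z| ≤ B ^ (q - 2) * B := by
    rw [hP, abs_mul]
    exact mul_le_mul (hpow z) (hu z) (abs_nonneg _) (by positivity)
  have hP'm : Measurable P' := measurable_const.mul (hum.abs.pow_const _)
  have hP'b (z : Config d k) : |P' z| ≤ (q - 1) * B ^ (q - 2) := by
    rw [hP', abs_mul, abs_of_nonneg (by linarith : 0 ≤ q - 1)]
    exact mul_le_mul_of_nonneg_left (hpow z) (by linarith)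
  have hint1 : Integrable fun z => W z * P z * Ja z := by
    refine integrable_bdd_mul' (B := Real.exp (lam * R) * (B ^ (q - 2) * B))
      (hWm.mul hPm).aestronglyMeasurable (fun z => ?_) hJa
    rw [abs_mul]
    exact mul_le_mul (hWb z) (hPb z) (abs_nonneg _) (Real.exp_pos _).le
  have hQ : Integrable fun z => W z * P z * J z := by
    refine integrable_bdd_mul' (B := Real.exp (lam * R) * (B ^ (q - 2) * B))
      (hWm.mul hPm).aestronglyMeasurable (fun z => ?_) hJ
    rw [abs_mul]
    exact mul_le_mul (hWb z) (hPb z) (abs_nonneg _) (Real.exp_pos _).le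
  have hint2 : Integrable fun z => W z * ((P' z * ua z +
      P z * (lam * truncGrad N φ R i a z)) * J z) := by
    have hb (z : Config d k) : |W z * (P' z * ua z + P z * (lam * truncGrad N φ R i a z))| ≤
        Real.exp (lam * R) * ((q - 1) * B ^ (q - 2) * B +
          B ^ (q - 2) * B * (lam * (2 * (R + 1)))) := by
      rw [abs_mul]
      refine mul_le_mul (hWb z) ((abs_add_le _ _).trans (add_le_add ?_ ?_)) (abs_nonneg _)
        (Real.exp_pos _).le
      · rw [abs_mul]
        exact mul_le_mul (hP'b z) (hua z) (abs_nonneg _)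
          (mul_nonneg (by linarith) (by positivity))
      · rw [abs_mul (P z), abs_mul lam, abs_of_nonneg hlam]
        exact mul_le_mul (hPb z) (mul_le_mul_of_nonneg_left (abs_truncGrad_le hφ hR i a z) hlam)
          (by positivity) (by positivity)
    refine (integrable_bdd_mul' (hWm.mul ((hP'm.mul huam).add (hPm.mul (measurable_const.mul
      (measurable_truncGrad hφm R i a))))).aestronglyMeasurable hb hJ).congr
      (ae_of_all _ fun z => mul_assoc _ _ _)
  have hzero := integral_lineDeriv_eq_zero (dirV i a) hQ (hint1.add hint2) (fun z => ?_)
    (fun z => ?_)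
  · simp only [Pi.add_apply] at hzero
    rw [integral_add hint1 hint2] at hzero
    linarith
  · refine ((continuous_exp_trunc lam R z i a).mul ?_).mul ?_
    · have hc : Continuous fun s : ℝ => u (z + toConfig (s • dirV i a)) :=
        continuous_iff_continuousAt.2 fun s => (du z s).continuousAt
      exact (hc.abs.rpow_const fun _ => Or.inr (by linarith)).mul hc
    · exact continuous_iff_continuousAt.2 fun s => (dJ z s).continuousAt
  · obtain ⟨S, hS, hd⟩ := hasDerivAt_exp_trunc (N := N) (φ := φ) lam R z i a
    refine ⟨S, hS, fun s hs => ?_⟩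
    have h1 := ((hd s hs).mul ((hasDerivAt_abs_rpow_mul hq _).comp s (du z s))).mul (dJ z s)
    refine h1.congr_deriv ?_
    simp only [Pi.add_apply, hW, hP, hP', Function.comp, Pi.mul_apply]
    ring

/-- The energy inequality for families that solve the mollified equation, with the weight
`e^{κ min(e_k, R) / (1 + t)}`. -/
lemma mollified_energy_inequality (hd : 0 < d) {q τ : ℝ} (hq : 2 ≤ q) (hτ : 0 < τ)
    (hφm : Measurable φ) (hφ : ∀ x, 0 ≤ φ x) {κ R : ℝ} (hκ : 1 / (2 * lamConst q τ) ≤ κ)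
    (hκ' : κ ≤ 1 / lamConst q τ) (hR : (k : ℝ) ≤ R) (hT : T ∈ Icc (0 : ℝ) 1)
    {u A : ℝ → Config d k → ℝ} {ua uaa H Ha : Fin k → Fin d → ℝ → Config d k → ℝ}
    (hu : IsTame volume T u) (hua : ∀ i a, IsTame volume T (ua i a))
    (huaa : ∀ i a, IsTame volume T (uaa i a)) (hH : ∀ i a, IsTame volume T (H i a))
    (hHa : ∀ i a, IsTame volume T (Ha i a))
    (du : ∀ i a, ∀ s ∈ Icc 0 T, ∀ z r, HasDerivAt
      (fun r : ℝ => u s (z + toConfig (r • dirV i a))) (ua i a s (z + toConfig (r • dirV i a))) r)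
    (dua : ∀ i a, ∀ s ∈ Icc 0 T, ∀ z r, HasDerivAt
      (fun r : ℝ => ua i a s (z + toConfig (r • dirV i a)))
      (uaa i a s (z + toConfig (r • dirV i a))) r)
    (dH : ∀ i a, ∀ s ∈ Icc 0 T, ∀ z r, HasDerivAt
      (fun r : ℝ => H i a s (z + toConfig (r • dirV i a)))
      (Ha i a s (z + toConfig (r • dirV i a))) r)
    (hA : Integrable (fun p : ℝ × Config d k =>
      Real.exp (κ / (1 + p.1) * min (energy N φ p.2) R) * |u p.1 p.2| ^ (q - 1) *
        Real.sign (u p.1 p.2) * A p.1 p.2) ((volume.restrict (Icc 0 T)).prod volume))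
    (hDint : ∀ z, IntervalIntegrable (fun s => -A s z +
      ∑ i, ∑ a, (τ * uaa i a s z - Ha i a s z)) volume 0 T)
    (hD : ∀ z, ∀ t ∈ Icc 0 T, u t z = u 0 z + ∫ s in (0 : ℝ)..t, (-A s z +
      ∑ i, ∑ a, (τ * uaa i a s z - Ha i a s z))) :
    (∫ z, Real.exp (κ / (1 + T) * min (energy N φ z) R) * |u T z| ^ q) +
      q * (∫ s in Icc 0 T, ∫ z, Real.exp (κ / (1 + s) * min (energy N φ z) R) *
        |u s z| ^ (q - 1) * Real.sign (u s z) * A s z) ≤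
      (∫ z, Real.exp (κ * min (energy N φ z) R) * |u 0 z| ^ q) +
        forceConst q τ * (1 / youngConst d q τ) ^ ((q - 2) / 2) *
          ∫ s in Icc 0 T, ∫ z, Real.exp (κ / (1 + s) * min (energy N φ z) R) *
            ∑ i, ∑ a, |H i a s z| ^ q := by
  have hκp : 0 < κ := lt_of_lt_of_le (by have := lamConst_pos hq hτ; positivity) hκ
  have hR0 : 0 ≤ R := (Nat.cast_nonneg k).trans hR
  have h0T : (0 : ℝ) ∈ Icc 0 T := ⟨le_rfl, hT.1⟩
  have hTT : T ∈ Icc 0 T := ⟨hT.1, le_rfl⟩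
  set C := forceConst q τ * (1 / youngConst d q τ) ^ ((q - 2) / 2) with hC
  set W : ℝ → Config d k → ℝ := fun s z => Real.exp (κ / (1 + s) * min (energy N φ z) R) with hW
  set P : ℝ → Config d k → ℝ := fun s z => |u s z| ^ (q - 2) * u s z with hP
  have hWb : IsBddFamily T W := isBddFamily_weight hφm hφ hκp.le hR0
  have hPb : IsBddFamily T P :=
    (hu.toIsBddFamily.abs_rpow (by linarith)).mul hu.toIsBddFamily
  set Ja : Fin k → Fin d → ℝ → Config d k → ℝ := fun i a s z => τ * uaa i a s z - Ha i a s z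
    with hJa
  have hJat (i : Fin k) (a : Fin d) : IsTame volume T (Ja i a) :=
    ((huaa i a).const_mul τ).sub (hHa i a)
  have hdiff : IsBddFamily T fun (s : ℝ) (z : Config d k) =>
      κ / (1 + s) ^ 2 * min (energy N φ z) R := by
    refine ⟨?_, κ * R, by positivity, fun s hs z => ?_⟩
    · exact (measurable_const.div ((measurable_const.add measurable_fst).pow_const 2)).mul
        (((measurable_energy hφm).comp measurable_snd).min measurable_const)
    · have h1 : 0 ≤ min (energy N φ z) R := le_min (energy_nonneg hφ z) hR0
      have h2 : 0 < 1 + s := by linarith [hs.1]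
      rw [abs_of_nonneg (by positivity)]
      refine mul_le_mul (div_le_self hκp.le ?_) (min_le_right _ _) h1 hκp.le
      nlinarith [hs.1]
  set ED : ℝ → Config d k → ℝ := fun s z => W s z * |u s z| ^ (q - 1) *
    Real.sign (u s z) * A s z with hED
  set Rm : ℝ → Config d k → ℝ := fun s z => W s z * ((∑ i, ∑ a, q * P s z * Ja i a s z) -
    κ / (1 + s) ^ 2 * min (energy N φ z) R * |u s z| ^ q) with hRm
  have hRmt : IsTame volume T Rm := by
    refine hWb.mul_tame (IsTame.sub (IsTame.sum _ fun i => IsTame.sum _ fun a => ?_) ?_)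
    · exact ((isBddFamily_const q).mul hPb).mul_tame (hJat i a)
    · exact hdiff.mul_tame (hu.abs_rpow hq)
  have hHt : IsTame volume T fun s z => W s z * ∑ i, ∑ a, |H i a s z| ^ q :=
    hWb.mul_tame (IsTame.sum _ fun i => IsTame.sum _ fun a => (hH i a).abs_rpow hq)
  have hΦt : IsTame volume T fun s z => W s z * |u s z| ^ q := hWb.mul_tame (hu.abs_rpow hq)
  have hED' (s : ℝ) (z : Config d k) : ED s z = W s z * P s z * A s z := by
    simp only [hED, hP]
    rw [mul_assoc (W s z), abs_rpow_mul_sign]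
  have hA' : Integrable (Function.uncurry ED)
      ((volume.restrict (Icc 0 T)).prod volume) := hA
  have hRmi := hRmt.integrable_prod
  have hchain : ∀ᵐ z, W T z * |u T z| ^ q - W 0 z * |u 0 z| ^ q =
      ∫ s in Icc 0 T, (-q * ED s z + Rm s z) := by
    refine ae_of_all _ fun z => ?_
    have h := weighted_power_sub_eq_integral (u := fun t => u t z) hq hT.1 (hDint z) (hD z) κ
      (min (energy N φ z) R)
    simp only [hW, add_zero, div_one]
    rw [h, intervalIntegral.integral_of_le hT.1, integral_Icc_eq_integral_Ioc]
    refine integral_congr_ae (ae_of_all _ fun s => ?_)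
    simp only [hED', hRm, hW]
    simp_rw [← Finset.mul_sum]
    ring
  have hswapint : Integrable (fun p : ℝ × Config d k => -q * ED p.1 p.2 + Rm p.1 p.2)
      ((volume.restrict (Icc 0 T)).prod volume) := (hA'.const_mul (-q)).add hRmi
  have hmain : (∫ z, W T z * |u T z| ^ q) - ∫ z, W 0 z * |u 0 z| ^ q =
      -q * (∫ s in Icc 0 T, ∫ z, ED s z) + ∫ s in Icc 0 T, ∫ z, Rm s z := by
    have e1 : Integrable (fun s => ∫ z, ED s z) (volume.restrict (Icc 0 T)) :=
      Integrable.integral_prod_left hA'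
    have e2 : Integrable (fun s => ∫ z, Rm s z) (volume.restrict (Icc 0 T)) :=
      Integrable.integral_prod_left hRmi
    rw [← integral_sub (hΦt.integrable_slice hTT) (hΦt.integrable_slice h0T),
      integral_congr_ae hchain, ← integral_integral_swap hswapint, ← integral_const_mul,
      ← integral_add (e1.const_mul _) e2]
    refine integral_congr_ae ?_
    filter_upwards [hA'.prod_right_ae, ae_restrict_mem measurableSet_Icc] with s hs hsT
    have hs' : Integrable fun z => ED s z := hs
    rw [integral_add (hs'.const_mul _) (hRmt.integrable_slice hsT), integral_const_mul]
  have hineq (s : ℝ) (hs : s ∈ Icc 0 T) :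
      ∫ z, Rm s z ≤ C * ∫ z, W s z * ∑ i, ∑ a, |H i a s z| ^ q := by
    have hs1 : s ∈ Icc (0 : ℝ) 1 := ⟨hs.1, hs.2.trans hT.2⟩
    have hlam : 0 ≤ κ / (1 + s) := div_nonneg hκp.le (by linarith [hs.1])
    have hparts (i : Fin k) (a : Fin d) : ∫ z, W s z * P s z * Ja i a s z =
        -∫ z, W s z * (((q - 1) * |u s z| ^ (q - 2) * ua i a s z +
          P s z * (κ / (1 + s) * truncGrad N φ R i a z)) * (τ * ua i a s z - H i a s z)) := by
      obtain ⟨B, hB0, hB⟩ := hu.bounded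
      obtain ⟨B', hB0', hB'⟩ := (hua i a).bounded
      refine integral_weight_byParts hq hφm hφ hlam hR0 i a
        (hu.measurable.comp measurable_prodMk_left)
        ((hua i a).measurable.comp measurable_prodMk_left)
        (fun z => (hB s hs z).trans (le_max_left B B'))
        (fun z => (hB' s hs z).trans (le_max_right B B'))
        ((((hua i a).const_mul τ).sub (hH i a)).integrable_slice hs)
        ((hJat i a).integrable_slice hs) (du i a s hs) fun z r => ?_
      exact ((dua i a s hs z r).const_mul τ).sub (dH i a s hs z r)
    have htg (i : Fin k) (a : Fin d) : IsBddFamily T fun s z =>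
        (κ / (1 + s) * truncGrad N φ R i a z) := by
      refine ⟨(measurable_const.div (measurable_const.add measurable_fst)).mul
        ((measurable_truncGrad hφm R i a).comp measurable_snd), κ * (2 * (R + 1)), by positivity,
        fun r hr z => ?_⟩
      rw [abs_mul, abs_of_nonneg (div_nonneg hκp.le (by linarith [hr.1]))]
      exact mul_le_mul (div_le_self hκp.le (by linarith [hr.1])) (abs_truncGrad_le hφ hR0 i a z)
        (abs_nonneg _) hκp.le
    have hXt (i : Fin k) (a : Fin d) : IsTame volume T fun s z =>
        W s z * (((q - 1) * |u s z| ^ (q - 2) * ua i a s z +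
          P s z * (κ / (1 + s) * truncGrad N φ R i a z)) * (τ * ua i a s z - H i a s z)) := by
      refine hWb.mul_tame (IsBddFamily.mul_tame (IsBddFamily.add ?_ (hPb.mul (htg i a)))
        (((hua i a).const_mul τ).sub (hH i a)))
      exact ((isBddFamily_const (q - 1)).mul (hu.toIsBddFamily.abs_rpow (by linarith))).mul
        (hua i a).toIsBddFamily
    have hYt (i : Fin k) (a : Fin d) : IsTame volume T fun s z => W s z * P s z * Ja i a s z :=
      (hWb.mul hPb).mul_tame (hJat i a)
    have hZt : IsTame volume T fun s z => W s z * (κ / (1 + s) ^ 2 * min (energy N φ z) R *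
        |u s z| ^ q) := hWb.mul_tame (hdiff.mul_tame (hu.abs_rpow hq))
    have hRmeq : (fun z => Rm s z) = fun z => (∑ i, ∑ a, q * (W s z * P s z * Ja i a s z)) -
        W s z * (κ / (1 + s) ^ 2 * min (energy N φ z) R * |u s z| ^ q) := by
      ext z
      simp only [hRm, mul_sub, Finset.mul_sum]
      congr 1
      refine Finset.sum_congr rfl fun i _ => Finset.sum_congr rfl fun a _ => ?_
      ring
    have hXneg (i : Fin k) (a : Fin d) : Integrable fun z =>
        -(q * (W s z * (((q - 1) * |u s z| ^ (q - 2) * ua i a s z +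
          P s z * (κ / (1 + s) * truncGrad N φ R i a z)) * (τ * ua i a s z - H i a s z)))) :=
      (((hXt i a).integrable_slice hs).const_mul q).neg
    have h1 : ∫ z, Rm s z = ∫ z, ((∑ i, ∑ a, -(q * (W s z * (((q - 1) * |u s z| ^ (q - 2) *
        ua i a s z + P s z * (κ / (1 + s) * truncGrad N φ R i a z)) *
          (τ * ua i a s z - H i a s z))))) -
        W s z * (κ / (1 + s) ^ 2 * min (energy N φ z) R * |u s z| ^ q)) := by
      rw [hRmeq, integral_sub (integrable_finsetSum _ fun i _ => integrable_finsetSum _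
          fun a _ => ((hYt i a).integrable_slice hs).const_mul q) (hZt.integrable_slice hs),
        integral_sub (integrable_finsetSum _ fun i _ => integrable_finsetSum _
          fun a _ => hXneg i a) (hZt.integrable_slice hs),
        integral_finsetSum _ fun i _ => integrable_finsetSum _
          fun a _ => ((hYt i a).integrable_slice hs).const_mul q,
        integral_finsetSum _ fun i _ => integrable_finsetSum _
          fun a _ => hXneg i a]
      congr 1
      refine Finset.sum_congr rfl fun i _ => ?_
      rw [integral_finsetSum _ fun a _ => ((hYt i a).integrable_slice hs).const_mul q,
        integral_finsetSum _ fun a _ => hXneg i a]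
      refine Finset.sum_congr rfl fun a _ => ?_
      rw [integral_const_mul, integral_neg, integral_const_mul, hparts]
      ring
    rw [h1, ← integral_const_mul]
    refine integral_mono (Integrable.sub (integrable_finsetSum _ fun i _ => integrable_finsetSum _
      fun a _ => hXneg i a) (hZt.integrable_slice hs))
      ((hHt.integrable_slice hs).const_mul C) fun z => ?_
    have hpt := pointwise_dissipation_le (k := k) hd hq hτ (u := u s z) hκ hκ' hs1
      (w := min (energy N φ z) R) (le_min (card_le_energy hφ z) hR)
      (a := fun i a => ua i a s z) (h := fun i a => H i a s z)
      (sum_truncGrad_sq_le hφ hR0 z)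
    have hW0 : 0 ≤ W s z := (Real.exp_pos _).le
    have hpt' := mul_le_mul_of_nonneg_left hpt hW0
    calc _ = W s z * (-(∑ i, ∑ c, q * (((q - 1) * |u s z| ^ (q - 2) * ua i c s z +
          |u s z| ^ (q - 2) * u s z * (κ / (1 + s) * truncGrad N φ R i c z)) *
            (τ * ua i c s z - H i c s z))) -
          κ / (1 + s) ^ 2 * min (energy N φ z) R * |u s z| ^ q) := by
          simp only [mul_sub (W s z), mul_neg, Finset.mul_sum, Finset.sum_neg_distrib, hP]
          congr 2
          refine Finset.sum_congr rfl fun i _ => Finset.sum_congr rfl fun a _ => ?_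
          ring
      _ ≤ _ := hpt'
      _ = _ := by ring
  have hfinal : ∫ s in Icc 0 T, ∫ z, Rm s z ≤
      C * ∫ s in Icc 0 T, ∫ z, W s z * ∑ i, ∑ a, |H i a s z| ^ q := by
    rw [← integral_const_mul]
    refine setIntegral_mono_on (Integrable.integral_prod_left hRmi)
      ((Integrable.integral_prod_left hHt.integrable_prod).const_mul C) measurableSet_Icc
      fun s hs => hineq s hs
  have hW0 : ∀ z, W 0 z = Real.exp (κ * min (energy N φ z) R) := fun z => by simp [hW]
  simp_rw [← hW0]
  linarith

end EnergyInequality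

/-! ### The energy inequality for mollified marginals -/

section MollifiedMarginal

variable {d k N : ℕ} {φ : Torus d → ℝ} {K : Torus d → Vel d} {T M : ℝ}

lemma isTame_conv {η : Config d k → ℝ} (hη : IsSmooth η) (hc : HasCompactSupport η)
    {h : ℝ → Config d k → ℝ} (hm : Measurable (Function.uncurry h))
    (hM : ∀ s ∈ Icc 0 T, Integrable (h s) ∧ ∫ z, |h s z| ≤ M) :
    IsTame volume T fun s => conv η (h s) := by
  obtain ⟨B, hB0, hB⟩ := exists_bound_of_compactSupport hη hc
  have hηi := hη.continuous.integrable_of_hasCompactSupport hc (μ := volume)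
  refine ⟨⟨measurable_conv hη.measurable hm, B * max M 0, by positivity, fun s hs z => ?_⟩,
    (∫ z, |η z|) * M, fun s hs => ?_⟩
  · refine (abs_conv_le hB (hM s hs).1 z).trans (mul_le_mul_of_nonneg_left ?_ hB0)
    exact (hM s hs).2.trans (le_max_left _ _)
  · have hsm : Measurable (h s) := hm.comp measurable_prodMk_left
    have hi := integrable_conv hη hc hsm (hM s hs).1
    refine ⟨hi, ?_⟩
    have h0 := lintegral_enorm_conv_le hη.measurable hsm
    have e (g : Config d k → ℝ) (hg : Integrable g) : ∫⁻ z, ‖g z‖ₑ = ENNReal.ofReal (∫ z, |g z|) :=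
      (ofReal_integral_norm_eq_lintegral_enorm hg).symm
    rw [e _ hi, e _ hηi, e _ (hM s hs).1, ← ENNReal.ofReal_mul
      (integral_nonneg fun z => abs_nonneg _), ENNReal.ofReal_le_ofReal_iff
      (mul_nonneg (integral_nonneg fun z => abs_nonneg _)
        (integral_nonneg fun z => abs_nonneg _))] at h0
    exact h0.trans (mul_le_mul_of_nonneg_left (hM s hs).2 (integral_nonneg fun z => abs_nonneg _))

/-- The energy inequality for the mollified marginal on `k` particles, with the weight
`e^{κ min(e_k, R) / (1 + t)}`. -/
lemma mollified_marginal_inequality (hd : 0 < d) {q σ : ℝ} (hq : 2 ≤ q) (hσ : 0 < σ)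
    (hφm : Measurable φ) (hφ : ∀ x, 0 ≤ φ x) (hK : Measurable K) {f : ℝ → Config d N → ℝ}
    (hf : IsWeakSolution σ K f) (hfm : Measurable (Function.uncurry f))
    (hM : ∀ t ∈ Icc (0 : ℝ) 1, IsControlled K M (f t))
    (hsymm : ∀ t ∈ Icc (0 : ℝ) 1, ∀ π : Equiv.Perm (Fin N), ∀ᵐ z, f t (z ∘ π) = f t z)
    (hk : k + 1 ≤ N) {κ R : ℝ} (hκ : 1 / (2 * lamConst q (σ ^ 2 / 2)) ≤ κ)
    (hκ' : κ ≤ 1 / lamConst q (σ ^ 2 / 2)) (hR : (k : ℝ) ≤ R) (hT : T ∈ Icc (0 : ℝ) 1)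
    {ρ : ℝ → Particle d → ℝ} (hρ : IsMollifier ρ) {ε : ℝ} (hε : 0 < ε)
    (hA : Integrable (fun y : ℝ × Config d k => entropyDensity N φ K q (κ / (1 + y.1)) R (ρ ε)
      (marginal (Nat.le_of_succ_le hk) (f y.1)) y.2) ((volume.restrict (Icc 0 T)).prod volume)) :
    (∫ z, Real.exp (κ / (1 + T) * min (energy N φ z) R) *
        |conv (tensor (ρ ε)) (marginal (Nat.le_of_succ_le hk) (f T)) z| ^ q) +
      q * (∫ s in Icc 0 T, ∫ z, entropyDensity N φ K q (κ / (1 + s)) R (ρ ε)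
        (marginal (Nat.le_of_succ_le hk) (f s)) z) ≤
      (∫ z, Real.exp (κ * min (energy N φ z) R) *
        |conv (tensor (ρ ε)) (marginal (Nat.le_of_succ_le hk) (f 0)) z| ^ q) +
        forceConst q (σ ^ 2 / 2) * (1 / youngConst d q (σ ^ 2 / 2)) ^ ((q - 2) / 2) *
          ∫ s in Icc 0 T, ∫ z, Real.exp (κ / (1 + s) * min (energy N φ z) R) *
            ∑ i, ∑ a, |conv (tensor (ρ ε)) (force N K i a (marginal hk (f s))) z| ^ q := by
  have hk' := Nat.le_of_succ_le hk
  have hη : IsBump ε (tensor (ρ ε) : Config d k → ℝ) := hρ.isBump_tensor hε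
  have hs1 {s : ℝ} (hs : s ∈ Icc 0 T) : s ∈ Icc (0 : ℝ) 1 := ⟨hs.1, hs.2.trans hT.2⟩
  have hgm : Measurable (Function.uncurry fun s => marginal hk' (f s)) := measurable_marginal hk' hfm
  have hgi : ∀ s ∈ Icc 0 T, Integrable (marginal hk' (f s)) ∧
      ∫ z, |marginal hk' (f s) z| ≤ M := fun s hs =>
    ⟨integrable_marginal hk' (hM s (hs1 hs)).integrable,
      (integral_abs_marginal_le hk' (hM s (hs1 hs)).integrable).trans (hM s (hs1 hs)).integral_le⟩
  have hhm (i : Fin k) (a : Fin d) :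
      Measurable (Function.uncurry fun s => force N K i a (marginal hk (f s))) :=
    measurable_force hK (measurable_marginal hk hfm) i a
  have hhi (i : Fin k) (a : Fin d) : ∀ s ∈ Icc 0 T, Integrable (force N K i a (marginal hk (f s))) ∧
      ∫ z, |force N K i a (marginal hk (f s)) z| ≤ M := fun s hs =>
    (hM s (hs1 hs)).integrable_force hK hk i a
  have hsm (e : Fin k → Vel d × Vel d) := hη.smooth.dirDeriv e
  have hcm (e : Fin k → Vel d × Vel d) := hasCompactSupport_dirDeriv hη.compact e
  have hD := conv_marginal_sub_eq_integral hK hf hfm hM hsymm hk hη.smooth hη.compact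
  refine mollified_energy_inequality (A := fun s => mollifyAdvection N K (ρ ε)
    (marginal hk' (f s))) (ua := fun i a s => conv (dirDeriv (dirV i a) (tensor (ρ ε)))
      (marginal hk' (f s)))
    (uaa := fun i a s => conv (dirDeriv (dirV i a) (dirDeriv (dirV i a) (tensor (ρ ε))))
      (marginal hk' (f s)))
    (H := fun i a s => conv (tensor (ρ ε)) (force N K i a (marginal hk (f s))))
    (Ha := fun i a s => conv (dirDeriv (dirV i a) (tensor (ρ ε)))
      (force N K i a (marginal hk (f s))))
    (u := fun s => conv (tensor (ρ ε)) (marginal hk' (f s)))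
    hd hq (by positivity) hφm hφ hκ hκ' hR hT
    (isTame_conv hη.smooth hη.compact hgm hgi)
    (fun i a => isTame_conv (hsm _) (hcm _) hgm hgi)
    (fun i a => isTame_conv ((hsm _).dirDeriv _) (hasCompactSupport_dirDeriv (hcm _) _) hgm hgi)
    (fun i a => isTame_conv hη.smooth hη.compact (hhm i a) (hhi i a))
    (fun i a => isTame_conv (hsm _) (hcm _) (hhm i a) (hhi i a))
    (fun i a s hs z r => hasDerivAt_conv hη.smooth hη.compact (hgi s hs).1 _ z r)
    (fun i a s hs z r => hasDerivAt_conv (hsm _) (hcm _) (hgi s hs).1 _ z r)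
    (fun i a s hs z r => hasDerivAt_conv hη.smooth hη.compact (hhi i a s hs).1 _ z r) hA
    (fun z => ?_) (fun z t ht => ?_)
  · refine ((hD z).1.mono_set ?_).congr fun s hs => ?_
    · rw [uIcc_of_le hT.1, uIcc_of_le zero_le_one]
      exact Icc_subset_Icc_right hT.2
    · simp [mollifyAdvection]
  · have h := (hD z).2 t (hs1 ht)
    rw [sub_eq_iff_eq_add'] at h
    refine h.trans ?_
    simp [mollifyAdvection]

end MollifiedMarginal

/-! ### Hölder's inequality for the mean force -/

section Holder

variable {d k N : ℕ} {φ : Torus d → ℝ} {K : Torus d → Vel d}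

instance : (volume : Measure (Torus d)).IsNegInvariant :=
  Measure.IsAddHaarMeasure.isNegInvariant_of_regular _

lemma integral_gaussian_pos {b : ℝ} (hb : 0 < b) :
    0 < ∫ v : Vel d, Real.exp (-b * ‖v‖ ^ 2) := by
  rw [GaussianFourier.integral_rexp_neg_mul_sq_norm hb]
  have := Real.pi_pos
  positivity

lemma integrable_gaussian {b : ℝ} (hb : 0 < b) :
    Integrable fun v : Vel d => Real.exp (-b * ‖v‖ ^ 2) := by
  by_contra h
  exact (integral_gaussian_pos (d := d) hb).ne' (integral_undef h)

/-- The Gaussian factor in Hölder's inequality for the mean force. -/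
def gaussConst (d : ℕ) (q c : ℝ) : ℝ := (∫ v : Vel d, Real.exp (-(c / (q - 1)) * ‖v‖ ^ 2)) ^ (q - 1)

lemma gaussConst_pos {q c : ℝ} (hq : 2 ≤ q) (hc : 0 < c) : 0 < gaussConst d q c :=
  Real.rpow_pos_of_pos (integral_gaussian_pos (div_pos hc (by linarith))) _

lemma enorm_force_rpow_le (hK : Measurable K) {h : Config d (k + 1) → ℝ} (hh : Measurable h)
    {q c : ℝ} (hq : 2 ≤ q) (hc : 0 < c) (hk : k ≤ N) (i : Fin k) (a : Fin d) (z : Config d k) :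
    ‖force N K i a h z‖ₑ ^ q ≤ ENNReal.ofReal (gaussConst d q c) *
      eLpNorm K (ENNReal.ofReal (q / (q - 1))) volume ^ q *
        ∫⁻ p, ENNReal.ofReal (Real.exp (c * ‖p.2‖ ^ 2)) * ‖h (snocConfig z p)‖ₑ ^ q := by
  have hq0 : 0 < q := by linarith
  have hq1 : 0 < q - 1 := by linarith
  set q' := q / (q - 1) with hq'
  have hq'0 : 0 < q' := by positivity
  have hconj : q'.HolderConjugate q := by
    refine Real.holderConjugate_iff.2 ⟨?_, ?_⟩
    · rw [hq', one_lt_div hq1]; linarith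
    · rw [hq']; field_simp; ring
  set A : Particle d → ℝ≥0∞ := fun p =>
    ‖K ((z i).1 - p.1)‖ₑ * ENNReal.ofReal (Real.exp (-(c / q) * ‖p.2‖ ^ 2)) with hA
  set B : Particle d → ℝ≥0∞ := fun p =>
    ENNReal.ofReal (Real.exp (c / q * ‖p.2‖ ^ 2)) * ‖h (snocConfig z p)‖ₑ with hB
  have hsub : Measurable fun x : Torus d => (z i).1 - x := measurable_const.sub measurable_id
  have hKx : Measurable fun x : Torus d => ‖K ((z i).1 - x)‖ₑ := (hK.comp hsub).enorm
  have hexp (b : ℝ) : Measurable fun v : Vel d => ENNReal.ofReal (Real.exp (b * ‖v‖ ^ 2)) :=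
    (Real.measurable_exp.comp (measurable_const.mul (measurable_norm.pow_const 2))).ennreal_ofReal
  have hAm : Measurable A := (hKx.comp measurable_fst).mul ((hexp _).comp measurable_snd)
  have hsn : Measurable fun p : Particle d => snocConfig z p :=
    measurable_snocConfig.comp measurable_prodMk_left
  have hBm : Measurable B := ((hexp _).comp measurable_snd).mul (hh.comp hsn).enorm
  have h1 : ‖force N K i a h z‖ₑ ≤ ∫⁻ p, (A * B) p := by
    have h2 : ‖((N : ℝ) - k) / N‖ₑ ≤ 1 := by
      rw [← ofReal_norm, ← ENNReal.ofReal_one]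
      refine ENNReal.ofReal_le_ofReal ?_
      have : (k : ℝ) ≤ N := by exact_mod_cast hk
      rw [Real.norm_of_nonneg (div_nonneg (by linarith) (by positivity))]
      exact div_le_one_of_le₀ (by linarith [(Nat.cast_nonneg k : (0 : ℝ) ≤ k)]) (by positivity)
    rw [force, enorm_mul]
    refine (mul_le_of_le_one_left zero_le h2).trans
      ((enorm_integral_le_lintegral_enorm _).trans (lintegral_mono fun p => ?_))
    have h3 : ENNReal.ofReal (Real.exp (-(c / q) * ‖p.2‖ ^ 2)) *
        ENNReal.ofReal (Real.exp (c / q * ‖p.2‖ ^ 2)) = 1 := by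
      rw [← ENNReal.ofReal_mul (Real.exp_pos _).le, ← Real.exp_add]
      simp
    calc ‖K ((z i).1 - p.1) a * h (snocConfig z p)‖ₑ
        ≤ ‖K ((z i).1 - p.1)‖ₑ * ‖h (snocConfig z p)‖ₑ := by
          rw [enorm_mul]
          gcongr
          exact enorm_le_iff_norm_le.2 (PiLp.norm_apply_le _ _)
      _ = ‖K ((z i).1 - p.1)‖ₑ * (ENNReal.ofReal (Real.exp (-(c / q) * ‖p.2‖ ^ 2)) *
          ENNReal.ofReal (Real.exp (c / q * ‖p.2‖ ^ 2))) * ‖h (snocConfig z p)‖ₑ := by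
          rw [h3, mul_one]
      _ = (A * B) p := by simp only [hA, hB, Pi.mul_apply]; ring
  have hAq : ∫⁻ p, A p ^ q' = (∫⁻ x, ‖K x‖ₑ ^ q') *
      ENNReal.ofReal (∫ v : Vel d, Real.exp (-(c / (q - 1)) * ‖v‖ ^ 2)) := by
    have h2 (p : Particle d) : A p ^ q' = ‖K ((z i).1 - p.1)‖ₑ ^ q' *
        ENNReal.ofReal (Real.exp (-(c / (q - 1)) * ‖p.2‖ ^ 2)) := by
      rw [hA, ENNReal.mul_rpow_of_nonneg _ _ hq'0.le, ENNReal.ofReal_rpow_of_pos (Real.exp_pos _),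
        ← Real.exp_mul]
      congr 3
      rw [hq']; field_simp
    simp_rw [h2]
    rw [Measure.volume_eq_prod, lintegral_prod_mul (hKx.pow_const _).aemeasurable
      (hexp _).aemeasurable, lintegral_sub_left_eq_self (fun x => ‖K x‖ₑ ^ q'),
      ofReal_integral_eq_lintegral_ofReal (integrable_gaussian (div_pos hc hq1))
        (ae_of_all _ fun v => (Real.exp_pos _).le)]
  have hBq : ∫⁻ p, B p ^ q =
      ∫⁻ p, ENNReal.ofReal (Real.exp (c * ‖p.2‖ ^ 2)) * ‖h (snocConfig z p)‖ₑ ^ q := by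
    refine lintegral_congr fun p => ?_
    rw [hB, ENNReal.mul_rpow_of_nonneg _ _ hq0.le, ENNReal.ofReal_rpow_of_pos (Real.exp_pos _),
      ← Real.exp_mul]
    congr 3
    field_simp
  have h4 := h1.trans (ENNReal.lintegral_mul_le_Lp_mul_Lq volume hconj hAm.aemeasurable
    hBm.aemeasurable)
  have h5 := ENNReal.rpow_le_rpow h4 hq0.le
  rw [ENNReal.mul_rpow_of_nonneg _ _ hq0.le, ← ENNReal.rpow_mul, ← ENNReal.rpow_mul,
    one_div_mul_cancel hq0.ne', ENNReal.rpow_one, hAq, hBq,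
    ENNReal.mul_rpow_of_nonneg _ _ (by positivity)] at h5
  refine h5.trans (le_of_eq ?_)
  have h6 : 1 / q' * q = q - 1 := by rw [hq']; field_simp
  have h7 : eLpNorm K (ENNReal.ofReal q') volume ^ q = (∫⁻ x, ‖K x‖ₑ ^ q') ^ (1 / q' * q) := by
    rw [eLpNorm_eq_lintegral_rpow_enorm_toReal (by simpa using hq'0) ENNReal.ofReal_ne_top,
      ENNReal.toReal_ofReal hq'0.le, ← ENNReal.rpow_mul]
  rw [h7, h6, gaussConst, ENNReal.ofReal_rpow_of_nonneg
    (integral_gaussian_pos (div_pos hc hq1)).le hq1.le]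
  ring

lemma weightedInt_eq (q l : ℝ) (hq : 0 ≤ q) (g : Config d k → ℝ) : weightedInt N φ q l g =
    ∫⁻ z, ENNReal.ofReal (Real.exp (l * energy N φ z)) * ‖g z‖ₑ ^ q := by
  refine lintegral_congr fun z => ?_
  rw [mul_comm, ENNReal.ofReal_mul (Real.exp_pos _).le, ← Real.enorm_abs,
    ← ENNReal.ofReal_rpow_of_nonneg (abs_nonneg _) hq, Real.enorm_of_nonneg (abs_nonneg _)]

lemma energy_add_le_energy_snocConfig (hφ : ∀ x, 0 ≤ φ x) (z : Config d k) (p : Particle d) :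
    energy N φ z + ‖p.2‖ ^ 2 ≤ energy N φ (snocConfig z p) := by
  have h1 : ∑ i, ∑ j, φ ((z i).1 - (z j).1) ≤
      ∑ i, ∑ j, φ ((snocConfig z p i).1 - (snocConfig z p j).1) := by
    rw [Fin.sum_univ_castSucc]
    refine le_add_of_le_of_nonneg (Finset.sum_le_sum fun i _ => ?_)
      (Finset.sum_nonneg fun j _ => hφ _)
    rw [Fin.sum_univ_castSucc]
    simpa using hφ _
  have h2 := mul_le_mul_of_nonneg_left h1 (by positivity : 0 ≤ 1 / (N : ℝ))
  rw [energy, energy, Fin.sum_univ_castSucc (f := fun i => 1 + ‖(snocConfig z p i).2‖ ^ 2)]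
  simp only [snocConfig_castSucc, snocConfig_last]
  linarith

lemma lintegral_force_rpow_le (hφm : Measurable φ) (hφ : ∀ x, 0 ≤ φ x) (hK : Measurable K)
    {h : Config d (k + 1) → ℝ} (hh : Measurable h) {q c l : ℝ} (hq : 2 ≤ q) (hc : 0 < c)
    (hl : c ≤ l) (hk : k ≤ N) (i : Fin k) (a : Fin d) :
    ∫⁻ z, ENNReal.ofReal (Real.exp (l * energy N φ z)) * ‖force N K i a h z‖ₑ ^ q ≤
      ENNReal.ofReal (gaussConst d q c) *
        eLpNorm K (ENNReal.ofReal (q / (q - 1))) volume ^ q * weightedInt N φ q l h := by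
  set D := ENNReal.ofReal (gaussConst d q c) *
    eLpNorm K (ENNReal.ofReal (q / (q - 1))) volume ^ q with hD
  set G : Config d (k + 1) → ℝ≥0∞ := fun y =>
    ENNReal.ofReal (Real.exp (l * energy N φ y)) * ‖h y‖ₑ ^ q with hG
  have hGm : Measurable G := (Real.measurable_exp.comp
    (measurable_const.mul (measurable_energy hφm))).ennreal_ofReal.mul (hh.enorm.pow_const q)
  have hGs : Measurable fun p : Config d k × Particle d => G (snocConfig p.1 p.2) :=
    hGm.comp measurable_snocConfig
  calc ∫⁻ z, ENNReal.ofReal (Real.exp (l * energy N φ z)) * ‖force N K i a h z‖ₑ ^ q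
      ≤ ∫⁻ z, D * ∫⁻ p, G (snocConfig z p) := by
        refine lintegral_mono fun z => ?_
        refine (mul_le_mul_right (enorm_force_rpow_le hK hh hq hc hk i a z) _).trans ?_
        rw [mul_left_comm]
        refine mul_le_mul_right ?_ D
        rw [← lintegral_const_mul' _ _ ENNReal.ofReal_ne_top]
        refine lintegral_mono fun p => ?_
        rw [← mul_assoc, ← ENNReal.ofReal_mul (Real.exp_pos _).le, ← Real.exp_add]
        refine mul_le_mul_left (ENNReal.ofReal_le_ofReal (Real.exp_le_exp.2 ?_)) _
        have h1 := mul_le_mul_of_nonneg_left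
          (energy_add_le_energy_snocConfig (N := N) hφ z p) (hc.le.trans hl)
        nlinarith [mul_le_mul_of_nonneg_right hl (sq_nonneg ‖p.2‖)]
    _ = D * ∫⁻ y, G y := by
        rw [lintegral_const_mul _ hGs.lintegral_prod_right',
          ← measurePreserving_snocConfig.lintegral_comp hGm,
          lintegral_prod _ (by exact hGs.aemeasurable)]
    _ = _ := by rw [weightedInt_eq q l (by linarith)]

end Holder

/-! ### The energy inequality for marginals -/

section Limit

variable {d k N : ℕ} {φ : Torus d → ℝ} {K : Torus d → Vel d} {T M : ℝ}

lemma IsBump.lintegral_conv_rpow_le {ε : ℝ} {η : Config d k → ℝ} (hη : IsBump ε η)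
    {g : Config d k → ℝ} (hgm : Measurable g) {q : ℝ} (hq : 1 ≤ q) :
    ∫⁻ z, ‖conv η g z‖ₑ ^ q ≤ ∫⁻ z, ‖g z‖ₑ ^ q := by
  calc ∫⁻ z, ‖conv η g z‖ₑ ^ q ≤ ∫⁻ z, ∫⁻ y, ‖η y‖ₑ * ‖g (z - y)‖ₑ ^ q :=
        lintegral_mono fun z => hη.enorm_conv_rpow_le hgm hq z
    _ = ∫⁻ y, ∫⁻ z, ‖η y‖ₑ * ‖g (z - y)‖ₑ ^ q := by
        refine lintegral_lintegral_swap (Measurable.aemeasurable ?_)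
        exact (hη.smooth.measurable.comp measurable_snd).enorm.mul
          ((hgm.comp (measurable_fst.sub measurable_snd)).enorm.pow_const q)
    _ = ∫⁻ y, ‖η y‖ₑ * ∫⁻ z, ‖g z‖ₑ ^ q := by
        refine lintegral_congr fun y => ?_
        rw [lintegral_const_mul _ (by exact
          ((hgm.comp (measurable_id.sub_const y)).enorm.pow_const q)),
          lintegral_sub_right_eq_self (fun z => ‖g z‖ₑ ^ q)]
    _ ≤ _ := hη.lintegral_le fun y _ => le_rfl

/-- Along a sequence of scales the mollifications of an integrable function converge almost
everywhere. -/
lemma IsMollifier.exists_seq_tendsto_ae {ρ : ℝ → Particle d → ℝ} (hρ : IsMollifier ρ)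
    {g : Config d k → ℝ} (hgm : Measurable g) (hg : Integrable g) :
    ∃ ε : ℕ → ℝ, (∀ n, 0 < ε n) ∧ Tendsto ε atTop (𝓝 0) ∧
      ∀ᵐ z, Tendsto (fun n => conv (tensor (ρ (ε n))) g z) atTop (𝓝 (g z)) := by
  have hpos (n : ℕ) : (0 : ℝ) < 1 / ((n : ℝ) + 1) := by positivity
  have h1 : Tendsto (fun n : ℕ => eLpNorm
      (conv (tensor (ρ (1 / ((n : ℝ) + 1)))) g - g) 1 volume) atTop (𝓝 0) := by
    refine ENNReal.tendsto_nhds_zero.2 fun δ hδ => ?_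
    obtain ⟨r, hr, h⟩ := exists_lintegral_conv_sub_le hgm hg hδ
    filter_upwards [(tendsto_one_div_add_atTop_nhds_zero_nat (𝕜 := ℝ)).eventually_le_const hr]
      with n hn
    rw [eLpNorm_one_eq_lintegral_enorm]
    exact h _ _ (hρ.isBump_tensor (hpos n)) hn
  have h2 : TendstoInMeasure volume (fun (n : ℕ) => conv (tensor (ρ (1 / ((n : ℝ) + 1)))) g)
      atTop g := tendstoInMeasure_of_tendsto_eLpNorm one_ne_zero
    (fun n => (measurable_conv_right (hρ.isBump_tensor (hpos n)).smooth.measurable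
      hgm).aestronglyMeasurable) hgm.aestronglyMeasurable h1
  obtain ⟨ns, hns, h3⟩ := h2.exists_seq_tendsto_ae
  exact ⟨fun n => 1 / ((ns n : ℝ) + 1), fun n => hpos _,
    (tendsto_one_div_add_atTop_nhds_zero_nat (𝕜 := ℝ)).comp hns.tendsto_atTop, h3⟩

lemma IsTame.ofReal_integral {X : Type*} [MeasurableSpace X] {μ : Measure X}
    {F : ℝ → X → ℝ} (hF : IsTame μ T F) (h0 : ∀ s x, 0 ≤ F s x) {s : ℝ} (hs : s ∈ Icc 0 T) :
    ENNReal.ofReal (∫ x, F s x ∂μ) = ∫⁻ x, ENNReal.ofReal (F s x) ∂μ :=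
  ofReal_integral_eq_lintegral_ofReal (hF.integrable_slice hs) (ae_of_all _ (h0 s))

lemma IsTame.ofReal_integral_integral {X : Type*} [MeasurableSpace X] {μ : Measure X} [SFinite μ]
    {F : ℝ → X → ℝ} (hF : IsTame μ T F) (h0 : ∀ s x, 0 ≤ F s x) :
    ENNReal.ofReal (∫ s in Icc 0 T, ∫ x, F s x ∂μ) =
      ∫⁻ s in Icc 0 T, ∫⁻ x, ENNReal.ofReal (F s x) ∂μ := by
  have h1 : Integrable (fun s => ∫ x, F s x ∂μ) (volume.restrict (Icc 0 T)) :=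
    hF.integrable_prod.integral_prod_left
  rw [ofReal_integral_eq_lintegral_ofReal h1 (ae_of_all _ fun s => integral_nonneg (h0 s))]
  exact setLIntegral_congr_fun measurableSet_Icc fun s hs => hF.ofReal_integral h0 hs

lemma ofReal_mul_abs_rpow {w u q : ℝ} (hw : 0 ≤ w) (hq : 0 ≤ q) :
    ENNReal.ofReal (w * |u| ^ q) = ENNReal.ofReal w * ‖u‖ₑ ^ q := by
  rw [ENNReal.ofReal_mul hw, ← Real.enorm_abs, ← ENNReal.ofReal_rpow_of_nonneg (abs_nonneg _) hq,
    Real.enorm_of_nonneg (abs_nonneg _)]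

/-- The truncated weight `e^{l min(e_k, R)}`. -/
def truncWeight (N : ℕ) (φ : Torus d → ℝ) (l R : ℝ) (z : Config d k) : ℝ≥0∞ :=
  ENNReal.ofReal (Real.exp (l * min (energy N φ z) R))

lemma measurable_truncWeight (hφm : Measurable φ) (l R : ℝ) :
    Measurable (truncWeight N φ l R : Config d k → ℝ≥0∞) :=
  (Real.measurable_exp.comp (measurable_const.mul
    ((measurable_energy hφm).min measurable_const))).ennreal_ofReal

lemma truncWeight_le {l : ℝ} (hl : 0 ≤ l) (R : ℝ) (z : Config d k) :
    truncWeight N φ l R z ≤ ENNReal.ofReal (Real.exp (l * R)) :=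
  ENNReal.ofReal_le_ofReal (Real.exp_le_exp.2 (mul_le_mul_of_nonneg_left (min_le_right _ _) hl))

lemma truncWeight_le_weight {l : ℝ} (hl : 0 ≤ l) (R : ℝ) (z : Config d k) :
    truncWeight N φ l R z ≤ ENNReal.ofReal (Real.exp (l * energy N φ z)) :=
  ENNReal.ofReal_le_ofReal (Real.exp_le_exp.2 (mul_le_mul_of_nonneg_left (min_le_left _ _) hl))

lemma truncWeight_mono {l : ℝ} (hl : 0 ≤ l) {R R' : ℝ} (h : R ≤ R') (z : Config d k) :
    truncWeight N φ l R z ≤ truncWeight N φ l R' z :=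
  ENNReal.ofReal_le_ofReal (Real.exp_le_exp.2 (mul_le_mul_of_nonneg_left
    (min_le_min_left _ h) hl))

/-- A bounded jointly measurable mollified family satisfies the energy inequality in
`[0, ∞]`. -/
lemma lintegral_mollified_marginal_le (hd : 0 < d) {q σ : ℝ} (hq : 2 ≤ q) (hσ : 0 < σ)
    (hφm : Measurable φ) (hφ : ∀ x, 0 ≤ φ x) (hK : Measurable K) {f : ℝ → Config d N → ℝ}
    (hf : IsWeakSolution σ K f) (hfm : Measurable (Function.uncurry f))
    (hM : ∀ t ∈ Icc (0 : ℝ) 1, IsControlled K M (f t))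
    (hsymm : ∀ t ∈ Icc (0 : ℝ) 1, ∀ π : Equiv.Perm (Fin N), ∀ᵐ z, f t (z ∘ π) = f t z)
    (hk : k + 1 ≤ N) {κ R : ℝ} (hκ : 1 / (2 * lamConst q (σ ^ 2 / 2)) ≤ κ)
    (hκ' : κ ≤ 1 / lamConst q (σ ^ 2 / 2)) (hR : (k : ℝ) ≤ R) (hT : T ∈ Icc (0 : ℝ) 1)
    {ρ : ℝ → Particle d → ℝ} (hρ : IsMollifier ρ) {ε : ℝ} (hε : 0 < ε)
    (hA : Integrable (fun y : ℝ × Config d k => entropyDensity N φ K q (κ / (1 + y.1)) R (ρ ε)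
      (marginal (Nat.le_of_succ_le hk) (f y.1)) y.2) ((volume.restrict (Icc 0 T)).prod volume))
    {δ : ℝ} (hδ : 0 ≤ δ) (hA' : -δ ≤ ∫ s in Icc 0 T, ∫ z, entropyDensity N φ K q (κ / (1 + s)) R
      (ρ ε) (marginal (Nat.le_of_succ_le hk) (f s)) z) :
    ∫⁻ z, truncWeight N φ (κ / (1 + T)) R z *
        ‖conv (tensor (ρ ε)) (marginal (Nat.le_of_succ_le hk) (f T)) z‖ₑ ^ q ≤
      (∫⁻ z, truncWeight N φ κ R z *
        ‖conv (tensor (ρ ε)) (marginal (Nat.le_of_succ_le hk) (f 0)) z‖ₑ ^ q) +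
      ENNReal.ofReal (forceConst q (σ ^ 2 / 2) *
        (1 / youngConst d q (σ ^ 2 / 2)) ^ ((q - 2) / 2)) *
        (∑ i, ∑ a, ∫⁻ s in Icc 0 T, ∫⁻ z, truncWeight N φ (κ / (1 + s)) R z *
          ‖conv (tensor (ρ ε)) (force N K i a (marginal hk (f s))) z‖ₑ ^ q) +
      ENNReal.ofReal (q * δ) := by
  have hk' := Nat.le_of_succ_le hk
  have hη : IsBump ε (tensor (ρ ε) : Config d k → ℝ) := hρ.isBump_tensor hε
  have hτ : 0 < σ ^ 2 / 2 := by positivity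
  have hκp : 0 < κ := lt_of_lt_of_le (by have := lamConst_pos hq hτ; positivity) hκ
  have hq0 : 0 ≤ q := by linarith
  have hR0 : 0 ≤ R := (Nat.cast_nonneg k).trans hR
  have h0T : (0 : ℝ) ∈ Icc 0 T := ⟨le_rfl, hT.1⟩
  have hTT : T ∈ Icc 0 T := ⟨hT.1, le_rfl⟩
  have hs1 {s : ℝ} (hs : s ∈ Icc 0 T) : s ∈ Icc (0 : ℝ) 1 := ⟨hs.1, hs.2.trans hT.2⟩
  set C := forceConst q (σ ^ 2 / 2) * (1 / youngConst d q (σ ^ 2 / 2)) ^ ((q - 2) / 2) with hC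
  have hC0 : 0 ≤ C := by
    have := forceConst_pos hq hτ
    have := youngConst_pos hd hq hτ
    positivity
  have hW : IsBddFamily T fun (s : ℝ) (z : Config d k) =>
      Real.exp (κ / (1 + s) * min (energy N φ z) R) := isBddFamily_weight hφm hφ hκp.le hR0
  have htu : IsTame volume T fun s => conv (tensor (ρ ε)) (marginal hk' (f s)) :=
    isTame_conv hη.smooth hη.compact (measurable_marginal hk' hfm) fun s hs =>
      ⟨integrable_marginal hk' (hM s (hs1 hs)).integrable,
        (integral_abs_marginal_le hk' (hM s (hs1 hs)).integrable).trans
          (hM s (hs1 hs)).integral_le⟩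
  have hth (i : Fin k) (a : Fin d) : IsTame volume T fun s =>
      conv (tensor (ρ ε)) (force N K i a (marginal hk (f s))) :=
    isTame_conv hη.smooth hη.compact (measurable_force hK (measurable_marginal hk hfm) i a)
      fun s hs => (hM s (hs1 hs)).integrable_force hK hk i a
  have hU := hW.mul_tame (htu.abs_rpow hq)
  have hF (i : Fin k) (a : Fin d) := hW.mul_tame ((hth i a).abs_rpow hq)
  have hFF := IsTame.sum Finset.univ fun i => IsTame.sum Finset.univ fun a => hF i a
  have hmain := mollified_marginal_inequality hd hq hσ hφm hφ hK hf hfm hM hsymm hk hκ hκ' hR hT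
    hρ hε hA
  rw [← hC] at hmain
  have e0 : ENNReal.ofReal (∫ z, Real.exp (κ / (1 + T) * min (energy N φ z) R) *
      |conv (tensor (ρ ε)) (marginal hk' (f T)) z| ^ q) =
      ∫⁻ z, truncWeight N φ (κ / (1 + T)) R z *
        ‖conv (tensor (ρ ε)) (marginal hk' (f T)) z‖ₑ ^ q := by
    rw [hU.ofReal_integral (fun s z => by positivity) hTT]
    exact lintegral_congr fun z => ofReal_mul_abs_rpow (Real.exp_pos _).le hq0
  have e1 : ENNReal.ofReal (∫ z, Real.exp (κ * min (energy N φ z) R) *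
      |conv (tensor (ρ ε)) (marginal hk' (f 0)) z| ^ q) =
      ∫⁻ z, truncWeight N φ κ R z * ‖conv (tensor (ρ ε)) (marginal hk' (f 0)) z‖ₑ ^ q := by
    have h := hU.ofReal_integral (fun s z => by positivity) h0T
    simp only [add_zero, div_one] at h
    rw [h]
    exact lintegral_congr fun z => ofReal_mul_abs_rpow (Real.exp_pos _).le hq0
  have e2 : ENNReal.ofReal (∫ s in Icc 0 T, ∫ z, Real.exp (κ / (1 + s) * min (energy N φ z) R) *
      ∑ i, ∑ a, |conv (tensor (ρ ε)) (force N K i a (marginal hk (f s))) z| ^ q) =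
      ∑ i, ∑ a, ∫⁻ s in Icc 0 T, ∫⁻ z, truncWeight N φ (κ / (1 + s)) R z *
          ‖conv (tensor (ρ ε)) (force N K i a (marginal hk (f s))) z‖ₑ ^ q := by
    simp_rw [Finset.mul_sum]
    have hFi (i : Fin k) (a : Fin d) : Integrable (fun s => ∫ z,
        Real.exp (κ / (1 + s) * min (energy N φ z) R) *
          |conv (tensor (ρ ε)) (force N K i a (marginal hk (f s))) z| ^ q)
        (volume.restrict (Icc 0 T)) := (hF i a).integrable_prod.integral_prod_left
    have h1 : ∫ s in Icc 0 T, ∫ z, ∑ i, ∑ a, Real.exp (κ / (1 + s) * min (energy N φ z) R) *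
        |conv (tensor (ρ ε)) (force N K i a (marginal hk (f s))) z| ^ q =
        ∑ i, ∑ a, ∫ s in Icc 0 T, ∫ z, Real.exp (κ / (1 + s) * min (energy N φ z) R) *
          |conv (tensor (ρ ε)) (force N K i a (marginal hk (f s))) z| ^ q := by
      rw [setIntegral_congr_fun measurableSet_Icc (g := fun s => ∑ i, ∑ a, ∫ z,
        Real.exp (κ / (1 + s) * min (energy N φ z) R) *
          |conv (tensor (ρ ε)) (force N K i a (marginal hk (f s))) z| ^ q)]
      · rw [integral_finsetSum _ fun i _ => integrable_finsetSum _ fun a _ => hFi i a]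
        exact Finset.sum_congr rfl fun i _ => integral_finsetSum _ fun a _ => hFi i a
      · intro s hs
        have hFs (i : Fin k) (a : Fin d) := (hF i a).integrable_slice hs
        simp only
        rw [integral_finsetSum _ fun i _ => integrable_finsetSum _ fun a _ => hFs i a]
        exact Finset.sum_congr rfl fun i _ => integral_finsetSum _ fun a _ => hFs i a
    have hnn (i : Fin k) (a : Fin d) : 0 ≤ ∫ s in Icc 0 T, ∫ z,
        Real.exp (κ / (1 + s) * min (energy N φ z) R) *
          |conv (tensor (ρ ε)) (force N K i a (marginal hk (f s))) z| ^ q :=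
      integral_nonneg fun s => integral_nonneg fun z => by positivity
    rw [h1, ENNReal.ofReal_sum_of_nonneg fun i _ => Finset.sum_nonneg fun a _ => hnn i a]
    refine Finset.sum_congr rfl fun i _ => ?_
    rw [ENNReal.ofReal_sum_of_nonneg fun a _ => hnn i a]
    refine Finset.sum_congr rfl fun a _ => ?_
    rw [(hF i a).ofReal_integral_integral fun s z => by positivity]
    exact lintegral_congr fun s => lintegral_congr fun z =>
      ofReal_mul_abs_rpow (Real.exp_pos _).le hq0
  rw [← e0, ← e1, ← e2, ← ENNReal.ofReal_mul hC0, ← ENNReal.ofReal_add, ← ENNReal.ofReal_add]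
  · refine ENNReal.ofReal_le_ofReal ?_
    have := mul_le_mul_of_nonneg_left hA' hq0
    linarith
  · refine add_nonneg (integral_nonneg fun z => by positivity) (mul_nonneg hC0
      (integral_nonneg fun s => integral_nonneg fun z => mul_nonneg (Real.exp_pos _).le
        (Finset.sum_nonneg fun i _ => Finset.sum_nonneg fun a _ => by positivity)))
  · positivity
  · exact integral_nonneg fun z => by positivity
  · refine mul_nonneg hC0
      (integral_nonneg fun s => integral_nonneg fun z => mul_nonneg (Real.exp_pos _).le
        (Finset.sum_nonneg fun i _ => Finset.sum_nonneg fun a _ => by positivity))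

end Limit

section EnergyMarginal

variable {d k N : ℕ} {φ : Torus d → ℝ} {K : Torus d → Vel d} {T M : ℝ}

lemma integrable_abs_rpow {X : Type*} [MeasurableSpace X] {μ : Measure X} {g : X → ℝ}
    (hg : Measurable g) {q : ℝ} (hq : 0 ≤ q) (h : ∫⁻ x, ‖g x‖ₑ ^ q ∂μ ≠ ⊤) :
    Integrable (fun x => |g x| ^ q) μ := by
  refine ⟨(hg.abs.pow_const q).aestronglyMeasurable, ?_⟩
  refine lt_of_eq_of_lt (lintegral_congr fun x => ?_) h.lt_top
  rw [Real.enorm_rpow_of_nonneg (abs_nonneg _) hq, Real.enorm_abs]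

lemma eventually_lintegral_conv_rpow_le {ρ : ℝ → Particle d → ℝ} (hρ : IsMollifier ρ)
    {ε : ℕ → ℝ} (hε : ∀ n, 0 < ε n) (hε0 : Tendsto ε atTop (𝓝 0)) {g : Config d k → ℝ}
    (hg : Measurable g) {q : ℝ} (hq : 1 ≤ q) (hgq : ∫⁻ z, ‖g z‖ₑ ^ q ≠ ⊤)
    {W : Config d k → ℝ≥0∞} (hW : Measurable W) {c : ℝ} (hWc : ∀ z, W z ≤ ENNReal.ofReal c)
    {δ : ℝ≥0∞} (hδ : 0 < δ) :
    ∀ᶠ n in atTop, ∫⁻ z, W z * ‖conv (tensor (ρ (ε n))) g z‖ₑ ^ q ≤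
      (∫⁻ z, W z * ‖g z‖ₑ ^ q) + δ := by
  have hδ' : 0 < δ / ENNReal.ofReal (max c 1) :=
    ENNReal.div_pos hδ.ne' ENNReal.ofReal_ne_top
  obtain ⟨r, hr, h⟩ := exists_lintegral_conv_rpow_le hg hq
    (integrable_abs_rpow hg (by linarith) hgq) hδ'
  filter_upwards [hε0.eventually_le_const hr] with n hn
  have h1 := h _ _ (hρ.isBump_tensor (hε n)) hn W (ENNReal.ofReal (max c 1)) hW
    fun z => (hWc z).trans (ENNReal.ofReal_le_ofReal (le_max_left _ _))
  rwa [ENNReal.mul_div_cancel (by simp) ENNReal.ofReal_ne_top] at h1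

lemma eventually_lintegral_lintegral_conv_rpow_le (hφm : Measurable φ)
    {ρ : ℝ → Particle d → ℝ} (hρ : IsMollifier ρ) {ε : ℕ → ℝ} (hε : ∀ n, 0 < ε n)
    (hε0 : Tendsto ε atTop (𝓝 0)) {g : ℝ → Config d k → ℝ}
    (hg : Measurable (Function.uncurry g)) {q : ℝ} (hq : 1 ≤ q) {B : ℝ≥0∞} (hB : B ≠ ⊤)
    (hgB : ∀ s ∈ Icc 0 T, ∫⁻ z, ‖g s z‖ₑ ^ q ≤ B) {κ R : ℝ} (hκ : 0 ≤ κ) (hR : 0 ≤ R)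
    {δ : ℝ≥0∞} (hδ : 0 < δ) :
    ∀ᶠ n in atTop, ∫⁻ s in Icc 0 T, ∫⁻ z, truncWeight N φ (κ / (1 + s)) R z *
        ‖conv (tensor (ρ (ε n))) (g s) z‖ₑ ^ q ≤
      (∫⁻ s in Icc 0 T, ∫⁻ z, truncWeight N φ (κ / (1 + s)) R z * ‖g s z‖ₑ ^ q) + δ := by
  set c := ENNReal.ofReal (Real.exp (κ * R)) with hc
  have hgs (s : ℝ) : Measurable (g s) := hg.comp measurable_prodMk_left
  have hl {s : ℝ} (hs : s ∈ Icc 0 T) : 0 ≤ κ / (1 + s) := div_nonneg hκ (by linarith [hs.1])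
  have hWc {s : ℝ} (hs : s ∈ Icc 0 T) (z : Config d k) :
      truncWeight N φ (κ / (1 + s)) R z ≤ c := (truncWeight_le (hl hs) R z).trans
    (ENNReal.ofReal_le_ofReal (Real.exp_le_exp.2 (mul_le_mul_of_nonneg_right
      (div_le_self hκ (by linarith [hs.1])) hR)))
  have hbound {s : ℝ} (hs : s ∈ Icc 0 T) (u : Config d k → ℝ) (hu : ∫⁻ z, ‖u z‖ₑ ^ q ≤ B) :
      ∫⁻ z, truncWeight N φ (κ / (1 + s)) R z * ‖u z‖ₑ ^ q ≤ c * B :=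
    (lintegral_mono fun z => mul_le_mul_left (hWc hs z) _).trans
      ((lintegral_const_mul' _ _ ENNReal.ofReal_ne_top).trans_le (mul_le_mul_right hu _))
  have hcB : ∫⁻ _ in Icc 0 T, c * B ≠ ⊤ := by
    rw [lintegral_const, Measure.restrict_apply_univ, Real.volume_Icc]
    exact ENNReal.mul_ne_top (ENNReal.mul_ne_top ENNReal.ofReal_ne_top hB) ENNReal.ofReal_ne_top
  have hfin : ∫⁻ s in Icc 0 T, ∫⁻ z, truncWeight N φ (κ / (1 + s)) R z * ‖g s z‖ₑ ^ q ≠ ⊤ :=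
    ne_top_of_le_ne_top hcB (setLIntegral_mono' measurableSet_Icc fun s hs =>
      hbound hs _ (hgB s hs))
  have hlim : limsup (fun n => ∫⁻ s in Icc 0 T, ∫⁻ z, truncWeight N φ (κ / (1 + s)) R z *
      ‖conv (tensor (ρ (ε n))) (g s) z‖ₑ ^ q) atTop ≤
      ∫⁻ s in Icc 0 T, ∫⁻ z, truncWeight N φ (κ / (1 + s)) R z * ‖g s z‖ₑ ^ q := by
    have hWm : Measurable fun p : ℝ × Config d k => truncWeight N φ (κ / (1 + p.1)) R p.2 :=
      (Real.measurable_exp.comp ((measurable_const.div (measurable_const.add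
        measurable_fst)).mul (((measurable_energy hφm).comp measurable_snd).min
          measurable_const))).ennreal_ofReal
    refine (limsup_lintegral_le (fun _ => c * B) (fun n => ?_) (fun n => ?_) hcB).trans ?_
    · exact (hWm.mul ((measurable_conv (hρ.isBump_tensor (hε n)).smooth.measurable
        hg).enorm.pow_const q)).lintegral_prod_right'
    · filter_upwards [ae_restrict_mem measurableSet_Icc] with s hs
      exact hbound hs _ (((hρ.isBump_tensor (hε n)).lintegral_conv_rpow_le (hgs s) hq).trans
        (hgB s hs))
    · refine setLIntegral_mono' measurableSet_Icc fun s hs => ?_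
      refine ENNReal.le_of_forall_pos_le_add fun δ' hδ' _ => ?_
      refine limsup_le_of_le (by isBoundedDefault) ?_
      exact eventually_lintegral_conv_rpow_le hρ hε hε0 (hgs s) hq
        (ne_top_of_le_ne_top hB (hgB s hs)) (measurable_truncWeight hφm _ _) (c := Real.exp (κ * R))
        (hWc hs) (by exact_mod_cast hδ')
  filter_upwards [eventually_lt_of_limsup_lt (hlim.trans_lt (ENNReal.lt_add_right hfin hδ.ne'))]
    with n hn
  exact hn.le

/-- The energy inequality for the marginal on `k` particles, closed by the marginal on `k + 1`
particles. -/
lemma weightedInt_marginal_le (hd : 0 < d) {q σ : ℝ} (hq : 2 ≤ q) (hσ : 0 < σ)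
    (hφm : Measurable φ) (hφ : ∀ x, 0 ≤ φ x) (hK : Measurable K) {f : ℝ → Config d N → ℝ}
    (hf : IsWeakSolution σ K f) (hfm : Measurable (Function.uncurry f))
    (hM : ∀ t ∈ Icc (0 : ℝ) 1, IsControlled K M (f t))
    (hsymm : ∀ t ∈ Icc (0 : ℝ) 1, ∀ π : Equiv.Perm (Fin N), ∀ᵐ z, f t (z ∘ π) = f t z)
    (hKq : eLpNorm K (ENNReal.ofReal (q / (q - 1))) volume ≠ ⊤)
    (hk : k + 1 ≤ N) {κ : ℝ} (hκ : 1 / (2 * lamConst q (σ ^ 2 / 2)) ≤ κ)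
    (hκ' : κ ≤ 1 / lamConst q (σ ^ 2 / 2)) (hT : T ∈ Icc (0 : ℝ) 1)
    (hE : EntropyInequality N φ K q (fun t => κ / (1 + t)) T
      (fun t => marginal (Nat.le_of_succ_le hk) (f t)))
    {B : ℝ≥0∞} (hB : B ≠ ⊤)
    (hgB : ∀ s ∈ Icc 0 T, weightedInt N φ q (κ / (1 + s)) (marginal hk (f s)) ≤ B) :
    weightedInt N φ q (κ / (1 + T)) (marginal (Nat.le_of_succ_le hk) (f T)) ≤
      weightedInt N φ q κ (marginal (Nat.le_of_succ_le hk) (f 0)) +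
        ENNReal.ofReal (forceConst q (σ ^ 2 / 2) *
          (1 / youngConst d q (σ ^ 2 / 2)) ^ ((q - 2) / 2)) * (k * (d *
          (ENNReal.ofReal (gaussConst d q (1 / (4 * lamConst q (σ ^ 2 / 2)))) *
            eLpNorm K (ENNReal.ofReal (q / (q - 1))) volume ^ q *
            ∫⁻ s in Icc 0 T, weightedInt N φ q (κ / (1 + s)) (marginal hk (f s))))) := by
  have hk' := Nat.le_of_succ_le hk
  have hq0 : 0 ≤ q := by linarith
  have hτ : 0 < σ ^ 2 / 2 := by positivity
  have hΛ := lamConst_pos hq hτ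
  have hκp : 0 < κ := lt_of_lt_of_le (by positivity) hκ
  have hs1 {s : ℝ} (hs : s ∈ Icc 0 T) : s ∈ Icc (0 : ℝ) 1 := ⟨hs.1, hs.2.trans hT.2⟩
  set c := 1 / (4 * lamConst q (σ ^ 2 / 2)) with hc
  have hc0 : 0 < c := by positivity
  have hcl {s : ℝ} (hs : s ∈ Icc 0 T) : c ≤ κ / (1 + s) := by
    have h1 : 1 / (2 * lamConst q (σ ^ 2 / 2)) = 2 * c := by rw [hc]; field_simp; norm_num
    rw [le_div_iff₀ (by linarith [hs.1])]
    nlinarith [(hs1 hs).2]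
  set Y := forceConst q (σ ^ 2 / 2) * (1 / youngConst d q (σ ^ 2 / 2)) ^ ((q - 2) / 2) with hY
  set D := ENNReal.ofReal (gaussConst d q c) *
    eLpNorm K (ENNReal.ofReal (q / (q - 1))) volume ^ q with hD
  have hDt : D ≠ ⊤ := ENNReal.mul_ne_top ENNReal.ofReal_ne_top
    (ENNReal.rpow_ne_top_of_nonneg hq0 hKq)
  have hgm : Measurable (Function.uncurry fun s => marginal hk' (f s)) := measurable_marginal hk' hfm
  have hgs (s : ℝ) : Measurable (marginal hk' (f s)) := hgm.comp measurable_prodMk_left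
  have hhm : Measurable (Function.uncurry fun s => marginal hk (f s)) := measurable_marginal hk hfm
  have hhs (s : ℝ) : Measurable (marginal hk (f s)) := hhm.comp measurable_prodMk_left
  by_cases hX : weightedInt N φ q κ (marginal hk' (f 0)) = ⊤
  · rw [hX, top_add]; exact le_top
  have hone {n : ℕ} {l : ℝ} (hl : 0 ≤ l) (z : Config d n) :
      1 ≤ ENNReal.ofReal (Real.exp (l * energy N φ z)) := by
    rw [ENNReal.one_le_ofReal, Real.one_le_exp_iff]
    exact mul_nonneg hl (energy_nonneg hφ z)
  have h0q : ∫⁻ z, ‖marginal hk' (f 0) z‖ₑ ^ q ≠ ⊤ := by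
    refine ne_top_of_le_ne_top hX ?_
    rw [weightedInt_eq q κ hq0]
    exact lintegral_mono fun z => le_mul_of_one_le_left zero_le (hone hκp.le z)
  have hforce {s : ℝ} (hs : s ∈ Icc 0 T) (i : Fin k) (a : Fin d) :
      ∫⁻ z, ENNReal.ofReal (Real.exp (κ / (1 + s) * energy N φ z)) *
        ‖force N K i a (marginal hk (f s)) z‖ₑ ^ q ≤
      D * weightedInt N φ q (κ / (1 + s)) (marginal hk (f s)) :=
    lintegral_force_rpow_le hφm hφ hK (hhs s) hq hc0 (hcl hs) hk' i a
  have hforce' {s : ℝ} (hs : s ∈ Icc 0 T) (i : Fin k) (a : Fin d) :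
      ∫⁻ z, ‖force N K i a (marginal hk (f s)) z‖ₑ ^ q ≤ D * B :=
    (lintegral_mono fun z => le_mul_of_one_le_left zero_le
      (hone (hc0.le.trans (hcl hs)) z)).trans
      ((hforce hs i a).trans (mul_le_mul_right (hgB s hs) _))
  set S := ∫⁻ s in Icc 0 T, weightedInt N φ q (κ / (1 + s)) (marginal hk (f s)) with hS
  obtain ⟨ρ, hρ, hint, hlim⟩ := hE
  have hgi : Integrable (marginal hk' (f T)) := integrable_marginal hk' (hM T hT).integrable
  obtain ⟨ε, hε, hε0, hae⟩ := hρ.exists_seq_tendsto_ae (hgs T) hgi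
  have hε0' : Tendsto ε atTop (𝓝[>] 0) :=
    tendsto_nhdsWithin_iff.2 ⟨hε0, Eventually.of_forall hε⟩
  have hkey (δ : ℝ) (hδ : 0 < δ) (n₀ : ℕ) :
      ∫⁻ z, truncWeight N φ (κ / (1 + T)) n₀ z * ‖marginal hk' (f T) z‖ₑ ^ q ≤
        weightedInt N φ q κ (marginal hk' (f 0)) + ENNReal.ofReal δ + ENNReal.ofReal Y *
          (∑ _i : Fin k, ∑ _a : Fin d, (D * S + ENNReal.ofReal δ)) + ENNReal.ofReal (q * δ) := by
    have hlt : ((-δ : ℝ) : EReal) < limsup (fun R : ℝ => liminf (fun ε : ℝ =>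
        ((∫ t in Icc 0 T, ∫ z, entropyDensity N φ K q (κ / (1 + t)) R (ρ ε)
          (marginal hk' (f t)) z : ℝ) : EReal)) (𝓝[>] 0)) atTop := by
      refine lt_of_lt_of_le ?_ hlim
      exact_mod_cast neg_neg_of_pos hδ
    obtain ⟨R, hRmax, hRlim⟩ := ((frequently_lt_of_lt_limsup (by isBoundedDefault)
      hlt).and_eventually (eventually_ge_atTop (max (max (n₀ : ℝ) k) 1))).exists.imp
        fun _ h => h.symm
    have hR1 : (1 : ℝ) ≤ R := (le_max_right _ _).trans hRmax
    have hRk : (k : ℝ) ≤ R := ((le_max_right _ _).trans (le_max_left _ _)).trans hRmax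
    have hRn : (n₀ : ℝ) ≤ R := ((le_max_left _ _).trans (le_max_left _ _)).trans hRmax
    have hev := hε0'.eventually (eventually_lt_of_lt_liminf hRlim (by isBoundedDefault))
    have hδ' : 0 < ENNReal.ofReal δ := ENNReal.ofReal_pos.2 hδ
    have hev0 := eventually_lintegral_conv_rpow_le hρ hε hε0 (hgs 0) (by linarith : 1 ≤ q) h0q
      (measurable_truncWeight (N := N) hφm κ R) (truncWeight_le hκp.le R) hδ'
    have hevF (i : Fin k) (a : Fin d) := eventually_lintegral_lintegral_conv_rpow_le
      (N := N) (T := T) hφm hρ hε hε0 (measurable_force hK hhm i a) (by linarith : 1 ≤ q)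
      (ENNReal.mul_ne_top hDt hB) (fun s hs => hforce' hs i a) hκp.le (by linarith : 0 ≤ R) hδ'
    calc ∫⁻ z, truncWeight N φ (κ / (1 + T)) n₀ z * ‖marginal hk' (f T) z‖ₑ ^ q
        ≤ ∫⁻ z, truncWeight N φ (κ / (1 + T)) R z * ‖marginal hk' (f T) z‖ₑ ^ q :=
          lintegral_mono fun z => mul_le_mul_left (truncWeight_mono
            (div_nonneg hκp.le (by linarith [hT.1])) hRn z) _
      _ = ∫⁻ z, liminf (fun n => truncWeight N φ (κ / (1 + T)) R z *
            ‖conv (tensor (ρ (ε n))) (marginal hk' (f T)) z‖ₑ ^ q) atTop := by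
          refine lintegral_congr_ae ?_
          filter_upwards [hae] with z hz
          refine (Tendsto.liminf_eq (ENNReal.Tendsto.const_mul ?_
            (Or.inr ENNReal.ofReal_ne_top))).symm
          exact (ENNReal.continuous_rpow_const.tendsto _).comp
            ((continuous_enorm.tendsto _).comp hz)
      _ ≤ liminf (fun n => ∫⁻ z, truncWeight N φ (κ / (1 + T)) R z *
            ‖conv (tensor (ρ (ε n))) (marginal hk' (f T)) z‖ₑ ^ q) atTop :=
          lintegral_liminf_le fun n => (measurable_truncWeight hφm _ R).mul
            ((measurable_conv_right (hρ.isBump_tensor (hε n)).smooth.measurable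
              (hgs T)).enorm.pow_const q)
      _ ≤ _ := by
          refine liminf_le_of_frequently_le' (Eventually.frequently ?_)
          filter_upwards [hev, hev0, eventually_all.2 fun i => eventually_all.2 fun a => hevF i a]
            with n hn hn0 hnF
          have hn' : -δ ≤ ∫ t in Icc 0 T, ∫ z, entropyDensity N φ K q (κ / (1 + t)) R (ρ (ε n))
              (marginal hk' (f t)) z := by exact_mod_cast hn.le
          refine (lintegral_mollified_marginal_le hd hq hσ hφm hφ hK hf hfm hM hsymm hk hκ hκ' hRk
            hT hρ (hε n) (hint R (by linarith) (ε n) (hε n)) hδ.le hn').trans ?_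
          refine add_le_add (add_le_add (hn0.trans (add_le_add ?_ le_rfl))
            (mul_le_mul_right (Finset.sum_le_sum fun i _ => Finset.sum_le_sum fun a _ =>
              (hnF i a).trans (add_le_add ?_ le_rfl)) _)) le_rfl
          · rw [weightedInt_eq q κ hq0]
            exact lintegral_mono fun z => mul_le_mul_left (truncWeight_le_weight hκp.le R z) _
          · rw [hS, ← lintegral_const_mul' _ _ hDt]
            refine setLIntegral_mono' measurableSet_Icc fun s hs => (lintegral_mono fun z =>
              mul_le_mul_left (truncWeight_le_weight (hc0.le.trans (hcl hs)) R z) _).trans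
                (hforce hs i a)
  have hsup : weightedInt N φ q (κ / (1 + T)) (marginal hk' (f T)) ≤
      ⨆ n : ℕ, ∫⁻ z, truncWeight N φ (κ / (1 + T)) n z * ‖marginal hk' (f T) z‖ₑ ^ q := by
    have hl : 0 ≤ κ / (1 + T) := div_nonneg hκp.le (by linarith [hT.1])
    rw [weightedInt_eq q _ hq0, ← lintegral_iSup (f := fun (n : ℕ) z =>
      truncWeight N φ (κ / (1 + T)) n z * ‖marginal hk' (f T) z‖ₑ ^ q) (fun n => (measurable_truncWeight hφm _ n).mul ((hgs T).enorm.pow_const q))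
      fun m n hmn z => mul_le_mul_left (truncWeight_mono hl (by exact_mod_cast hmn) z) _]
    refine lintegral_mono fun z => ?_
    obtain ⟨n, hn⟩ := exists_nat_ge (energy N φ z)
    refine le_trans (le_of_eq ?_) (le_iSup _ n)
    simp only [truncWeight]
    rw [min_eq_left hn]
  have hfinal (δ : ℝ) (hδ : 0 < δ) : weightedInt N φ q (κ / (1 + T)) (marginal hk' (f T)) ≤
      weightedInt N φ q κ (marginal hk' (f 0)) + ENNReal.ofReal δ + ENNReal.ofReal Y *
          (∑ _i : Fin k, ∑ _a : Fin d, (D * S + ENNReal.ofReal δ)) + ENNReal.ofReal (q * δ) :=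
    hsup.trans (iSup_le fun n => hkey δ hδ n)
  have hcont : Tendsto (fun δ : ℝ => weightedInt N φ q κ (marginal hk' (f 0)) + ENNReal.ofReal δ +
      ENNReal.ofReal Y * (∑ _i : Fin k, ∑ _a : Fin d, (D * S + ENNReal.ofReal δ)) +
        ENNReal.ofReal (q * δ)) (𝓝[>] 0)
      (𝓝 (weightedInt N φ q κ (marginal hk' (f 0)) + ENNReal.ofReal 0 +
      ENNReal.ofReal Y * (∑ _i : Fin k, ∑ _a : Fin d, (D * S + ENNReal.ofReal 0)) +
        ENNReal.ofReal (q * 0))) := by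
    have h0 : Tendsto (fun δ : ℝ => ENNReal.ofReal δ) (𝓝[>] 0) (𝓝 (ENNReal.ofReal 0)) :=
      (ENNReal.continuous_ofReal.tendsto 0).mono_left nhdsWithin_le_nhds
    have h1 : Tendsto (fun δ : ℝ => ENNReal.ofReal (q * δ)) (𝓝[>] 0)
        (𝓝 (ENNReal.ofReal (q * 0))) :=
      ((ENNReal.continuous_ofReal.comp (continuous_const_mul q)).tendsto 0).mono_left
        nhdsWithin_le_nhds
    refine ((tendsto_const_nhds.add h0).add (ENNReal.Tendsto.const_mul ?_
      (Or.inr ENNReal.ofReal_ne_top))).add h1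
    exact tendsto_finsetSum _ fun i _ => tendsto_finsetSum _ fun a _ => tendsto_const_nhds.add h0
  refine (ge_of_tendsto hcont (eventually_nhdsWithin_of_forall fun δ hδ => hfinal δ hδ)).trans
    (le_of_eq ?_)
  simp

end EnergyMarginal

/-! ### Integrability of the interaction -/

section Interaction

variable {d N : ℕ} {K : Torus d → Vel d}

/-- Under the Lebesgue measure, the difference of two positions is independent of every
quantity which is invariant under translations of the positions. -/
lemma lintegral_comp_sub_mul {i j : Fin N} (hij : i ≠ j) {κ : Torus d → ℝ≥0∞} (hκ : Measurable κ)
    {E : Config d N → ℝ≥0∞} (hE : Measurable E)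
    (hinv : ∀ (h : Torus d) z, E (z + Pi.single i (h, 0)) = E z) :
    ∫⁻ z, κ ((z i).1 - (z j).1) * E z = (∫⁻ x, κ x) * ∫⁻ z, E z := by
  have hm : Measurable fun z : Config d N => (z i).1 - (z j).1 :=
    (measurable_fst.comp (measurable_pi_apply i)).sub (measurable_fst.comp (measurable_pi_apply j))
  have h1 (h : Torus d) : ∫⁻ z, κ ((z i).1 - (z j).1) * E z =
      ∫⁻ z, κ ((z i).1 - (z j).1 + h) * E z := by
    rw [← lintegral_add_right_eq_self (fun z => κ ((z i).1 - (z j).1) * E z)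
      (Pi.single i (h, 0) : Config d N)]
    refine lintegral_congr fun z => ?_
    rw [hinv]
    congr 2
    simp [Pi.single_eq_of_ne hij.symm]
    abel
  calc ∫⁻ z, κ ((z i).1 - (z j).1) * E z
      = ∫⁻ h : Torus d, ∫⁻ z, κ ((z i).1 - (z j).1 + h) * E z := by
        simp_rw [← h1]; simp
    _ = ∫⁻ z, ∫⁻ h : Torus d, κ ((z i).1 - (z j).1 + h) * E z := by
        refine lintegral_lintegral_swap (Measurable.aemeasurable ?_)
        exact (hκ.comp ((hm.comp measurable_snd).add measurable_fst)).mul (hE.comp measurable_snd)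
    _ = ∫⁻ z, (∫⁻ x, κ x) * E z := by
        refine lintegral_congr fun z => ?_
        rw [lintegral_mul_const _ (by exact hκ.comp (measurable_const.add measurable_id)),
          lintegral_add_left_eq_self κ]
    _ = _ := lintegral_const_mul _ hE

lemma ae_comp_sub {i j : Fin N} (hij : i ≠ j) {p : Torus d → Prop} (hp : ∀ᵐ x, p x) :
    ∀ᵐ z : Config d N, p ((z i).1 - (z j).1) := by
  obtain ⟨s, hs, hsm, hs0⟩ := exists_measurable_superset_of_null (ae_iff.1 hp)
  have h1 := lintegral_comp_sub_mul hij (measurable_one.indicator hsm)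
    (E := fun _ : Config d N => 1) measurable_const fun _ _ => rfl
  have hm : Measurable fun z : Config d N => (z i).1 - (z j).1 :=
    (measurable_fst.comp (measurable_pi_apply i)).sub (measurable_fst.comp (measurable_pi_apply j))
  rw [lintegral_indicator_one hsm, hs0, zero_mul] at h1
  simp only [mul_one] at h1
  have h2 := (lintegral_eq_zero_iff ((measurable_one.indicator hsm).comp hm)).1 h1
  filter_upwards [h2] with z hz
  by_contra hc
  have : (z i).1 - (z j).1 ∈ s := hs hc
  simp [this] at hz

/-- The weight `e^{b ∑ |v_i|²}`. -/
def velWeight (b : ℝ) (z : Config d N) : ℝ≥0∞ := ENNReal.ofReal (Real.exp (b * ∑ i, ‖(z i).2‖ ^ 2))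

lemma measurable_velWeight (b : ℝ) : Measurable (velWeight b : Config d N → ℝ≥0∞) :=
  (Real.measurable_exp.comp (measurable_const.mul (Finset.measurable_fun_sum _ fun i _ =>
    ((measurable_snd.comp (measurable_pi_apply i)).norm.pow_const 2)))).ennreal_ofReal

lemma lintegral_velWeight_ne_top {b : ℝ} (hb : 0 < b) :
    ∫⁻ z : Config d N, velWeight (-b) z ≠ ⊤ := by
  have h1 : Integrable fun p : Particle d => Real.exp (-b * ‖p.2‖ ^ 2) := by
    have := (integrable_const (1 : ℝ) (μ := (volume : Measure (Torus d)))).mul_prod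
      (integrable_gaussian (d := d) hb)
    simp only [one_mul] at this
    exact this
  have h2 := Integrable.fintype_prod (μ := fun _ : Fin N => (volume : Measure (Particle d)))
    (f := fun _ p => Real.exp (-b * ‖p.2‖ ^ 2)) fun _ => h1
  have h3 : ∫⁻ z : Config d N, velWeight (-b) z =
      ∫⁻ z : Config d N, ‖∏ i, Real.exp (-b * ‖(z i).2‖ ^ 2)‖ₑ := by
    refine lintegral_congr fun z => ?_
    rw [velWeight, Finset.mul_sum, Real.exp_sum, Real.enorm_of_nonneg
      (Finset.prod_nonneg fun i _ => (Real.exp_pos _).le)]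
  rw [h3]
  exact h2.2.ne

lemma velWeight_rpow (b : ℝ) {r : ℝ} (z : Config d N) :
    velWeight b z ^ r = velWeight (b * r) z := by
  rw [velWeight, velWeight, ENNReal.ofReal_rpow_of_pos (Real.exp_pos _), ← Real.exp_mul]
  congr 2; ring

lemma velWeight_neg_mul (b : ℝ) (z : Config d N) : velWeight (-b) z * velWeight b z = 1 := by
  rw [velWeight, velWeight, ← ENNReal.ofReal_mul (Real.exp_pos _).le, ← Real.exp_add]
  simp

/-- Functions with a finite Gaussian moment of order `q` are integrable against the interaction
kernel. -/
lemma exists_isControlled (hK : Measurable K) (hK0 : K 0 = 0) {q c : ℝ} (hq : 2 ≤ q) (hc : 0 < c)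
    (hKq : eLpNorm K (ENNReal.ofReal (q / (q - 1))) volume ≠ ⊤) {B B' : ℝ≥0∞} (hB : B ≠ ⊤)
    (hB' : B' ≠ ⊤) :
    ∃ M, ∀ g : Config d N → ℝ, Measurable g → ∫⁻ z, ‖g z‖ₑ ≤ B →
      ∫⁻ z, velWeight c z * ‖g z‖ₑ ^ q ≤ B' → IsControlled K M g := by
  have hq0 : 0 < q := by linarith
  have hq1 : 0 < q - 1 := by linarith
  set q' := q / (q - 1) with hq'
  have hq'0 : 0 < q' := by positivity
  have hconj : q'.HolderConjugate q := by
    refine Real.holderConjugate_iff.2 ⟨?_, ?_⟩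
    · rw [hq', one_lt_div hq1]; linarith
    · rw [hq']; field_simp; ring
  have hKq' : ∫⁻ x, ‖K x‖ₑ ^ q' ≠ ⊤ := by
    have h := (lintegral_rpow_enorm_lt_top_of_eLpNorm_lt_top (by simpa using hq'0)
      ENNReal.ofReal_ne_top hKq.lt_top).ne
    rwa [ENNReal.toReal_ofReal hq'0.le] at h
  set A := (∫⁻ x, ‖K x‖ₑ ^ q') * ∫⁻ z : Config d N, velWeight (-(c / q * q')) z with hA
  have hAt : A ≠ ⊤ := ENNReal.mul_ne_top hKq' (lintegral_velWeight_ne_top (by positivity))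
  set D := A ^ (1 / q') * B' ^ (1 / q) with hD
  have hDt : D ≠ ⊤ := ENNReal.mul_ne_top (ENNReal.rpow_ne_top_of_nonneg (by positivity) hAt)
    (ENNReal.rpow_ne_top_of_nonneg (by positivity) hB')
  refine ⟨max B.toReal D.toReal, fun g hg hgB hgB' => ?_⟩
  have hm (i j : Fin N) : Measurable fun z : Config d N => ‖K ((z i).1 - (z j).1)‖ₑ :=
    (measurable_kernel hK i j).enorm
  have hker (i j : Fin N) : ∫⁻ z, ‖‖K ((z i).1 - (z j).1)‖ * |g z|‖ₑ ≤ D := by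
    rcases eq_or_ne i j with rfl | hij
    · simp [hK0]
    calc ∫⁻ z, ‖‖K ((z i).1 - (z j).1)‖ * |g z|‖ₑ
        = ∫⁻ z, ((fun z => ‖K ((z i).1 - (z j).1)‖ₑ * velWeight (-(c / q)) z) *
            fun z => velWeight (c / q) z * ‖g z‖ₑ) z := by
          refine lintegral_congr fun z => ?_
          rw [enorm_mul, enorm_norm, Real.enorm_abs, Pi.mul_apply, mul_assoc,
            ← mul_assoc (velWeight _ z), velWeight_neg_mul, one_mul]
      _ ≤ _ := ENNReal.lintegral_mul_le_Lp_mul_Lq volume hconj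
            ((hm i j).mul (measurable_velWeight _)).aemeasurable
            ((measurable_velWeight _).mul hg.enorm).aemeasurable
      _ ≤ D := by
          refine mul_le_mul' (ENNReal.rpow_le_rpow (le_of_eq ?_) (by positivity))
            (ENNReal.rpow_le_rpow (le_trans (le_of_eq ?_) hgB') (by positivity))
          · rw [hA, ← lintegral_comp_sub_mul hij (hK.enorm.pow_const q')
              (measurable_velWeight _) fun h z => ?_]
            · refine lintegral_congr fun z => ?_
              rw [ENNReal.mul_rpow_of_nonneg _ _ hq'0.le, velWeight_rpow, neg_mul]
            · simp only [velWeight, Pi.add_apply]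
              congr 4
              ext l
              rcases eq_or_ne l i with rfl | hl
              · simp
              · simp [Pi.single_eq_of_ne hl]
          · refine lintegral_congr fun z => ?_
            rw [ENNReal.mul_rpow_of_nonneg _ _ hq0.le, velWeight_rpow, div_mul_cancel₀ _ hq0.ne']
  have hint : Integrable g := ⟨hg.aestronglyMeasurable, hgB.trans_lt hB.lt_top⟩
  have hkint (i j : Fin N) : Integrable fun z => ‖K ((z i).1 - (z j).1)‖ * |g z| :=
    ⟨((measurable_kernel hK i j).norm.mul hg.abs).aestronglyMeasurable,
      (hker i j).trans_lt hDt.lt_top⟩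
  have hle (u : Config d N → ℝ) (hu : Integrable u) (h0 : ∀ z, 0 ≤ u z) (C : ℝ≥0∞) (hC : C ≠ ⊤)
      (h : ∫⁻ z, ‖u z‖ₑ ≤ C) : ∫ z, u z ≤ C.toReal := by
    have h1 := ofReal_integral_norm_eq_lintegral_enorm hu
    simp_rw [Real.norm_of_nonneg (h0 _)] at h1
    rw [← h1] at h
    exact (ENNReal.ofReal_le_iff_le_toReal hC).1 h
  refine ⟨hint, ?_, hkint, fun i j => ?_⟩
  · refine (hle _ hint.abs (fun z => abs_nonneg _) B hB ?_).trans (le_max_left _ _)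
    simpa using hgB
  · exact (hle _ (hkint i j) (fun z => by positivity) D hDt (hker i j)).trans (le_max_right _ _)

end Interaction

/-! ### The integrated hierarchy -/

section Iteration

variable {N : ℕ} {F₀ F L T : ℝ}

/-- The solution of the hierarchy `b_k' = k L b_{k+1}`, `b_N = F^N` with initial values of order
`F₀^k`. -/
def hierBound (N : ℕ) (F₀ F L : ℝ) (k : ℕ) (t : ℝ) : ℝ :=
  F₀ ^ k * ((1 - F₀ * L * t) ^ k)⁻¹ + (N - 1).choose (k - 1) * F ^ N * (L * t) ^ (N - k)

lemma hierBound_nonneg (hF₀ : 0 < F₀) (hF : 0 < F) (hL : 0 ≤ L) (k : ℕ) {t : ℝ} (ht : 0 ≤ t)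
    (h : F₀ * L * t ≤ 1 / 4) : 0 ≤ hierBound N F₀ F L k t := by
  have : 0 < 1 - F₀ * L * t := by linarith
  unfold hierBound; positivity

lemma continuousOn_hierBound (hF₀ : 0 < F₀) (hL : 0 ≤ L) (k : ℕ) {t : ℝ}
    (h : F₀ * L * t ≤ 1 / 4) : ContinuousOn (hierBound N F₀ F L k) (Icc 0 t) := by
  refine (continuousOn_const.mul (ContinuousOn.inv₀ (by fun_prop) fun s hs => ?_)).add
    (by fun_prop)
  have h1 : F₀ * L * s ≤ F₀ * L * t := mul_le_mul_of_nonneg_left hs.2 (by positivity)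
  exact pow_ne_zero _ (by linarith)

lemma hierBound_eq (hF₀ : 0 < F₀) (hL : 0 ≤ L) {k : ℕ} (hk1 : 1 ≤ k) (hk : k < N) {t : ℝ}
    (ht : 0 ≤ t) (h : F₀ * L * t ≤ 1 / 4) :
    F₀ ^ k + k * L * (∫ s in (0 : ℝ)..t, hierBound N F₀ F L (k + 1) s) =
      hierBound N F₀ F L k t := by
  obtain ⟨n, rfl⟩ := Nat.exists_eq_add_of_lt hk
  have hk0 : (k : ℝ) ≠ 0 := by positivity
  have hderiv : ∀ s ∈ uIcc 0 t, HasDerivAt (hierBound (k + n + 1) F₀ F L k)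
      (k * L * hierBound (k + n + 1) F₀ F L (k + 1) s) s := by
    intro s hs
    rw [uIcc_of_le ht] at hs
    have h1 : F₀ * L * s ≤ F₀ * L * t := mul_le_mul_of_nonneg_left hs.2 (by positivity)
    have h2 : 1 - F₀ * L * s ≠ 0 := by linarith
    have e1 : k + n + 1 - k = n + 1 := by omega
    have e2 : k + n + 1 - (k + 1) = n := by omega
    obtain ⟨m, rfl⟩ := Nat.exists_eq_add_of_le' hk1
    have hchoose : ((m + 1 + n).choose (m + 1) : ℝ) * (m + 1) =
        (m + 1 + n).choose m * (n + 1) := by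
      have h3 := Nat.choose_succ_right_eq (m + 1 + n) m
      have h4 : m + 1 + n - m = n + 1 := by omega
      rw [h4] at h3
      exact_mod_cast h3
    unfold hierBound
    rw [e1, e2]
    have d1 : HasDerivAt (fun s => 1 - F₀ * L * s) (-(F₀ * L)) s := by
      simpa using ((hasDerivAt_id' s).const_mul (F₀ * L)).const_sub 1
    have d2 := ((d1.pow (m + 1)).inv (pow_ne_zero _ h2)).const_mul (F₀ ^ (m + 1))
    have d3 : HasDerivAt (fun s => L * s) L s := by
      simpa using (hasDerivAt_id' s).const_mul L
    have d4 := (d3.pow (n + 1)).const_mul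
      (((m + 1 + n + 1 - 1).choose (m + 1 - 1) : ℝ) * F ^ (m + 1 + n + 1))
    refine (d2.add d4).congr_deriv ?_
    simp only [Nat.add_sub_cancel, Nat.cast_add, Nat.cast_one, Pi.pow_apply]
    rw [mul_add]
    congr 1
    · field_simp
      ring
    · linear_combination (-(F ^ (m + 1 + n + 1) * (L * s) ^ n * L)) * hchoose
  have hcont : ContinuousOn (fun s => k * L * hierBound (k + n + 1) F₀ F L (k + 1) s)
      (uIcc 0 t) := by
    rw [uIcc_of_le ht]
    exact continuousOn_const.mul (continuousOn_hierBound hF₀ hL _ h)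
  have hint := intervalIntegral.integral_eq_sub_of_hasDerivAt hderiv hcont.intervalIntegrable
  rw [intervalIntegral.integral_const_mul] at hint
  have h0 : hierBound (k + n + 1) F₀ F L k 0 = F₀ ^ k := by
    have e1 : k + n + 1 - k = n + 1 := by omega
    simp [hierBound, e1]
  rw [hint, h0]; ring

lemma hierBound_le (hF₀ : 0 < F₀) (hF : 0 < F) (hL : 0 ≤ L) {k : ℕ} (hk1 : 1 ≤ k) (hk : k ≤ N)
    {t : ℝ} (ht : 0 ≤ t) (h : F₀ * L * t ≤ 1 / 4) (h' : F * L * t ≤ 1 / 4) :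
    hierBound N F₀ F L k t ≤
      2 ^ k * F₀ ^ k + F ^ k * (2 : ℝ) ^ (2 * (k : ℤ) - (N : ℤ) - 1) := by
  refine add_le_add ?_ ?_
  · rw [mul_comm, ← inv_pow]
    refine mul_le_mul_of_nonneg_right (pow_le_pow_left₀ (by
      rw [inv_nonneg]; linarith) ?_ k) (by positivity)
    rw [inv_le_comm₀ (by linarith) two_pos]
    linarith
  · obtain ⟨n, rfl⟩ := Nat.exists_eq_add_of_le hk
    have e1 : k + n - k = n := by omega
    have h1 : ((k + n - 1).choose (k - 1) : ℝ) ≤ 2 ^ (k + n - 1) := by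
      exact_mod_cast Nat.choose_le_two_pow _ _
    have h2 : (F * L * t) ^ n ≤ (1 / 4) ^ n := pow_le_pow_left₀ (by positivity) h' n
    have e2 : (2 : ℝ) ^ (2 * (k : ℤ) - ((k + n : ℕ) : ℤ) - 1) =
        2 ^ (k + n - 1) * (1 / 4) ^ n := by
      obtain ⟨m, rfl⟩ := Nat.exists_eq_add_of_le' hk1
      have e3 : m + 1 + n - 1 = m + n := by omega
      have e4 : 2 * ((m + 1 : ℕ) : ℤ) - ((m + 1 + n : ℕ) : ℤ) - 1 = (m : ℤ) - n := by
        push_cast; ring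
      rw [e3, e4, zpow_sub₀ two_ne_zero, zpow_natCast, zpow_natCast, pow_add]
      rw [div_pow, one_pow, show (4 : ℝ) = 2 * 2 by norm_num, mul_pow]
      field_simp
    rw [e1, e2]
    calc ((k + n - 1).choose (k - 1) : ℝ) * F ^ (k + n) * (L * t) ^ n
        = F ^ k * ((k + n - 1).choose (k - 1) * (F * L * t) ^ n) := by
          rw [pow_add, mul_assoc F L t, mul_pow F]; ring
      _ ≤ F ^ k * (2 ^ (k + n - 1) * (1 / 4) ^ n) := by gcongr

lemma hierBound_mono (hF₀ : 0 < F₀) (hF : 0 < F) (hL : 0 ≤ L) (k : ℕ) {s t : ℝ} (hs : 0 ≤ s)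
    (hst : s ≤ t) (h : F₀ * L * t ≤ 1 / 4) : hierBound N F₀ F L k s ≤ hierBound N F₀ F L k t := by
  have h1 : F₀ * L * s ≤ F₀ * L * t := mul_le_mul_of_nonneg_left hst (by positivity)
  unfold hierBound
  have h2 : 0 < 1 - F₀ * L * t := by linarith
  gcongr

/-- The solution of the integrated hierarchy of inequalities. -/
lemma hierarchy_le (hF₀ : 0 < F₀) (hF : 0 < F) (hL : 0 ≤ L) (hT : F₀ * L * T ≤ 1 / 4)
    (X : ∀ k, k ≤ N → ℝ → ℝ≥0∞)
    (hN : ∀ t ∈ Icc 0 T, X N le_rfl t ≤ ENNReal.ofReal (F ^ N))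
    (h0 : ∀ k (hk : k ≤ N), 1 ≤ k → X k hk 0 ≤ ENNReal.ofReal (F₀ ^ k))
    (hstep : ∀ k (hk : k + 1 ≤ N), 1 ≤ k → ∀ t ∈ Icc 0 T, ∀ B : ℝ≥0∞, B ≠ ⊤ →
      (∀ s ∈ Icc 0 t, X (k + 1) hk s ≤ B) → X k (Nat.le_of_succ_le hk) t ≤
        X k (Nat.le_of_succ_le hk) 0 + ENNReal.ofReal (k * L) * ∫⁻ s in Icc 0 t, X (k + 1) hk s)
    (k : ℕ) (hk : k ≤ N) (hk1 : 1 ≤ k) (t : ℝ) (ht : t ∈ Icc 0 T) :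
    X k hk t ≤ ENNReal.ofReal (hierBound N F₀ F L k t) := by
  have hle {s : ℝ} (hs : s ∈ Icc 0 T) : F₀ * L * s ≤ 1 / 4 :=
    (mul_le_mul_of_nonneg_left hs.2 (by positivity)).trans hT
  obtain ⟨m, hm⟩ : ∃ m, N - k = m := ⟨_, rfl⟩
  induction m generalizing k t with
  | zero =>
    obtain rfl : k = N := by omega
    refine (hN t ht).trans (ENNReal.ofReal_le_ofReal ?_)
    have h1 : 0 < 1 - F₀ * L * t := by linarith [hle ht]
    have h2 : 0 ≤ F₀ ^ k * ((1 - F₀ * L * t) ^ k)⁻¹ := by positivity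
    simpa [hierBound] using h2
  | succ m ih =>
    have hk' : k + 1 ≤ N := by omega
    have hIH (s : ℝ) (hs : s ∈ Icc 0 t) :
        X (k + 1) hk' s ≤ ENNReal.ofReal (hierBound N F₀ F L (k + 1) s) :=
      ih (k + 1) hk' (by omega) s ⟨hs.1, hs.2.trans ht.2⟩ (by omega)
    have h1 := hstep k hk' hk1 t ht (ENNReal.ofReal (hierBound N F₀ F L (k + 1) t))
      ENNReal.ofReal_ne_top fun s hs => (hIH s hs).trans
        (ENNReal.ofReal_le_ofReal (hierBound_mono hF₀ hF hL _ hs.1 hs.2 (hle ht)))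
    have h2 : ∫⁻ s in Icc 0 t, X (k + 1) hk' s ≤
        ENNReal.ofReal (∫ s in (0 : ℝ)..t, hierBound N F₀ F L (k + 1) s) := by
      have hi : IntegrableOn (hierBound N F₀ F L (k + 1)) (Icc 0 t) :=
        (continuousOn_hierBound hF₀ hL _ (hle ht)).integrableOn_Icc
      rw [intervalIntegral.integral_of_le ht.1, ← integral_Icc_eq_integral_Ioc,
        ofReal_integral_eq_lintegral_ofReal hi]
      · exact setLIntegral_mono' measurableSet_Icc fun s hs => hIH s hs
      · filter_upwards [ae_restrict_mem measurableSet_Icc] with s hs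
        exact hierBound_nonneg hF₀ hF hL _ hs.1 (hle ⟨hs.1, hs.2.trans ht.2⟩)
    have h3 : 0 ≤ ∫ s in (0 : ℝ)..t, hierBound N F₀ F L (k + 1) s :=
      intervalIntegral.integral_nonneg ht.1 fun s hs =>
        hierBound_nonneg hF₀ hF hL _ hs.1 (hle ⟨hs.1, hs.2.trans ht.2⟩)
    calc X k hk t ≤ _ := h1
      _ ≤ ENNReal.ofReal (F₀ ^ k) + ENNReal.ofReal (k * L) *
          ENNReal.ofReal (∫ s in (0 : ℝ)..t, hierBound N F₀ F L (k + 1) s) := by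
          gcongr
          exact h0 k hk hk1
      _ = ENNReal.ofReal (hierBound N F₀ F L k t) := by
          rw [← ENNReal.ofReal_mul (by positivity), ← ENNReal.ofReal_add (by positivity)
            (by positivity), hierBound_eq hF₀ hL hk1 (by omega) ht.1 (hle ht)]

end Iteration

/-! ### Changing the interaction on a null set -/

section Modification

variable {d k N : ℕ} {φ φ' : Torus d → ℝ} {K K' : Torus d → Vel d}

lemma ae_forall_comp_sub_eq {E : Type*} {g g' : Torus d → E} (h0 : g 0 = g' 0) (h : g =ᵐ[volume] g') :
    ∀ᵐ z : Config d k, ∀ i j, g ((z i).1 - (z j).1) = g' ((z i).1 - (z j).1) := by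
  refine ae_all_iff.2 fun i => ae_all_iff.2 fun j => ?_
  rcases eq_or_ne i j with rfl | hij
  · simp [h0]
  · exact ae_comp_sub hij h

lemma ae_energy_eq (h0 : φ 0 = φ' 0) (h : φ =ᵐ[volume] φ') :
    ∀ᵐ z : Config d k, energy N φ z = energy N φ' z := by
  filter_upwards [ae_forall_comp_sub_eq h0 h] with z hz
  simp only [energy, hz]

lemma ae_advection_eq (h0 : K 0 = K' 0) (h : K =ᵐ[volume] K') :
    ∀ᵐ z : Config d k, ∀ ψ, advection N K ψ z = advection N K' ψ z := by
  filter_upwards [ae_forall_comp_sub_eq h0 h] with z hz ψ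
  simp only [advection, hz]

lemma weightedInt_congr (h0 : φ 0 = φ' 0) (h : φ =ᵐ[volume] φ') (q l : ℝ) (g : Config d k → ℝ) :
    weightedInt N φ q l g = weightedInt N φ' q l g := by
  refine lintegral_congr_ae ?_
  filter_upwards [ae_energy_eq h0 h] with z hz
  rw [hz]

lemma IsWeakSolution.congr {σ : ℝ} {f : ℝ → Config d N → ℝ} (hf : IsWeakSolution σ K f)
    (h0 : K 0 = K' 0) (h : K =ᵐ[volume] K') : IsWeakSolution σ K' f := by
  intro Ψ hΨ t ht
  rw [hf Ψ hΨ t ht]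
  refine intervalIntegral.integral_congr fun s _ => integral_congr_ae ?_
  filter_upwards [ae_advection_eq (N := N) h0 h] with z hz
  simp only [hz]

lemma mollifyAdvection_congr (h0 : K 0 = K' 0) (h : K =ᵐ[volume] K') (ρ : Particle d → ℝ)
    (g : Config d k → ℝ) : mollifyAdvection N K ρ g = mollifyAdvection N K' ρ g := by
  ext z
  unfold mollifyAdvection
  congr 1
  refine integral_congr_ae ?_
  filter_upwards [ae_advection_eq (N := N) h0 h] with y hy
  simp only [hy]

lemma EntropyInequality.congr {q T : ℝ} {lam : ℝ → ℝ} {g : ℝ → Config d k → ℝ}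
    (hE : EntropyInequality N φ K q lam T g) (hφ0 : φ 0 = φ' 0) (hφ : φ =ᵐ[volume] φ')
    (hK0 : K 0 = K' 0) (hK : K =ᵐ[volume] K') : EntropyInequality N φ' K' q lam T g := by
  have hae (l R : ℝ) (ρ : Particle d → ℝ) (g : Config d k → ℝ) (z : Config d k)
      (hz : energy N φ z = energy N φ' z) :
      entropyDensity N φ K q l R ρ g z = entropyDensity N φ' K' q l R ρ g z := by
    simp only [entropyDensity, hz, mollifyAdvection_congr hK0 hK]
  obtain ⟨ρ, hρ, hint, hlim⟩ := hE
  refine ⟨ρ, hρ, fun R hR ε hε => (hint R hR ε hε).congr ?_, hlim.trans (le_of_eq ?_)⟩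
  · filter_upwards [Measure.quasiMeasurePreserving_snd.ae (ae_energy_eq (N := N) hφ0 hφ)]
      with y hy
    exact hae _ _ _ _ _ hy
  · have h (R ε s : ℝ) : ∫ z, entropyDensity N φ K q (lam s) R (ρ ε) (g s) z =
        ∫ z, entropyDensity N φ' K' q (lam s) R (ρ ε) (g s) z := by
      refine integral_congr_ae ?_
      filter_upwards [ae_energy_eq (N := N) hφ0 hφ] with z hz
      exact hae _ _ _ _ _ hz
    simp only [h]

lemma IsEntropySolution.congr {σ q lam₀ : ℝ} {f : ℝ → Config d N → ℝ}
    (hf : IsEntropySolution σ φ K q lam₀ f) (hφ0 : φ 0 = φ' 0) (hφ : φ =ᵐ[volume] φ')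
    (hK0 : K 0 = K' 0) (hK : K =ᵐ[volume] K') : IsEntropySolution σ φ' K' q lam₀ f where
  measurable := hf.measurable
  bounded := hf.bounded
  symmetric := hf.symmetric
  gaussian_decay := hf.gaussian_decay
  weak_solution := hf.weak_solution.congr hK0 hK
  entropy k hk hk1 T hT κ hκ hκ' := (hf.entropy k hk hk1 T hT κ hκ hκ').congr hφ0 hφ hK0 hK

lemma exists_measurable_potential (hφ : AEStronglyMeasurable φ volume) (h0 : ∀ x, 0 ≤ φ x)
    (hφ0 : φ 0 = 0) :
    ∃ φ' : Torus d → ℝ, Measurable φ' ∧ (∀ x, 0 ≤ φ' x) ∧ φ' 0 = 0 ∧ φ =ᵐ[volume] φ' := by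
  refine ⟨({0}ᶜ : Set (Torus d)).indicator fun x => |hφ.mk φ x|,
    hφ.stronglyMeasurable_mk.measurable.abs.indicator (measurableSet_singleton 0).compl,
    fun x => indicator_nonneg (fun _ _ => abs_nonneg _) x, by simp, ?_⟩
  filter_upwards [hφ.ae_eq_mk] with x hx
  by_cases h : x = 0
  · simp [h, hφ0]
  · rw [indicator_of_mem (by simpa using h), ← hx, abs_of_nonneg (h0 x)]

lemma exists_measurable_force (hK : AEStronglyMeasurable K volume) (hK0 : K 0 = 0) :
    ∃ K' : Torus d → Vel d, Measurable K' ∧ K' 0 = 0 ∧ K =ᵐ[volume] K' := by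
  refine ⟨({0}ᶜ : Set (Torus d)).indicator (hK.mk K),
    hK.stronglyMeasurable_mk.measurable.indicator (measurableSet_singleton 0).compl, by simp, ?_⟩
  filter_upwards [hK.ae_eq_mk] with x hx
  by_cases h : x = 0
  · simp [h, hK0]
  · rw [indicator_of_mem (by simpa using h), ← hx]

end Modification

/-! ### The moment bound -/

section Moment

variable {d k N : ℕ} {φ : Torus d → ℝ} {K : Torus d → Vel d}

/-- The constant of the energy inequality between consecutive marginals. -/
def hierConst (d : ℕ) (q τ : ℝ) : ℝ :=
  forceConst q τ * (1 / youngConst d q τ) ^ ((q - 2) / 2) *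
    (d * gaussConst d q (1 / (4 * lamConst q τ)))

lemma hierConst_pos (hd : 0 < d) {q τ : ℝ} (hq : 2 ≤ q) (hτ : 0 < τ) : 0 < hierConst d q τ := by
  have h1 := forceConst_pos hq hτ
  have h2 := youngConst_pos hd hq hτ
  have h3 := lamConst_pos hq hτ
  have h4 := gaussConst_pos (d := d) hq (by positivity : 0 < 1 / (4 * lamConst q τ))
  have h5 : (0 : ℝ) < d := by exact_mod_cast hd
  unfold hierConst; positivity

lemma weightedInt_mono (hφ : ∀ x, 0 ≤ φ x) {q l l' : ℝ} (h : l ≤ l') (g : Config d k → ℝ) :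
    weightedInt N φ q l g ≤ weightedInt N φ q l' g := by
  refine lintegral_mono fun z => ENNReal.ofReal_le_ofReal ?_
  have := energy_nonneg (N := N) hφ z
  gcongr

/-- The weighted integral is lower semicontinuous in the exponent of the weight. -/
lemma weightedInt_le_of_tendsto (hφm : Measurable φ) {q l : ℝ} {g : Config d k → ℝ}
    (hg : Measurable g) {κ : ℕ → ℝ} (hκ : Tendsto κ atTop (𝓝 l)) {B : ℝ≥0∞}
    (hB : ∀ n, weightedInt N φ q (κ n) g ≤ B) : weightedInt N φ q l g ≤ B := by
  calc weightedInt N φ q l g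
      = ∫⁻ z, liminf (fun n => ENNReal.ofReal (|g z| ^ q * Real.exp (κ n * energy N φ z)))
          atTop := by
        refine lintegral_congr fun z => (Tendsto.liminf_eq ?_).symm
        exact (ENNReal.continuous_ofReal.tendsto _).comp (tendsto_const_nhds.mul
          ((Real.continuous_exp.tendsto _).comp (hκ.mul_const _)))
    _ ≤ liminf (fun n => weightedInt N φ q (κ n) g) atTop :=
        lintegral_liminf_le fun n => ((hg.abs.pow_const q).mul (Real.measurable_exp.comp
          (measurable_const.mul (measurable_energy hφm)))).ennreal_ofReal
    _ ≤ B := liminf_le_of_frequently_le' (Eventually.frequently (Eventually.of_forall hB))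

lemma lam_eq (Lam t : ℝ) : lam Lam t = 1 / Lam / (1 + t) := by
  rw [lam, div_div]

lemma rate_hierConst {Lam : ℝ} (hLam : 0 < Lam) (c : ℝ) (p : ℝ≥0∞) (q : ℝ)
    (K : Torus d → Vel d) :
    rate Lam (c * lam Lam 1) 1 p q K = c * (eLpNorm K p volume).toReal ^ q := by
  have h : lam Lam 1 ≠ 0 := by unfold lam; positivity
  rw [rate, Real.rpow_one, mul_div_cancel_right₀ _ h]

lemma IsEntropySolution.exists_isControlled {σ q lam₀ : ℝ} {f : ℝ → Config d N → ℝ}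
    (hf : IsEntropySolution σ φ K q lam₀ f) (hφ : ∀ x, 0 ≤ φ x) (hK : Measurable K)
    (hK0 : K 0 = 0) (hq : 2 ≤ q)
    (hKq : eLpNorm K (ENNReal.ofReal (q / (q - 1))) volume ≠ ⊤) {c : ℝ} (hc : 0 < c)
    {l : ℝ → ℝ} (hl : ∀ t ∈ Icc (0 : ℝ) 1, c ≤ l t) {B : ℝ≥0∞} (hB : B ≠ ⊤)
    (hfB : ∀ t ∈ Icc (0 : ℝ) 1, weightedInt N φ q (l t) (f t) ≤ B) :
    ∃ M, ∀ t ∈ Icc (0 : ℝ) 1, IsControlled K M (f t) := by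
  obtain ⟨β, hβ, V, hV, hdecay⟩ := hf.gaussian_decay
  obtain ⟨M, hM⟩ := Hierarchy.exists_isControlled (N := N) hK hK0 hq hc hKq
    (B := ENNReal.ofReal (V ^ N)) ENNReal.ofReal_ne_top hB
  refine ⟨M, fun t ht => hM _ (hf.measurable.comp measurable_prodMk_left)
    (le_trans (lintegral_mono fun z => ?_) (hdecay t ht))
    (le_trans (lintegral_mono fun z => ?_) ((weightedInt_mono hφ (hl t ht) _).trans (hfB t ht)))⟩
  · rw [← ofReal_norm, Real.norm_eq_abs]
    refine ENNReal.ofReal_le_ofReal (le_mul_of_one_le_left (abs_nonneg _)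
      (Real.one_le_exp (by positivity)))
  · rw [velWeight, ← ofReal_mul_abs_rpow (Real.exp_pos _).le (by linarith), mul_comm]
    refine ENNReal.ofReal_le_ofReal (mul_le_mul_of_nonneg_left (Real.exp_le_exp.2
      (mul_le_mul_of_nonneg_left ?_ hc.le)) (by positivity))
    have := sum_sq_velocity_le_energy (N := N) hφ z
    linarith [(Nat.cast_nonneg N : (0 : ℝ) ≤ N)]

/-- The bound on the marginals, for a weight strictly below the critical one. -/
lemma weightedInt_marginal_le_hierBound (hd : 0 < d) {σ q : ℝ} (hσ : 0 < σ) (hq : 2 ≤ q)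
    (hφm : Measurable φ) (hφ : ∀ x, 0 ≤ φ x) (hK : Measurable K) (hK0 : K 0 = 0)
    {p : ℝ≥0∞} (hp : ENNReal.ofReal (q / (q - 1)) ≤ p) (hKp : MemLp K p)
    {f : ℝ → Config d N → ℝ}
    (hf : IsEntropySolution σ φ K q (lam (lamConst q (σ ^ 2 / 2)) 0) f) {F₀ F : ℝ} (hF₀ : 0 < F₀)
    (hF : 0 < F) (hinit : ∀ (k : ℕ) (hk : k ≤ N), 1 ≤ k →
      weightedInt N φ q (lam (lamConst q (σ ^ 2 / 2)) 0) (marginal hk (f 0)) ≤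
        ENNReal.ofReal (F₀ ^ k))
    (hfull : ∀ t ∈ Icc (0 : ℝ) 1, weightedInt N φ q (lam (lamConst q (σ ^ 2 / 2)) t) (f t) ≤
      ENNReal.ofReal (F ^ N)) {T : ℝ} (hT : T ≤ 1)
    (hsmall : F₀ * (hierConst d q (σ ^ 2 / 2) * (eLpNorm K p volume).toReal ^ q) * T ≤ 1 / 4)
    {κ : ℝ} (hκ : 1 / (2 * lamConst q (σ ^ 2 / 2)) ≤ κ) (hκ' : κ < 1 / lamConst q (σ ^ 2 / 2))
    (k : ℕ) (hk : k ≤ N) (hk1 : 1 ≤ k) (t : ℝ) (ht : t ∈ Icc 0 T) :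
    weightedInt N φ q (κ / (1 + t)) (marginal hk (f t)) ≤ ENNReal.ofReal (hierBound N F₀ F
      (hierConst d q (σ ^ 2 / 2) * (eLpNorm K p volume).toReal ^ q) k t) := by
  set τ := σ ^ 2 / 2 with hτ
  have hτ0 : 0 < τ := by positivity
  have hΛ := lamConst_pos hq hτ0
  have hκp : 0 < κ := lt_of_lt_of_le (by positivity) hκ
  have hlam0 : lam (lamConst q τ) 0 = 1 / lamConst q τ := by simp [lam]
  have hKle : eLpNorm K (ENNReal.ofReal (q / (q - 1))) volume ≤ eLpNorm K p volume :=
    eLpNorm_le_eLpNorm_of_exponent_le hp hK.aestronglyMeasurable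
  have hKq : eLpNorm K (ENNReal.ofReal (q / (q - 1))) volume ≠ ⊤ :=
    ne_top_of_le_ne_top hKp.2.ne hKle
  have hT1 {s : ℝ} (hs : s ∈ Icc 0 T) : s ∈ Icc (0 : ℝ) 1 := ⟨hs.1, hs.2.trans hT⟩
  obtain ⟨M, hM⟩ := hf.exists_isControlled hφ hK hK0 hq hKq
    (c := 1 / (2 * lamConst q τ)) (by positivity) (l := lam (lamConst q τ)) (fun s hs => by
      unfold lam
      refine one_div_le_one_div_of_le (mul_pos hΛ (by linarith [hs.1])) ?_
      nlinarith [hs.2]) ENNReal.ofReal_ne_top hfull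
  refine hierarchy_le hF₀ hF (mul_nonneg (hierConst_pos hd hq hτ0).le (by positivity)) hsmall
    (fun k hk t => weightedInt N φ q (κ / (1 + t)) (marginal hk (f t))) (fun t ht => ?_)
    (fun k hk hk1 => ?_) (fun k hk hk1 t ht B hB hgB => ?_) k hk hk1 t ht
  · rw [marginal_self]
    refine (weightedInt_mono hφ ?_ _).trans (hfull t (hT1 ht))
    rw [lam_eq]
    exact div_le_div_of_nonneg_right hκ'.le (by linarith [ht.1])
  · refine (weightedInt_mono hφ ?_ _).trans (hinit k hk hk1)
    rw [hlam0, add_zero, div_one]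
    exact hκ'.le
  · have h := weightedInt_marginal_le hd hq hσ hφm hφ hK hf.weak_solution hf.measurable hM
      hf.symmetric hKq hk hκ hκ'.le (hT1 ht)
      (hf.entropy k (Nat.le_of_succ_le hk) hk1 t (hT1 ht) κ hκp (by rw [hlam0]; exact hκ')) hB hgB
    simp only [add_zero, div_one]
    refine h.trans (add_le_add le_rfl ?_)
    rw [← hτ]
    set Y := forceConst q τ * (1 / youngConst d q τ) ^ ((q - 2) / 2) with hY
    set G := gaussConst d q (1 / (4 * lamConst q τ)) with hG
    set S := ∫⁻ s in Icc 0 t, weightedInt N φ q (κ / (1 + s)) (marginal hk (f s))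
    have hY0 : 0 ≤ Y := by
      have h1 := forceConst_pos hq hτ0
      have h2 := youngConst_pos hd hq hτ0
      positivity
    have hG0 : 0 ≤ G := (gaussConst_pos hq (by positivity)).le
    have hKr : eLpNorm K p volume ^ q =
        ENNReal.ofReal ((eLpNorm K p volume).toReal ^ q) := by
      rw [← ENNReal.ofReal_rpow_of_nonneg ENNReal.toReal_nonneg (by linarith),
        ENNReal.ofReal_toReal hKp.2.ne]
    have hconst : ENNReal.ofReal (k * (hierConst d q τ * (eLpNorm K p volume).toReal ^ q)) =
        ENNReal.ofReal Y * (k * (d * (ENNReal.ofReal G * eLpNorm K p volume ^ q))) := by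
      rw [hKr, ← ENNReal.ofReal_natCast k, ← ENNReal.ofReal_natCast d,
        ← ENNReal.ofReal_mul hG0, ← ENNReal.ofReal_mul (by positivity),
        ← ENNReal.ofReal_mul (by positivity), ← ENNReal.ofReal_mul hY0]
      congr 1
      rw [hierConst]
      ring
    rw [hconst]
    calc ENNReal.ofReal Y * (k * (d * (ENNReal.ofReal G *
          eLpNorm K (ENNReal.ofReal (q / (q - 1))) volume ^ q * S)))
        ≤ ENNReal.ofReal Y * (k * (d * (ENNReal.ofReal G * eLpNorm K p volume ^ q * S))) := by
          gcongr
      _ = _ := by ring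

lemma holderConjugate_le {q : ℝ} (hq : 2 ≤ q) {p : ℝ≥0∞}
    (h : (ENNReal.ofReal q)⁻¹ + p⁻¹ ≤ 1) : ENNReal.ofReal (q / (q - 1)) ≤ p := by
  have hq0 : 0 < q := by linarith
  have hq1 : 0 < q - 1 := by linarith
  rw [← ENNReal.inv_le_inv, ← ENNReal.ofReal_inv_of_pos (by positivity)]
  have h1 : ENNReal.ofReal q⁻¹ + p⁻¹ ≤ ENNReal.ofReal q⁻¹ + ENNReal.ofReal (q / (q - 1))⁻¹ := by
    rw [← ENNReal.ofReal_add (by positivity) (by positivity)]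
    have e : q⁻¹ + (q / (q - 1))⁻¹ = 1 := by field_simp; ring
    rw [e, ENNReal.ofReal_one, ENNReal.ofReal_inv_of_pos hq0]
    exact h
  exact (ENNReal.add_le_add_iff_left ENNReal.ofReal_ne_top).1 h1

end Moment

end Hierarchy

end

open Hierarchy
theorem proposition2p3 (d : ℕ) (hd : 0 < d) (σ : ℝ) (hσ : 0 < σ) (q : ℝ) (hq : 2 ≤ q) :
    ∃ Lam C θ : ℝ, 0 < Lam ∧ 0 < C ∧ 0 < θ ∧
      ∀ (p : ℝ≥0∞), 1 < p → (ENNReal.ofReal q)⁻¹ + p⁻¹ ≤ 1 →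
      ∀ (φ : Torus d → ℝ) (K : Torus d → Vel d), IsRepulsive p φ K →
      ∀ (N : ℕ) (f : ℝ → Config d N → ℝ), IsEntropySolution σ φ K q (lam Lam 0) f →
      ∀ F₀ F : ℝ, 0 < F₀ → 0 < F →
      (∀ (k : ℕ) (hk : k ≤ N), 1 ≤ k →
        weightedInt N φ q (lam Lam 0) (marginal hk (f 0)) ≤ ENNReal.ofReal (F₀ ^ k)) →
      (∀ t ∈ Icc (0 : ℝ) 1, weightedInt N φ q (lam Lam t) (f t) ≤ ENNReal.ofReal (F ^ N)) →
      ∀ T : ℝ, T ≤ 1 → 4 * rate Lam C θ p q K * max F₀ F * T ≤ 1 →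
      ∀ (k : ℕ) (hk : k ≤ N), 1 ≤ k → ∀ t ∈ Icc (0 : ℝ) T,
        weightedInt N φ q (lam Lam t) (marginal hk (f t)) ≤
          ENNReal.ofReal (2 ^ k * F₀ ^ k + F ^ k * (2 : ℝ) ^ (2 * (k : ℤ) - (N : ℤ) - 1)) := by
  have hτ : 0 < σ ^ 2 / 2 := by positivity
  have hΛ := lamConst_pos hq hτ
  have hc := hierConst_pos hd hq hτ
  set Λ := lamConst q (σ ^ 2 / 2) with hΛdef
  refine ⟨Λ, hierConst d q (σ ^ 2 / 2) * lam Λ 1, 1, hΛ,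
    mul_pos hc (by unfold lam; positivity), one_pos, ?_⟩
  intro p _ hp φ K hφK N f hf F₀ F hF₀ hF hinit hfull T hT hsmall k hk hk1 t ht
  obtain ⟨φ', hφm, hφ, hφ0, hφφ⟩ := exists_measurable_potential hφK.integrable.1 hφK.nonneg
    hφK.potential_zero
  obtain ⟨K', hK, hK0, hKK⟩ := exists_measurable_force hφK.memLp.1 hφK.kernel_zero
  have hφ0' : φ 0 = φ' 0 := hφK.potential_zero.trans hφ0.symm
  have hf' := hf.congr hφ0' hφφ (hφK.kernel_zero.trans hK0.symm) hKK
  have hKp : MemLp K' p := (memLp_congr_ae hKK).1 hφK.memLp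
  simp only [weightedInt_congr hφ0' hφφ] at hinit hfull ⊢
  rw [rate_hierConst hΛ, eLpNorm_congr_ae hKK] at hsmall
  set L := hierConst d q (σ ^ 2 / 2) * (eLpNorm K' p volume).toReal ^ q with hL
  have hL0 : 0 ≤ L := by positivity
  have hT0 : 0 ≤ T := ht.1.trans ht.2
  have hsm {x s : ℝ} (hx : x ≤ max F₀ F) (hs : s ∈ Icc 0 T) : x * L * s ≤ 1 / 4 := by
    have h1 : x * L * s ≤ max F₀ F * L * T :=
      mul_le_mul (mul_le_mul_of_nonneg_right hx hL0) hs.2 hs.1 (by positivity)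
    linarith
  have hTT : T ∈ Icc 0 T := ⟨hT0, le_rfl⟩
  refine le_trans ?_ (ENNReal.ofReal_le_ofReal (hierBound_le hF₀ hF hL0 hk1 hk ht.1
    (hsm (le_max_left _ _) ht) (hsm (le_max_right _ _) ht)))
  have hm : Measurable (marginal hk (f t)) :=
    (measurable_marginal hk hf.measurable).comp measurable_prodMk_left
  set κ : ℕ → ℝ := fun n => 1 / Λ * (1 - 1 / ((n : ℝ) + 1) / 2) with hκ
  have hlim : Tendsto (fun n => κ n / (1 + t)) atTop (𝓝 (lam Λ t)) := by
    have h1 : Tendsto κ atTop (𝓝 (1 / Λ * (1 - 0 / 2))) :=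
      (((tendsto_one_div_add_atTop_nhds_zero_nat (𝕜 := ℝ)).div_const 2).const_sub 1).const_mul _
    rw [lam_eq]
    simpa using h1.div_const (1 + t)
  refine weightedInt_le_of_tendsto hφm hm hlim fun n => ?_
  have hn : 0 < 1 / ((n : ℝ) + 1) := by positivity
  have hn1 : 1 / ((n : ℝ) + 1) ≤ 1 := by
    rw [div_le_one (by positivity)]
    linarith [(Nat.cast_nonneg n : (0 : ℝ) ≤ n)]
  refine weightedInt_marginal_le_hierBound hd hσ hq hφm hφ hK hK0 (holderConjugate_le hq hp) hKp
    hf' hF₀ hF hinit hfull hT (hsm (le_max_left _ _) hTT) ?_ ?_ k hk hk1 t ht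
  · rw [← one_div_mul_one_div]
    simp only [hκ]
    rw [← hΛdef]
    have := one_div_pos.2 hΛ
    nlinarith
  · simp only [hκ]
    rw [← hΛdef]
    have := one_div_pos.2 hΛ
    nlinarith
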